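/- **Setting.** Let $\mathcal C=\{x\in\mathbb R^n:\varphi_i(x)\le 0\ (i=1,\dots,m),\ Cx=d\}$, where $C\in\mathbb R^{p\times n}$ has rank $p$ and each $\varphi_i:\mathbb R^n\to\mathbb R$ is convex and $C^1$. Put $\mathcal C_= =\{x: Cx=d\}$ and $\mathcal C_<=\{x:\varphi(x)<0\}$; assume that $\mathcal C$ is compact and $\mathcal C_<\cap\mathcal C_=\neq\emptyset$. For $r,s>0$ let $\hat{\mathcal C}_r=\{x:Cx=d,\ \varphi(x)\le r e\}$ and $\tilde{\mathcal C}_s=\{x:\|Cx-d\|\le s,\ \varphi(x)\le 0\}$. Let $F$ be an $\mathbb R^n$-valued operator that is monotone and $L$-Lipschitz ($L>0$) on $\mathcal C_=$, and assume that $F$ is strictly monotone on $\mathcal C$ or that some $\varphi_i$ is strictly convex. Let $x^\star\in\mathcal C$ solve the variational inequality $\langle F(x^\star),x-x^\star\rangle\ge 0$ for all $x\in\mathcal C$. Let $c>0$, $\xi>1$ and assume that $F$ is star-$\xi$-monotone, i.e. $\langle x-x^\star,F(x)-F(x^\star)\rangle\ge c\|x-x^\star\|^\xi$, for all $x\in\hat{\mathcal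 C}_r$ for some $r>0$, or for all $x\in\tilde{\mathcal C}_s$ for some $s>0$. **Algorithm (ACVI).** Given $\mu_{-1}>0$, $\beta>0$, $\delta\in(0,1)$, $(y^{(0)}_0,\lambda^{(0)}_0)\in\mathbb R^n\times\mathbb R^n$ and numbers $T,K$ of outer and inner iterations, let $P_c=I-C^\top(CC^\top)^{-1}C$, $d_c=C^\top(CC^\top)^{-1}d$, $\mu_t=\delta^{t+1}\mu_{-1}$. For $t=0,\dots,T-1$ and $k=0,\dots,K-1$: $x^{(t)}_{k+1}$ solves $x+\frac1\beta P_cF(x)-P_cy^{(t)}_k+\frac1\beta P_c\lambda^{(t)}_k-d_c=0$; $y^{(t)}_{k+1}$ minimizes $-\mu_t\sum_i\log(-\varphi_i(y))+\frac\beta2\|y-x^{(t)}_{k+1}-\frac1\beta\lambda^{(t)}_k\|^2$ over $\mathcal C_<$; $\lambda^{(t)}_{k+1}=\lambda^{(t)}_k+\beta(x^{(t)}_{k+1}-y^{(t)}_{k+1})$. After the inner loop, $(y^{(t+1)}_0,\lambda^{(t+1)}_0)=(y^{(t)}_K,\lambda^{(t)}_K)$. Let $\hat x^{(t)}_K=\frac1K\sum_{k=1}^Kx^{(t)}_k$.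 **Central path.** For $\mu>0$, $x^\mu$ is the point with $\varphi(x^\mu)<0$, $Cx^\mu=d$ for which there are $\bar\lambda\in\mathbb R^m_{>0}$, $\nu\in\mathbb R^p$ with $F(x^\mu)+\sum_i\bar\lambda_i\nabla\varphi_i(x^\mu)+C^\top\nu=0$ and $\bar\lambda_i\varphi_i(x^\mu)=-\mu$ for all $i$; and $\lambda^\mu\in\mathbb R^n$ is the multiplier of the constraint $x=y$ at the solution $x=y=x^\mu$ of $\min_{x\in\mathcal C_=,\,y\in\mathcal C_<}\ \langle F(x^\mu),x\rangle-\mu\sum_i\log(-\varphi_i(y))$ subject to $x=y$. **Notation.** $\mathcal G(x,\mathcal C)=\max_{z\in\mathcal C}\langle F(x),x-z\rangle$, $M=\sup_{x\in\mathcal C}\|F(x)\|$, $D=\max_{x\in\mathcal C}\|x^\star-x\|$, $M_0=DL+M$, $\Delta^{\mu_t}=\frac1\beta\|\lambda^{(t)}_0-\lambda^{\mu_t}\|^2+\beta\|y^{(t)}_0-x^{\mu_t}\|^2$, and $M_1=\left(\frac mc\mu_{-1}\right)^{1/\xi}+2\sqrt{\Delta^{\mu_t}/\beta}+\frac ML$.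 **Theorem.** For every $\mu>0$ the pair $(x^\mu,\lambda^\mu)$ exists and is unique, and the iterates of ACVI exist for all $T,K$. Moreover, for every $\mu_{-1}>0$ and every $T$ there is $K_0\in\mathbb N$ such that for all $K>K_0$ and all $t<T$: 1. $\displaystyle \|x^{(t)}_K-x^\star\|\le b:=\left(\frac2c\left(\frac{\Delta^{\mu_t}}K+\frac{2\Delta^{\mu_t}}{\sqrt K}+\|\lambda^{\mu_t}\|\sqrt{\frac{\Delta^{\mu_t}}{\beta K}}\right)+\frac{LM_1}c\left(\frac mc\mu_{-1}\right)^{1/\xi}\delta^{(t+1)/\xi}\right)^{1/\xi}$ and $\mathcal G(x^{(t)}_K,\mathcal C)\le M_0\,b$. 2. If in addition $F$ is $\xi$-monotone on $\mathcal C_=$, i.e. $\langle x-x',F(x)-F(x')\rangle\ge c\|x-x'\|^\xi$ for all $x,x'\in\mathcal C_=$, then $\displaystyle\|\hat x^{(t)}_K-x^\star\|\le \hat b:=\left(\frac{\Delta^{\mu_t}}{cK}\right)^{1/\xi}+\left(\frac mc\mu_t\right)^{1/\xi}$ and $\mathcal G(\hat x^{(t)}_K,\mathcal C)\le M_0\,\hat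 b$. If star-$\xi$-monotonicity holds on some $\hat{\mathcal C}_r$, then $K_0$ can be chosen independently of $T$. Finally, there are constants $A,B,K_0$, independent of $T,K,t$, such that for all $T$, all $K>K_0$ and all $t<T$ with $t\ge A\ln K$: $\|x^{(t)}_K-x^\star\|$ and $\mathcal G(x^{(t)}_K,\mathcal C)$ are at most $B K^{-1/(2\xi)}$; and, if $F$ is $\xi$-monotone on $\mathcal C_=$ as in 2, $\|\hat x^{(t)}_K-x^\star\|$ and $\mathcal G(\hat x^{(t)}_K,\mathcal C)$ are at most $B K^{-1/\xi}$. -/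

import Mathlib

namespace ACVI

/-- `ℝⁿ` with the Euclidean norm. -/
abbrev Vec (n : ℕ) : Type := EuclideanSpace ℝ (Fin n)

/-- The data of a constraint set `{x ∈ ℝⁿ | φ i x ≤ 0 for all i, C x = d}`. -/
structure Constraints (n m p : ℕ) where
  C : Matrix (Fin p) (Fin n) ℝ
  d : Vec p
  φ : Fin m → Vec n → ℝ

section Sets

variable {n m p : ℕ} (P : Constraints n m p)

/-- The affine subspace `{x | C x = d}`. -/
def Constraints.eqSet : Set (Vec n) := {x | Matrix.toEuclideanLin P.C x = P.d}

/-- The strict inequality set `{x | φ x < 0}`; it is the domain of the log-barrier. -/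
def Constraints.ltSet : Set (Vec n) := {x | ∀ i, P.φ i x < 0}

/-- The whole constraint set `{x | φ x ≤ 0, C x = d}`. -/
def Constraints.feasible : Set (Vec n) := {x | (∀ i, P.φ i x ≤ 0) ∧ x ∈ P.eqSet}

/-- `{x | C x = d, φ x ≤ r e}`. -/
def Constraints.hatSet (r : ℝ) : Set (Vec n) := {x | x ∈ P.eqSet ∧ ∀ i, P.φ i x ≤ r}

/-- `{x | ‖C x - d‖ ≤ s, φ x ≤ 0}`. -/
def Constraints.tildeSet (s : ℝ) : Set (Vec n) :=
  {x | ‖Matrix.toEuclideanLin P.C x - P.d‖ ≤ s ∧ ∀ i, P.φ i x ≤ 0}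

/-- Standing assumptions on the constraints: `C` has full row rank, every `φ i` is convex and
continuously differentiable on `ℝⁿ`, the relative interior `{φ < 0} ∩ {C x = d}` is nonempty, and
the constraint set is compact. -/
structure Constraints.Regular : Prop where
  rank_eq : P.C.rank = p
  contDiff : ∀ i, ContDiff ℝ 1 (P.φ i)
  convex : ∀ i, ConvexOn ℝ Set.univ (P.φ i)
  interior_nonempty : (P.ltSet ∩ P.eqSet).Nonempty
  compact : IsCompact P.feasible

end Sets

section Operators

variable {n : ℕ}

/-- `F` is monotone on `S`. -/
def MonotoneOp (F : Vec n → Vec n) (S : Set (Vec n)) : Prop :=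
  ∀ x ∈ S, ∀ x' ∈ S, 0 ≤ inner ℝ (x - x') (F x - F x')

/-- `F` is strictly monotone on `S`. -/
def StrictMonotoneOp (F : Vec n → Vec n) (S : Set (Vec n)) : Prop :=
  ∀ x ∈ S, ∀ x' ∈ S, x ≠ x' → 0 < inner ℝ (x - x') (F x - F x')

/-- `F` is `ξ`-monotone on `S` with constant `c`. -/
def XiMonotoneOp (F : Vec n → Vec n) (S : Set (Vec n)) (c ξ : ℝ) : Prop :=
  ∀ x ∈ S, ∀ x' ∈ S, c * ‖x - x'‖ ^ ξ ≤ inner ℝ (x - x') (F x - F x')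

/-- `F` is star-`ξ`-monotone on `S` with constant `c`, relative to the point `xstar`. -/
def StarXiMonotoneOp (F : Vec n → Vec n) (S : Set (Vec n)) (xstar : Vec n) (c ξ : ℝ) : Prop :=
  ∀ x ∈ S, c * ‖x - xstar‖ ^ ξ ≤ inner ℝ (x - xstar) (F x - F xstar)

/-- `F` is `L`-Lipschitz on `S`. -/
def LipschitzOp (F : Vec n → Vec n) (S : Set (Vec n)) (L : ℝ) : Prop :=
  ∀ x ∈ S, ∀ x' ∈ S, ‖F x - F x'‖ ≤ L * ‖x - x'‖

/-- `x` solves the variational inequality of `F` over `S`. -/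
def IsVISolution (F : Vec n → Vec n) (S : Set (Vec n)) (x : Vec n) : Prop :=
  x ∈ S ∧ ∀ z ∈ S, 0 ≤ inner ℝ (F x) (z - x)

/-- The gap function `max_{z ∈ S} ⟨F x, x - z⟩` (the maximum exists for `S` compact, nonempty). -/
noncomputable def gap (F : Vec n → Vec n) (S : Set (Vec n)) (x : Vec n) : ℝ :=
  sSup ((fun z : Vec n => (inner ℝ (F x) (x - z) : ℝ)) '' S)

/-- `sup_{z ∈ S} ‖F z‖`. -/
noncomputable def supNorm (F : Vec n → Vec n) (S : Set (Vec n)) : ℝ :=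
  sSup ((fun z : Vec n => ‖F z‖) '' S)

/-- The largest distance from `x` to a point of `S`. -/
noncomputable def maxDist (S : Set (Vec n)) (x : Vec n) : ℝ :=
  sSup ((fun z : Vec n => ‖x - z‖) '' S)

end Operators

section CentralPath

variable {n m p : ℕ} (P : Constraints n m p)

/-- The scaled log-barrier `-μ ∑ i, log (-φ i y)`, meaningful on `P.ltSet`. -/
noncomputable def Constraints.barrier (μ : ℝ) (y : Vec n) : ℝ :=
  -μ * ∑ i, Real.log (-(P.φ i y))

/-- `x` is the central path point at `μ`: with some multipliers `lam : ℝᵐ`, `nu : ℝᵖ` it solves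
the perturbed KKT system of the variational inequality. -/
def IsCentralPoint (F : Vec n → Vec n) (μ : ℝ) (x : Vec n) : Prop :=
  ∃ (lam : Fin m → ℝ) (nu : Vec p),
    F x + ∑ i, lam i • gradient (P.φ i) x + Matrix.toEuclideanLin P.C.transpose nu = 0 ∧
    (∀ i, lam i * P.φ i x + μ = 0) ∧
    Matrix.toEuclideanLin P.C x = P.d ∧
    (∀ i, P.φ i x < 0) ∧ (∀ i, 0 < lam i)

/-- `(x, x, l)` is a KKT point of the split problem `min f(x) + g(y)` subject to `x = y`, where
`f(z) = ⟨F x, z⟩` on `{C z = d}` (and `+∞` elsewhere) and `g` is the log-barrier scaled by `μ`: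
`0 ∈ ∂f(x) + l` and `0 ∈ ∂g(x) - l`. -/
def IsSplitMultiplier (F : Vec n → Vec n) (μ : ℝ) (x l : Vec n) : Prop :=
  (x ∈ P.eqSet ∧ ∀ z ∈ P.eqSet, inner ℝ (F x) x - inner ℝ l (z - x) ≤ (inner ℝ (F x) z : ℝ)) ∧
  (x ∈ P.ltSet ∧ ∀ z ∈ P.ltSet, P.barrier μ x + inner ℝ l (z - x) ≤ P.barrier μ z)

/-- `x = x^μ` is the central path point at `μ` and `l = λ^μ` is the multiplier of the split
problem at it. -/
def IsCentralPair (F : Vec n → Vec n) (μ : ℝ) (x l : Vec n) : Prop :=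
  IsCentralPoint P F μ x ∧ IsSplitMultiplier P F μ x l

end CentralPath

section Algorithm

variable {n m p : ℕ} (P : Constraints n m p)

/-- `P_c = I - Cᵀ (C Cᵀ)⁻¹ C`. -/
noncomputable def Constraints.Pc : Vec n →ₗ[ℝ] Vec n :=
  Matrix.toEuclideanLin (1 - P.C.transpose * (P.C * P.C.transpose)⁻¹ * P.C)

/-- `d_c = Cᵀ (C Cᵀ)⁻¹ d`. -/
noncomputable def Constraints.dc : Vec n :=
  Matrix.toEuclideanLin (P.C.transpose * (P.C * P.C.transpose)⁻¹) P.d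

/-- The barrier parameter `μ_t = δ^{t+1} μ_{-1}`. -/
noncomputable def muSeq (μinit δ : ℝ) (t : ℕ) : ℝ := δ ^ (t + 1) * μinit

/-- `x t k`, `y t k`, `lam t k` are the iterates of the ACVI algorithm with hyperparameters
`μ_{-1} = μinit`, `β`, `δ`, initial point `(y₀, l₀)`, `T` outer and `K` inner iterations.
(`x t 0` is not produced by the algorithm.) -/
structure IsACVIRun (F : Vec n → Vec n) (μinit β δ : ℝ) (y₀ l₀ : Vec n) (T K : ℕ)
    (x y lam : ℕ → ℕ → Vec n) : Prop where
  init_y : y 0 0 = y₀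
  init_lam : lam 0 0 = l₀
  x_step : ∀ t < T, ∀ k < K,
    x t (k + 1) + (1 / β) • P.Pc (F (x t (k + 1))) - P.Pc (y t k) + (1 / β) • P.Pc (lam t k)
      - P.dc = 0
  y_mem : ∀ t < T, ∀ k < K, y t (k + 1) ∈ P.ltSet
  y_step : ∀ t < T, ∀ k < K,
    IsMinOn (fun z => P.barrier (muSeq μinit δ t) z
      + β / 2 * ‖z - x t (k + 1) - (1 / β) • lam t k‖ ^ 2) P.ltSet (y t (k + 1))
  lam_step : ∀ t < T, ∀ k < K, lam t (k + 1) = lam t k + β • (x t (k + 1) - y t (k + 1))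
  warm_y : ∀ t < T, y (t + 1) 0 = y t K
  warm_lam : ∀ t < T, lam (t + 1) 0 = lam t K

/-- The average `(1/K) ∑_{k=1}^K x_k`. -/
noncomputable def average (x : ℕ → Vec n) (K : ℕ) : Vec n :=
  (1 / (K : ℝ)) • ∑ k ∈ Finset.Icc 1 K, x k

/-- `Δ = (1/β) ‖λ₀ - λ^μ‖² + β ‖y₀ - y^μ‖²`, for an inner loop that starts at `(y₀, l₀)`; here
`y^μ = x^μ`. -/
noncomputable def Delta (β : ℝ) (y₀ l₀ xμ lμ : Vec n) : ℝ :=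
  1 / β * ‖l₀ - lμ‖ ^ 2 + β * ‖y₀ - xμ‖ ^ 2

/-- The bound on the distance of the last iterate to the solution, with `Δ = Δ^{μ_t}`,
`lnorm = ‖λ^{μ_t}‖`, `M = sup ‖F‖` and `M₁ = (m μ_{-1} / c)^{1/ξ} + 2 √(Δ/β) + M / L`. -/
noncomputable def lastBound (m : ℕ) (c ξ L M β δ μinit Δ lnorm : ℝ) (t K : ℕ) : ℝ :=
  (2 / c * (Δ / K + 2 * Δ / √(K : ℝ) + lnorm * √(Δ / (β * K)))
    + L * ((m / c * μinit) ^ (1 / ξ) + 2 * √(Δ / β) + M / L) / c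
      * (m / c * μinit) ^ (1 / ξ) * δ ^ (((t : ℝ) + 1) / ξ)) ^ (1 / ξ)

/-- The bound on the distance of the average iterate to the solution. -/
noncomputable def avgBound (m : ℕ) (c ξ μt Δ : ℝ) (K : ℕ) : ℝ :=
  (Δ / (c * K)) ^ (1 / ξ) + (m / c * μt) ^ (1 / ξ)

/-- The explicit bounds at the outer iteration `t` of a run with `K` inner iterations whose
iterates are `x, y, lam`; `xμ, lμ` is the central path with its multipliers. -/
def ExplicitBounds (F : Vec n → Vec n) (L c ξ : ℝ) (xstar : Vec n) (μinit β δ : ℝ)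
    (xμ lμ : ℝ → Vec n) (K : ℕ) (x y lam : ℕ → ℕ → Vec n) (t : ℕ) : Prop :=
  let μt := muSeq μinit δ t
  let Δ := Delta β (y t 0) (lam t 0) (xμ μt) (lμ μt)
  let M := supNorm F P.feasible
  let M₀ := maxDist P.feasible xstar * L + M
  let bLast := lastBound m c ξ L M β δ μinit Δ ‖lμ μt‖ t K
  let bAvg := avgBound m c ξ μt Δ K
  (‖x t K - xstar‖ ≤ bLast ∧ gap F P.feasible (x t K) ≤ M₀ * bLast) ∧
  (XiMonotoneOp F P.eqSet c ξ →
    ‖average (x t) K - xstar‖ ≤ bAvg ∧ gap F P.feasible (average (x t) K) ≤ M₀ * bAvg)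

end Algorithm

end ACVI

/-!
The proof treats the algorithm as an alternating direction method whose centre, the central path,
moves from one outer iteration to the next.

*Existence.* The barrier has an explicit gradient, and its proximal step is solvable because the
barrier is bounded below by an affine function and blows up at the boundary. A strongly monotone
perturbation of `F` plus the barrier gradient then has a zero modulo the normal space of
`{C x = d}`, by Banach's fixed point theorem for the forward-backward map
(`exists_isNormal_add_smul_add_barrierGrad`). With no inequality constraints this is the `x`-step;
letting the perturbation vanish gives the central path (`exists_central_point`), where compactness
and a bound on the barrier keep the limit strictly feasible. The multiplier at the central point is
forced to be the barrier gradient (`isCentralPair_iff`), and strict monotonicity of `F` or of the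
barrier gradient gives uniqueness.

*Inner loop.* The weighted squared distance to the central pair decreases along the inner loop by at
least twice the operator gap plus the squared residual
(`IsInnerLoop.two_mul_inner_add_le`). From the second iteration on the multipliers are gradients of
one convex function, so the residuals decrease and the last one is `O(1 / √K)`
(`IsInnerLoop.last_residual_sq_le`); hence the operator gap of the last iterate is at most
`2 Δ / √K` (`IsInnerLoop.inner_last_le`). Telescoping and convexity give `O(1 / K)` for the average
(`IsInnerLoop.norm_average_sub_central_le`).

*Uniformity.* Slater's condition bounds the multipliers at approximate KKT points
(`exists_multiplier_bound`). Since a long inner loop ends at such a point wherever it started, the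
quantities `Δ` of all outer iterations have a common bound (`exists_Delta_bound`).

*Bounds.* The KKT system gives `c ‖x^μ - xstar‖ ^ ξ ≤ m μ`. Passing from the central point to the
solution costs `L e (2 √(Δ / β) + e)` with `e = (m μ_t / c) ^ (1 / ξ)`, whereas the claimed bound
provides `L e (2 √(Δ / β) + e₀)` with `e₀ = (m μ_{-1} / c) ^ (1 / ξ)`, larger by a fixed factor
because `e ≤ δ ^ (1 / ξ) e₀` (`exists_contraction_factor`). This room absorbs the infeasibility of
the iterates in the estimate of the gap function. If star-monotonicity is available at the last
iterate the factor is uniform in `t`; otherwise the iterate is first projected to the constraint set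
by a linear error bound (`exists_error_bound`), and the error of that step is absorbed for each `t`
separately. For the average the room comes from a factor `1 / 2` and from the slack of the gap
function on the central path (`IsSetting.exists_central_gap_slack`).
-/

namespace ACVI

/-! ### First-order convexity inequalities -/

section Gradient

variable {n : ℕ}

theorem hasDerivAt_comp_line {f : Vec n → ℝ} {g x : Vec n} (hf : HasGradientAt f g x)
    (v : Vec n) : HasDerivAt (fun t : ℝ => f (x + t • v)) (inner ℝ g v) 0 := by
  have h1 : HasDerivAt (fun t : ℝ => x + t • v) v 0 := by
    simpa using ((hasDerivAt_id (0 : ℝ)).smul_const v).const_add x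
  have hf' : HasFDerivAt f (InnerProductSpace.toDual ℝ (Vec n) g) (x + (0 : ℝ) • v) := by
    simpa using hf.hasFDerivAt
  have h2 := hf'.comp_hasDerivAt 0 h1
  rw [InnerProductSpace.toDual_apply_apply] at h2
  exact h2

theorem inner_le_sub_of_convexOn {f : Vec n → ℝ} (hf : ConvexOn ℝ Set.univ f) {g x : Vec n}
    (hg : HasGradientAt f g x) (z : Vec n) : inner ℝ g (z - x) ≤ f z - f x := by
  have hc : ConvexOn ℝ Set.univ (fun t : ℝ => f (x + t • (z - x))) := by
    have h := hf.comp_affineMap (AffineMap.lineMap x z)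
    have e : (f ∘ (AffineMap.lineMap x z : ℝ →ᵃ[ℝ] Vec n)) = fun t : ℝ => f (x + t • (z - x)) := by
      funext t; simp [AffineMap.lineMap_apply, add_comm]
    rwa [e] at h
  have h := hc.le_slope_of_hasDerivAt (Set.mem_univ 0) (Set.mem_univ 1) one_pos
    (hasDerivAt_comp_line hg (z - x))
  simpa [slope_def_field] using h

theorem inner_lt_sub_of_strictConvexOn {f : Vec n → ℝ} (hf : StrictConvexOn ℝ Set.univ f)
    {g x : Vec n} (hg : HasGradientAt f g x) {z : Vec n} (hzx : z ≠ x) :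
    inner ℝ g (z - x) < f z - f x := by
  -- Apply the weak inequality at the midpoint and use strict convexity there.
  have h := inner_le_sub_of_convexOn hf.convexOn hg ((1 / 2 : ℝ) • z + (1 / 2 : ℝ) • x)
  obtain ⟨-, hs⟩ := hf
  have h2 := hs (Set.mem_univ z) (Set.mem_univ x) hzx (show (0 : ℝ) < 1 / 2 by norm_num)
    (show (0 : ℝ) < 1 / 2 by norm_num) (by norm_num)
  have e : (1 / 2 : ℝ) • z + (1 / 2 : ℝ) • x - x = (1 / 2 : ℝ) • (z - x) := by module
  rw [e, inner_smul_right] at h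
  simp only [smul_eq_mul] at h2
  linarith

end Gradient

/-! ### The logarithmic barrier -/

section Barrier

variable {n m p : ℕ} {P : Constraints n m p}

/-- The gradient `∑ i, μ / (-φ i y) • ∇φ i y` of the barrier at `y ∈ {φ < 0}`. -/
noncomputable def Constraints.barrierGrad (P : Constraints n m p) (μ : ℝ) (y : Vec n) : Vec n :=
  ∑ i, (μ / -(P.φ i y)) • gradient (P.φ i) y

theorem hasGradientAt_constraint (hd : ∀ i, ContDiff ℝ 1 (P.φ i)) (i : Fin m) (x : Vec n) :
    HasGradientAt (P.φ i) (gradient (P.φ i) x) x :=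
  (((hd i).differentiable one_ne_zero) x).hasGradientAt

theorem continuous_gradient_constraint (hd : ∀ i, ContDiff ℝ 1 (P.φ i)) (i : Fin m) :
    Continuous (gradient (P.φ i)) :=
  (InnerProductSpace.toDual ℝ (Vec n)).symm.continuous.comp ((hd i).continuous_fderiv one_ne_zero)

theorem isOpen_ltSet (hd : ∀ i, ContDiff ℝ 1 (P.φ i)) : IsOpen P.ltSet := by
  have : P.ltSet = ⋂ i, {x | P.φ i x < 0} := by ext; simp [Constraints.ltSet]
  rw [this]
  exact isOpen_iInter_of_finite fun i => isOpen_lt (hd i).continuous continuous_const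

theorem isClosed_eqSet : IsClosed P.eqSet :=
  isClosed_eq (LinearMap.continuous_of_finiteDimensional _) continuous_const

theorem continuousOn_barrierGrad (hd : ∀ i, ContDiff ℝ 1 (P.φ i)) (μ : ℝ) :
    ContinuousOn (P.barrierGrad μ) P.ltSet := by
  unfold Constraints.barrierGrad
  refine continuousOn_finsetSum _ fun i _ => ContinuousOn.smul (ContinuousOn.div
    continuousOn_const (hd i).continuous.neg.continuousOn fun x hx => ?_)
    (continuous_gradient_constraint hd i).continuousOn
  exact neg_ne_zero.2 (hx i).ne

theorem hasGradientAt_barrier (hd : ∀ i, ContDiff ℝ 1 (P.φ i)) (μ : ℝ) {y : Vec n}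
    (hy : y ∈ P.ltSet) : HasGradientAt (P.barrier μ) (P.barrierGrad μ y) y := by
  have h : ∀ i, HasFDerivAt (fun y => Real.log (-(P.φ i y)))
      ((-(P.φ i y))⁻¹ • -(InnerProductSpace.toDual ℝ (Vec n) (gradient (P.φ i) y))) y := fun i =>
    ((hasGradientAt_constraint hd i y).hasFDerivAt.neg).log (neg_ne_zero.2 (hy i).ne)
  have h2 := (HasFDerivAt.fun_sum (u := Finset.univ) fun i _ => h i).const_mul (-μ)
  rw [hasGradientAt_iff_hasFDerivAt]
  refine h2.congr_fderiv ?_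
  simp only [Constraints.barrierGrad, map_sum, map_smul, Finset.smul_sum]
  refine Finset.sum_congr rfl fun i _ => ?_
  rw [smul_neg, smul_neg, neg_smul, neg_neg, smul_smul, div_eq_mul_inv]

/-- Pairing the barrier gradient at `y` with a direction bounds the constraint values linearly:
its coefficients `μ / (-φ i y)` are the multipliers of the perturbed KKT system. -/
theorem inner_barrierGrad_le (hd : ∀ i, ContDiff ℝ 1 (P.φ i))
    (hcv : ∀ i, ConvexOn ℝ Set.univ (P.φ i)) {μ : ℝ} (hμ : 0 ≤ μ) {y : Vec n} (hy : y ∈ P.ltSet)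
    (z : Vec n) :
    inner ℝ (P.barrierGrad μ y) (z - y) ≤ ∑ i, μ / -(P.φ i y) * P.φ i z + m * μ := by
  have h : ∀ i, inner ℝ ((μ / -(P.φ i y)) • gradient (P.φ i) y) (z - y)
      ≤ μ / -(P.φ i y) * P.φ i z + μ := by
    intro i
    have hi := hy i
    have h1 := inner_le_sub_of_convexOn (hcv i) (hasGradientAt_constraint hd i y) z
    rw [real_inner_smul_left]
    have h2 : 0 ≤ μ / -(P.φ i y) := div_nonneg hμ (by linarith)
    have h3 : μ / -(P.φ i y) * P.φ i y = -μ := by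
      have : P.φ i y ≠ 0 := hi.ne
      field_simp
    nlinarith [mul_le_mul_of_nonneg_left h1 h2]
  unfold Constraints.barrierGrad
  rw [sum_inner]
  refine (Finset.sum_le_sum fun i _ => h i).trans ?_
  simp [Finset.sum_add_distrib]

theorem inner_barrierGrad_le_of_nonpos (hd : ∀ i, ContDiff ℝ 1 (P.φ i))
    (hcv : ∀ i, ConvexOn ℝ Set.univ (P.φ i)) {μ : ℝ} (hμ : 0 ≤ μ) {y : Vec n} (hy : y ∈ P.ltSet)
    {z : Vec n} (hz : ∀ i, P.φ i z ≤ 0) :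
    inner ℝ (P.barrierGrad μ y) (z - y) ≤ m * μ := by
  have h := inner_barrierGrad_le hd hcv hμ hy z
  have : ∑ i, μ / -(P.φ i y) * P.φ i z ≤ 0 := Finset.sum_nonpos fun i _ =>
    mul_nonpos_of_nonneg_of_nonpos (div_nonneg hμ (by have := hy i; linarith)) (hz i)
  linarith

theorem neg_log_neg_sub_ge {a b : ℝ} (ha : a < 0) (hb : b < 0) :
    (b - a) / -a ≤ Real.log (-a) - Real.log (-b) := by
  have h := Real.log_le_sub_one_of_pos (x := -b / -a) (div_pos (by linarith) (by linarith))
  rw [Real.log_div (by linarith) (by linarith)] at h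
  have e : -b / -a - 1 = -((b - a) / -a) := by
    have : a ≠ 0 := ha.ne
    field_simp
  linarith

theorem inner_barrierGrad_le_sub (hd : ∀ i, ContDiff ℝ 1 (P.φ i))
    (hcv : ∀ i, ConvexOn ℝ Set.univ (P.φ i)) {μ : ℝ} (hμ : 0 ≤ μ) {y z : Vec n}
    (hy : y ∈ P.ltSet) (hz : z ∈ P.ltSet) :
    inner ℝ (P.barrierGrad μ y) (z - y) ≤ P.barrier μ z - P.barrier μ y := by
  unfold Constraints.barrierGrad Constraints.barrier
  rw [sum_inner]
  have e : -μ * ∑ i, Real.log (-(P.φ i z)) - -μ * ∑ i, Real.log (-(P.φ i y))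
      = ∑ i, μ * (Real.log (-(P.φ i y)) - Real.log (-(P.φ i z))) := by
    rw [← Finset.mul_sum, Finset.sum_sub_distrib]; ring
  rw [e]
  refine Finset.sum_le_sum fun i _ => ?_
  have hi := hy i
  have h1 := inner_le_sub_of_convexOn (hcv i) (hasGradientAt_constraint hd i y) z
  rw [real_inner_smul_left, div_mul_eq_mul_div, mul_div_assoc]
  refine mul_le_mul_of_nonneg_left ?_ hμ
  exact (div_le_div_of_nonneg_right h1 (by linarith)).trans (neg_log_neg_sub_ge hi (hz i))

theorem barrierGrad_monotone (hd : ∀ i, ContDiff ℝ 1 (P.φ i))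
    (hcv : ∀ i, ConvexOn ℝ Set.univ (P.φ i)) {μ : ℝ} (hμ : 0 ≤ μ) :
    MonotoneOp (P.barrierGrad μ) P.ltSet := by
  intro y hy z hz
  have h1 := inner_barrierGrad_le_sub hd hcv hμ hy hz
  have h2 := inner_barrierGrad_le_sub hd hcv hμ hz hy
  rw [real_inner_comm, inner_sub_left]
  have e : inner ℝ (P.barrierGrad μ y) (z - y) = - inner ℝ (P.barrierGrad μ y) (y - z) := by
    rw [← inner_neg_right, neg_sub]
  linarith

theorem barrierGrad_strictMonotone (hd : ∀ i, ContDiff ℝ 1 (P.φ i))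
    (hcv : ∀ i, ConvexOn ℝ Set.univ (P.φ i)) {i₀ : Fin m}
    (hi₀ : StrictConvexOn ℝ Set.univ (P.φ i₀)) {μ : ℝ} (hμ : 0 < μ) :
    StrictMonotoneOp (P.barrierGrad μ) P.ltSet := by
  -- The barrier lies strictly above its tangents, because its `i₀`-th summand does.
  have key : ∀ y ∈ P.ltSet, ∀ z ∈ P.ltSet, z ≠ y →
      inner ℝ (P.barrierGrad μ y) (z - y) < P.barrier μ z - P.barrier μ y := by
    intro y hy z hz hzy
    unfold Constraints.barrierGrad Constraints.barrier
    rw [sum_inner]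
    have e : -μ * ∑ i, Real.log (-(P.φ i z)) - -μ * ∑ i, Real.log (-(P.φ i y))
        = ∑ i, μ * (Real.log (-(P.φ i y)) - Real.log (-(P.φ i z))) := by
      rw [← Finset.mul_sum, Finset.sum_sub_distrib]; ring
    rw [e]
    refine Finset.sum_lt_sum (fun i _ => ?_) ⟨i₀, Finset.mem_univ _, ?_⟩
    · have hi := hy i
      have h1 := inner_le_sub_of_convexOn (hcv i) (hasGradientAt_constraint hd i y) z
      rw [real_inner_smul_left, div_mul_eq_mul_div, mul_div_assoc]
      refine mul_le_mul_of_nonneg_left ?_ hμ.le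
      exact (div_le_div_of_nonneg_right h1 (by linarith)).trans (neg_log_neg_sub_ge hi (hz i))
    · have hi := hy i₀
      have h1 := inner_lt_sub_of_strictConvexOn hi₀ (hasGradientAt_constraint hd i₀ y) hzy
      rw [real_inner_smul_left, div_mul_eq_mul_div, mul_div_assoc]
      refine mul_lt_mul_of_pos_left ?_ hμ
      exact (div_lt_div_of_pos_right h1 (by linarith)).trans_le (neg_log_neg_sub_ge hi (hz i₀))
  intro y hy z hz hyz
  have h1 := key y hy z hz hyz.symm
  have h2 := key z hz y hy hyz
  rw [real_inner_comm, inner_sub_left]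
  have e : inner ℝ (P.barrierGrad μ y) (z - y) = - inner ℝ (P.barrierGrad μ y) (y - z) := by
    rw [← inner_neg_right, neg_sub]
  linarith

/-- On a bounded set, an upper bound on the barrier keeps all constraints uniformly inactive. -/
theorem exists_slack_of_barrier_le (hd : ∀ i, ContDiff ℝ 1 (P.φ i)) {μ : ℝ} (hμ : 0 < μ)
    (R Q : ℝ) : ∃ η > 0, ∀ z ∈ P.ltSet, ‖z‖ ≤ R → P.barrier μ z ≤ Q → ∀ i, P.φ i z ≤ -η := by
  have hH : ∃ H : ℝ, 1 ≤ H ∧ ∀ i, ∀ z : Vec n, ‖z‖ ≤ R → -(P.φ i z) ≤ H := by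
    have : ∀ i, ∃ H : ℝ, ∀ z : Vec n, ‖z‖ ≤ R → -(P.φ i z) ≤ H := by
      intro i
      obtain ⟨H, hH⟩ := (isCompact_closedBall (0 : Vec n) R).bddAbove_image
        (hd i).continuous.neg.continuousOn
      exact ⟨H, fun z hz => hH ⟨z, by simpa using hz, rfl⟩⟩
    choose H hH using this
    refine ⟨1 + ∑ i, |H i|, ?_, fun i z hz => ?_⟩
    · have : 0 ≤ ∑ i, |H i| := Finset.sum_nonneg fun i _ => abs_nonneg _
      linarith
    · have := Finset.single_le_sum (f := fun i => |H i|) (fun i _ => abs_nonneg _)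
        (Finset.mem_univ i)
      have := hH i z hz
      have := le_abs_self (H i)
      linarith
  obtain ⟨H, hH1, hH⟩ := hH
  refine ⟨Real.exp (-(Q / μ + m * Real.log H)), Real.exp_pos _, fun z hz hzR hzQ i => ?_⟩
  have hi := hz i
  rw [le_neg, ← Real.le_log_iff_exp_le (by linarith)]
  have hlog : ∀ j, Real.log (-(P.φ j z)) ≤ Real.log H := fun j =>
    Real.log_le_log (by have := hz j; linarith) (hH j z hzR)
  have hlH : 0 ≤ Real.log H := Real.log_nonneg hH1
  -- All summands but the `i`-th are at most `log H`.
  have hsum : ∑ j, Real.log (-(P.φ j z)) ≤ Real.log (-(P.φ i z)) + m * Real.log H := by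
    rw [← Finset.add_sum_erase _ _ (Finset.mem_univ i)]
    have h1 : ∑ j ∈ Finset.univ.erase i, Real.log (-(P.φ j z))
        ≤ ∑ j ∈ Finset.univ.erase i, Real.log H := Finset.sum_le_sum fun j _ => hlog j
    have h2 : ∑ j ∈ Finset.univ.erase i, Real.log H ≤ ∑ j : Fin m, Real.log H :=
      Finset.sum_le_sum_of_subset_of_nonneg (Finset.erase_subset _ _) fun _ _ _ => hlH
    have h3 : ∑ j : Fin m, Real.log H = m * Real.log H := by simp
    linarith
  have hb : -(Q / μ) ≤ ∑ j, Real.log (-(P.φ j z)) := by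
    unfold Constraints.barrier at hzQ
    rw [neg_le, ← neg_le_neg_iff, neg_neg, neg_le, le_div_iff₀ hμ]
    linarith
  linarith

/-- The proximal step of the barrier over a closed set is solvable. -/
theorem exists_isMinOn_barrier_add_sq (hd : ∀ i, ContDiff ℝ 1 (P.φ i))
    (hcv : ∀ i, ConvexOn ℝ Set.univ (P.φ i)) {μ a : ℝ} (hμ : 0 < μ) (ha : 0 < a)
    {A : Set (Vec n)} (hA : IsClosed A) (hne : (P.ltSet ∩ A).Nonempty) (w : Vec n) :
    ∃ z ∈ P.ltSet ∩ A, IsMinOn (fun z => P.barrier μ z + a / 2 * ‖z - w‖ ^ 2) (P.ltSet ∩ A) z := by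
  obtain ⟨z₀, hz₀, hz₀A⟩ := hne
  set f : Vec n → ℝ := fun z => P.barrier μ z + a / 2 * ‖z - w‖ ^ 2 with hf
  set G := ‖P.barrierGrad μ z₀‖
  -- The barrier is bounded below by an affine function, so the sublevel set is bounded.
  have hbd : ∀ z ∈ P.ltSet, f z ≤ f z₀ → ‖z - w‖ ≤ ‖z₀ - w‖ + 2 * G / a := by
    intro z hz hle
    by_contra! hcon
    have h1 := inner_barrierGrad_le_sub hd hcv hμ.le hz₀ hz
    have h2 : -(G * (‖z - w‖ + ‖z₀ - w‖)) ≤ inner ℝ (P.barrierGrad μ z₀) (z - z₀) := by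
      have h3 := abs_real_inner_le_norm (P.barrierGrad μ z₀) (z - z₀)
      have h4 : ‖z - z₀‖ ≤ ‖z - w‖ + ‖z₀ - w‖ := by
        have : z - z₀ = (z - w) - (z₀ - w) := by abel
        rw [this]; exact norm_sub_le _ _
      have h5 := mul_le_mul_of_nonneg_left h4 (norm_nonneg (P.barrierGrad μ z₀))
      have := neg_abs_le (inner ℝ (P.barrierGrad μ z₀) (z - z₀) : ℝ)
      linarith
    have hG : 0 ≤ G := norm_nonneg _
    have h6 : 2 * G < a * (‖z - w‖ - ‖z₀ - w‖) := by
      rw [← div_lt_iff₀' ha]; linarith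
    have h0 := norm_nonneg (z₀ - w)
    have hpos : 0 < ‖z - w‖ + ‖z₀ - w‖ := by
      have : 0 ≤ 2 * G / a := by positivity
      linarith
    have h7 := mul_lt_mul_of_pos_right h6 hpos
    simp only [hf] at hle
    nlinarith
  have hbd' : ∀ z ∈ P.ltSet, f z ≤ f z₀ → ‖z‖ ≤ ‖z₀ - w‖ + 2 * G / a + ‖w‖ := by
    intro z hz hle
    have := hbd z hz hle
    have h2 := norm_add_le (z - w) w
    rw [sub_add_cancel] at h2
    linarith
  set R := ‖z₀ - w‖ + 2 * G / a + ‖w‖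
  obtain ⟨η, hη, hslack⟩ := exists_slack_of_barrier_le (P := P) hd hμ R (f z₀)
  have hin : ∀ z ∈ P.ltSet, f z ≤ f z₀ → ∀ i, P.φ i z ≤ -η := fun z hz hle =>
    hslack z hz (hbd' z hz hle) (le_trans (by simp only [hf]; nlinarith [sq_nonneg ‖z - w‖]) hle)
  set S : Set (Vec n) := Metric.closedBall 0 R ∩ (A ∩ {z | ∀ i, P.φ i z ≤ -η}) with hS
  have hScomp : IsCompact S := by
    refine (isCompact_closedBall 0 R).inter_right (hA.inter ?_)
    have : {z | ∀ i, P.φ i z ≤ -η} = ⋂ i, {z | P.φ i z ≤ -η} := by ext; simp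
    rw [this]
    exact isClosed_iInter fun i => isClosed_le (hd i).continuous continuous_const
  have hSlt : S ⊆ P.ltSet := fun z hz i => lt_of_le_of_lt (hz.2.2 i) (by linarith)
  have hz₀S : z₀ ∈ S := ⟨by simpa using hbd' z₀ hz₀ le_rfl, hz₀A, hin z₀ hz₀ le_rfl⟩
  have hcont : ContinuousOn f S := by
    refine ContinuousOn.add (fun z hz => ?_) (by fun_prop)
    exact (hasGradientAt_barrier hd μ (hSlt hz)).continuousAt.continuousWithinAt
  obtain ⟨z, hzS, hzmin⟩ := hScomp.exists_isMinOn ⟨z₀, hz₀S⟩ hcont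
  refine ⟨z, ⟨hSlt hzS, hzS.2.1⟩, fun u hu => ?_⟩
  by_cases hle : f u ≤ f z₀
  · exact hzmin ⟨by simpa using hbd' u hu.1 hle, hu.2, hin u hu.1 hle⟩
  · exact (hzmin hz₀S).trans (not_le.1 hle).le

/-- Stationarity of a proximal step of the barrier, along every direction that stays in `A`. -/
theorem inner_eq_zero_of_isMinOn (hd : ∀ i, ContDiff ℝ 1 (P.φ i)) {μ a : ℝ} {A : Set (Vec n)}
    {z w v : Vec n} (hz : z ∈ P.ltSet)
    (hmin : IsMinOn (fun z => P.barrier μ z + a / 2 * ‖z - w‖ ^ 2) (P.ltSet ∩ A) z)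
    (hv : ∀ t : ℝ, z + t • v ∈ A) :
    inner ℝ (P.barrierGrad μ z + a • (z - w)) v = 0 := by
  have h1 := hasDerivAt_comp_line (hasGradientAt_barrier hd μ hz) v
  have h2 : HasDerivAt (fun t : ℝ => a / 2 * ‖z + t • v - w‖ ^ 2) (a / 2 * (2 * inner ℝ (z - w) v))
      0 := by
    have h3 : HasDerivAt (fun t : ℝ => z + t • v - w) v 0 := by
      simpa using (((hasDerivAt_id (0 : ℝ)).smul_const v).const_add z).sub_const w
    simpa using (h3.norm_sq).const_mul (a / 2)
  have h4 := h1.add h2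
  have hloc : IsLocalMin (fun t : ℝ => P.barrier μ (z + t • v) + a / 2 * ‖z + t • v - w‖ ^ 2) 0 := by
    have hc : Continuous fun t : ℝ => z + t • v := by fun_prop
    have hmem : ∀ᶠ t in nhds (0 : ℝ), z + t • v ∈ P.ltSet :=
      hc.continuousAt.eventually ((isOpen_ltSet hd).mem_nhds (by simpa using hz))
    filter_upwards [hmem] with t ht
    simpa using hmin ⟨ht, hv t⟩
  have h5 := hloc.hasDerivAt_eq_zero h4
  rw [inner_add_left, real_inner_smul_left]
  linarith

theorem barrierGrad_eq_of_isMinOn (hd : ∀ i, ContDiff ℝ 1 (P.φ i)) {μ a : ℝ} {z w : Vec n}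
    (hz : z ∈ P.ltSet)
    (hmin : IsMinOn (fun z => P.barrier μ z + a / 2 * ‖z - w‖ ^ 2) P.ltSet z) :
    P.barrierGrad μ z = a • (w - z) := by
  have h := inner_eq_zero_of_isMinOn (A := Set.univ) hd (v := P.barrierGrad μ z + a • (z - w)) hz
    (by simpa using hmin) (fun _ => Set.mem_univ _)
  rw [inner_self_eq_zero] at h
  rw [eq_neg_of_add_eq_zero_left h]; module

/-- A subgradient of the barrier is its gradient. -/
theorem eq_barrierGrad_of_subgradient (hd : ∀ i, ContDiff ℝ 1 (P.φ i)) {μ : ℝ} {x l : Vec n}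
    (hx : x ∈ P.ltSet)
    (hl : ∀ z ∈ P.ltSet, P.barrier μ x + inner ℝ l (z - x) ≤ P.barrier μ z) :
    l = P.barrierGrad μ x := by
  set v := l - P.barrierGrad μ x with hv
  have h1 := hasDerivAt_comp_line (hasGradientAt_barrier hd μ hx) v
  have h2 : HasDerivAt (fun t : ℝ => t * inner ℝ l v) (inner ℝ l v) 0 := by
    simpa using (hasDerivAt_id (0 : ℝ)).mul_const (inner ℝ l v)
  have h4 := h1.sub h2
  have hloc : IsLocalMin (fun t : ℝ => P.barrier μ (x + t • v) - t * inner ℝ l v) 0 := by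
    have hc : Continuous fun t : ℝ => x + t • v := by fun_prop
    have hmem : ∀ᶠ t in nhds (0 : ℝ), x + t • v ∈ P.ltSet :=
      hc.continuousAt.eventually ((isOpen_ltSet hd).mem_nhds (by simpa using hx))
    filter_upwards [hmem] with t ht
    have := hl _ ht
    simp only [add_sub_cancel_left, inner_smul_right] at this
    simp only [zero_smul, add_zero, zero_mul, sub_zero]
    linarith
  have h5 := hloc.hasDerivAt_eq_zero h4
  have h6 : inner ℝ v v = 0 := by
    rw [hv, inner_sub_left, ← hv]; linarith
  exact sub_eq_zero.1 (inner_self_eq_zero.1 h6)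

end Barrier

/-! ### Directions of the affine constraint and the projection `P_c` -/

section Projection

variable {n m p : ℕ} {P : Constraints n m p}

/-- `u` is orthogonal to all directions of the affine subspace `{C x = d}`, i.e. to `ker C`. -/
def Constraints.IsNormal (P : Constraints n m p) (u : Vec n) : Prop :=
  ∀ v, Matrix.toEuclideanLin P.C v = 0 → inner ℝ u v = 0

theorem map_sub_eq_zero {x z : Vec n} (hx : x ∈ P.eqSet) (hz : z ∈ P.eqSet) :
    Matrix.toEuclideanLin P.C (x - z) = 0 := by
  rw [map_sub, hx, hz, sub_self]

theorem Constraints.IsNormal.inner_sub_eq_zero {u x z : Vec n} (hu : P.IsNormal u)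
    (hx : x ∈ P.eqSet) (hz : z ∈ P.eqSet) : inner ℝ u (x - z) = 0 :=
  hu _ (map_sub_eq_zero hx hz)

theorem add_smul_mem_eqSet {x v : Vec n} (hx : x ∈ P.eqSet)
    (hv : Matrix.toEuclideanLin P.C v = 0) (t : ℝ) : x + t • v ∈ P.eqSet := by
  simp only [Constraints.eqSet, Set.mem_ofPred_eq, map_add, map_smul, hv, smul_zero, add_zero]
  exact hx

theorem convex_eqSet : Convex ℝ P.eqSet := by
  intro x hx z hz a b _ _ hab
  simp only [Constraints.eqSet, Set.mem_ofPred_eq, map_add, map_smul] at *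
  rw [hx, hz, ← add_smul, hab, one_smul]

theorem transpose_eq_adjoint (C : Matrix (Fin p) (Fin n) ℝ) :
    Matrix.toEuclideanLin C.transpose = LinearMap.adjoint (Matrix.toEuclideanLin C) := by
  rw [← Matrix.toEuclideanLin_conjTranspose_eq_adjoint, Matrix.conjTranspose_eq_transpose_of_trivial]

theorem inner_transpose_apply (C : Matrix (Fin p) (Fin n) ℝ) (u : Vec p) (v : Vec n) :
    inner ℝ (Matrix.toEuclideanLin C.transpose u) v = inner ℝ u (Matrix.toEuclideanLin C v) := by
  rw [transpose_eq_adjoint, LinearMap.adjoint_inner_left]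

theorem Constraints.IsNormal.exists_transpose_eq {u : Vec n} (hu : P.IsNormal u) :
    ∃ nu : Vec p, Matrix.toEuclideanLin P.C.transpose nu = u := by
  have h : u ∈ (LinearMap.ker (Matrix.toEuclideanLin P.C))ᗮ := by
    rw [Submodule.mem_orthogonal']
    exact fun v hv => hu v hv
  rw [LinearMap.orthogonal_ker, ← transpose_eq_adjoint] at h
  exact h

theorem isUnit_det_of_rank_eq {C : Matrix (Fin p) (Fin n) ℝ} (hC : C.rank = p) :
    IsUnit (C * C.transpose).det := by
  have h : (C * C.transpose).rank = p := by rw [Matrix.rank_self_mul_transpose, hC]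
  rw [← Matrix.isUnit_iff_isUnit_det, ← Matrix.mulVec_surjective_iff_isUnit]
  have h2 : LinearMap.range (C * C.transpose).mulVecLin = ⊤ := by
    apply Submodule.eq_top_of_finrank_eq
    rw [← Matrix.rank, h]; simp
  exact LinearMap.range_eq_top.1 h2

theorem toEuclideanLin_mul_apply {a b c : ℕ} (A : Matrix (Fin a) (Fin b) ℝ)
    (B : Matrix (Fin b) (Fin c) ℝ) (v : Vec c) :
    Matrix.toEuclideanLin (A * B) v = Matrix.toEuclideanLin A (Matrix.toEuclideanLin B v) := by
  rw [Matrix.toEuclideanLin, Matrix.toLpLin_mul_same]; rfl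

theorem map_transpose_inv_apply (hC : P.C.rank = p) (u : Vec p) :
    Matrix.toEuclideanLin P.C (Matrix.toEuclideanLin P.C.transpose
      (Matrix.toEuclideanLin (P.C * P.C.transpose)⁻¹ u)) = u := by
  rw [← toEuclideanLin_mul_apply, ← toEuclideanLin_mul_apply,
    Matrix.mul_nonsing_inv _ (isUnit_det_of_rank_eq hC), Matrix.toEuclideanLin,
    Matrix.toLpLin_one]
  rfl

theorem Pc_apply (v : Vec n) : P.Pc v = v - Matrix.toEuclideanLin P.C.transpose
    (Matrix.toEuclideanLin (P.C * P.C.transpose)⁻¹ (Matrix.toEuclideanLin P.C v)) := by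
  rw [Constraints.Pc, map_sub, LinearMap.sub_apply, toEuclideanLin_mul_apply,
    toEuclideanLin_mul_apply]
  congr 1
  rw [Matrix.toEuclideanLin, Matrix.toLpLin_one]
  rfl

theorem map_Pc_apply (hC : P.C.rank = p) (v : Vec n) : Matrix.toEuclideanLin P.C (P.Pc v) = 0 := by
  rw [Pc_apply, map_sub, map_transpose_inv_apply hC, sub_self]

theorem inner_Pc_apply (u : Vec n) {v : Vec n} (hv : Matrix.toEuclideanLin P.C v = 0) :
    inner ℝ (P.Pc u) v = inner ℝ u v := by
  rw [Pc_apply, inner_sub_left, inner_transpose_apply, hv, inner_zero_right, sub_zero]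

theorem map_dc (hC : P.C.rank = p) : Matrix.toEuclideanLin P.C P.dc = P.d := by
  rw [Constraints.dc, toEuclideanLin_mul_apply, map_transpose_inv_apply hC]

theorem inner_dc {v : Vec n} (hv : Matrix.toEuclideanLin P.C v = 0) : inner ℝ P.dc v = 0 := by
  rw [Constraints.dc, toEuclideanLin_mul_apply, inner_transpose_apply, hv, inner_zero_right]

/-- The `x`-step of the algorithm is the stationarity condition of a proximal step of the operator
along the affine subspace. -/
theorem x_step_iff (hC : P.C.rank = p) {β : ℝ} (hβ : 0 < β) (x y l f : Vec n) :
    x + (1 / β) • P.Pc f - P.Pc y + (1 / β) • P.Pc l - P.dc = 0 ↔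
      x ∈ P.eqSet ∧ P.IsNormal (f + l + β • (x - y)) := by
  set e := x + (1 / β) • P.Pc f - P.Pc y + (1 / β) • P.Pc l - P.dc with he
  have hinner : ∀ v, Matrix.toEuclideanLin P.C v = 0 →
      inner ℝ (f + l + β • (x - y)) v = β * inner ℝ e v := by
    intro v hv
    simp only [he, inner_add_left, inner_sub_left, real_inner_smul_left, inner_Pc_apply _ hv,
      inner_dc hv]
    field_simp
    ring
  have hmap : Matrix.toEuclideanLin P.C e = Matrix.toEuclideanLin P.C x - P.d := by
    simp only [he, map_sub, map_add, map_smul, map_Pc_apply hC, map_dc hC, smul_zero, add_zero,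
      sub_zero]
  constructor
  · intro h0
    rw [h0, map_zero] at hmap
    refine ⟨(sub_eq_zero.1 hmap.symm), fun v hv => ?_⟩
    rw [hinner v hv, h0, inner_zero_left, mul_zero]
  · rintro ⟨hx, hnorm⟩
    have hx' : Matrix.toEuclideanLin P.C x = P.d := hx
    rw [hx', sub_self] at hmap
    have h1 := hnorm e hmap
    rw [hinner e hmap] at h1
    exact inner_self_eq_zero.1 ((mul_eq_zero.1 h1).resolve_left hβ.ne')

end Projection

/-! ### Existence of the central path and of the iterates -/

section Existence

variable {n m p : ℕ} {P : Constraints n m p} {F : Vec n → Vec n} {L : ℝ}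

theorem LipschitzOp.continuousOn {S : Set (Vec n)} (hLip : LipschitzOp F S L) :
    ContinuousOn F S := by
  have : LipschitzOnWith (Real.toNNReal L) F S := by
    refine LipschitzOnWith.of_dist_le_mul fun x hx y hy => ?_
    rw [dist_eq_norm, dist_eq_norm]
    refine (hLip x hx y hy).trans (mul_le_mul_of_nonneg_right ?_ (norm_nonneg _))
    exact Real.le_coe_toNNReal L
  exact this.continuousOn

/-- A strongly monotone perturbation of `F` plus the barrier gradient has a zero modulo the normal
space of `{C x = d}`: it is the fixed point of the forward-backward map
`x ↦ prox (x - τ (F x + ε (x - w)))`, a contraction for a small step `τ`. -/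
theorem exists_isNormal_add_smul_add_barrierGrad (hd : ∀ i, ContDiff ℝ 1 (P.φ i))
    (hcv : ∀ i, ConvexOn ℝ Set.univ (P.φ i)) (hne : (P.ltSet ∩ P.eqSet).Nonempty) (hL : 0 < L)
    (hmono : MonotoneOp F P.eqSet) (hLip : LipschitzOp F P.eqSet L) {μ ε : ℝ} (hμ : 0 < μ)
    (hε : 0 < ε) (w : Vec n) :
    ∃ x ∈ P.ltSet ∩ P.eqSet, P.IsNormal (F x + ε • (x - w) + P.barrierGrad μ x) := by
  set τ : ℝ := ε / (L + ε) ^ 2 with hτ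
  have hτ0 : 0 < τ := by positivity
  set g : Vec n → Vec n := fun x => F x + ε • (x - w) with hg
  choose T hT hTmin using fun x : Vec n => exists_isMinOn_barrier_add_sq hd hcv hμ
    (one_div_pos.2 hτ0) isClosed_eqSet hne (x - τ • g x)
  have hopt : ∀ x v, Matrix.toEuclideanLin P.C v = 0 →
      inner ℝ (P.barrierGrad μ (T x) + (1 / τ) • (T x - (x - τ • g x))) v = 0 := fun x v hv =>
    inner_eq_zero_of_isMinOn hd (hT x).1 (hTmin x) fun t => add_smul_mem_eqSet (hT x).2 hv t
  set q : ℝ := 1 - ε ^ 2 / (L + ε) ^ 2 with hq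
  have hq0 : 0 ≤ q := by
    rw [hq, sub_nonneg, div_le_one (by positivity)]
    exact pow_le_pow_left₀ hε.le (by linarith) 2
  have hq1 : q < 1 := by
    have : 0 < ε ^ 2 / (L + ε) ^ 2 := by positivity
    linarith
  have hforward : ∀ x ∈ P.eqSet, ∀ x' ∈ P.eqSet,
      ‖(x - τ • g x) - (x' - τ • g x')‖ ^ 2 ≤ q * ‖x - x'‖ ^ 2 := by
    intro x hx x' hx'
    have e1 : (x - τ • g x) - (x' - τ • g x') = (x - x') - τ • (g x - g x') := by module
    have e2 : g x - g x' = (F x - F x') + ε • (x - x') := by simp only [hg]; module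
    have h1 : ε * ‖x - x'‖ ^ 2 ≤ inner ℝ (x - x') (g x - g x') := by
      rw [e2, inner_add_right, inner_smul_right, real_inner_self_eq_norm_sq]
      have := hmono x hx x' hx'
      linarith
    have h2 : ‖g x - g x'‖ ≤ (L + ε) * ‖x - x'‖ := by
      rw [e2]
      refine (norm_add_le _ _).trans ?_
      rw [norm_smul, Real.norm_of_nonneg hε.le, add_mul]
      have := hLip x hx x' hx'
      linarith
    have h3 : ‖g x - g x'‖ ^ 2 ≤ (L + ε) ^ 2 * ‖x - x'‖ ^ 2 := by
      rw [← mul_pow]; exact pow_le_pow_left₀ (norm_nonneg _) h2 2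
    rw [e1, norm_sub_sq_real, inner_smul_right, norm_smul, mul_pow, Real.norm_of_nonneg hτ0.le]
    have h4 : τ ^ 2 * ‖g x - g x'‖ ^ 2 ≤ τ ^ 2 * ((L + ε) ^ 2 * ‖x - x'‖ ^ 2) :=
      mul_le_mul_of_nonneg_left h3 (sq_nonneg _)
    have h5 : τ ^ 2 * ((L + ε) ^ 2 * ‖x - x'‖ ^ 2) = ε ^ 2 / (L + ε) ^ 2 * ‖x - x'‖ ^ 2 := by
      rw [hτ]; field_simp
    have h6 : τ * (ε * ‖x - x'‖ ^ 2) = ε ^ 2 / (L + ε) ^ 2 * ‖x - x'‖ ^ 2 := by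
      rw [hτ]; field_simp
    have h7 := mul_le_mul_of_nonneg_left h1 hτ0.le
    rw [hq]
    nlinarith
  have hback : ∀ x x' : Vec n, ‖T x - T x'‖ ≤ ‖(x - τ • g x) - (x' - τ • g x')‖ := by
    intro x x'
    set d := T x - T x'
    have hdir : Matrix.toEuclideanLin P.C d = 0 := map_sub_eq_zero (hT x).2 (hT x').2
    have h1 := hopt x d hdir
    have h2 := hopt x' d hdir
    have h3 := barrierGrad_monotone hd hcv hμ.le _ (hT x).1 _ (hT x').1
    rw [real_inner_comm] at h3
    have h4 : inner ℝ (d - ((x - τ • g x) - (x' - τ • g x'))) d ≤ 0 := by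
      have e : inner ℝ (P.barrierGrad μ (T x) - P.barrierGrad μ (T x')) d
          + 1 / τ * inner ℝ (d - ((x - τ • g x) - (x' - τ • g x'))) d = 0 := by
        rw [← real_inner_smul_left, ← inner_add_left, ← sub_zero (0 : ℝ)]
        nth_rewrite 1 [← h1]
        rw [← h2, ← inner_sub_left]
        congr 1
        module
      have h5 : 1 / τ * inner ℝ (d - ((x - τ • g x) - (x' - τ • g x'))) d ≤ 0 := by linarith
      by_contra! hcon
      have := mul_pos (one_div_pos.2 hτ0) hcon
      linarith
    rw [inner_sub_left, real_inner_self_eq_norm_sq] at h4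
    have h5 := real_inner_le_norm ((x - τ • g x) - (x' - τ • g x')) d
    by_contra! hcon
    have h6 : 0 < ‖d‖ := (norm_nonneg _).trans_lt hcon
    nlinarith
  have hcontr : ContractingWith (Real.toNNReal (√q))
      (fun x : P.eqSet => (⟨T x, (hT x).2⟩ : P.eqSet)) := by
    refine ⟨?_, LipschitzWith.of_dist_le_mul fun x x' => ?_⟩
    · rw [Real.toNNReal_lt_one]
      rw [Real.sqrt_lt' one_pos]; simpa using hq1
    · rw [Subtype.dist_eq, Subtype.dist_eq, dist_eq_norm, dist_eq_norm,
        Real.coe_toNNReal _ (Real.sqrt_nonneg q)]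
      refine (hback x x').trans ?_
      refine (pow_le_pow_iff_left₀ (norm_nonneg _) (by positivity) two_ne_zero).1 ?_
      rw [mul_pow, Real.sq_sqrt hq0]
      exact hforward x x.2 x' x'.2
  have : CompleteSpace P.eqSet := isClosed_eqSet.completeSpace_coe
  have : Nonempty P.eqSet := ⟨⟨hne.some, hne.some_mem.2⟩⟩
  have hfix := hcontr.fixedPoint_isFixedPt
  set x₀ := ContractingWith.fixedPoint _ hcontr
  have hx₀ : T x₀ = x₀ := congrArg Subtype.val hfix
  refine ⟨x₀, hx₀ ▸ hT x₀, fun v hv => ?_⟩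
  have h := hopt x₀ v hv
  rw [hx₀] at h
  rw [← h]
  congr 1
  have : (1 / τ) • ((x₀ : Vec n) - (x₀ - τ • g x₀)) = g x₀ := by
    rw [sub_sub_cancel, smul_smul, one_div_mul_cancel hτ0.ne', one_smul]
  rw [this, add_comm]

theorem exists_x_step (hP : P.Regular) (hL : 0 < L) (hmono : MonotoneOp F P.eqSet)
    (hLip : LipschitzOp F P.eqSet L) {β : ℝ} (hβ : 0 < β) (y l : Vec n) :
    ∃ x, x + (1 / β) • P.Pc (F x) - P.Pc y + (1 / β) • P.Pc l - P.dc = 0 := by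
  -- Drop the inequality constraints: the barrier of an empty family vanishes.
  let Q : Constraints n 0 p := ⟨P.C, P.d, fun i => i.elim0⟩
  obtain ⟨x, hx, hnorm⟩ := exists_isNormal_add_smul_add_barrierGrad (P := Q) (F := F)
    (fun i => i.elim0) (fun i => i.elim0)
    ⟨hP.interior_nonempty.some, fun i => i.elim0, hP.interior_nonempty.some_mem.2⟩ hL hmono hLip
    one_pos hβ (y - (1 / β) • l)
  refine ⟨x, (x_step_iff hP.rank_eq hβ _ _ _ _).2 ⟨hx.2, fun v hv => ?_⟩⟩
  rw [← hnorm v hv]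
  congr 1
  simp only [Constraints.barrierGrad, Finset.univ_eq_empty, Finset.sum_empty, add_zero]
  have : β • (1 / β) • l = l := by rw [smul_smul, mul_one_div_cancel hβ.ne', one_smul]
  rw [sub_sub_eq_add_sub, smul_sub, smul_sub, smul_add, this]
  abel

theorem exists_isACVIRun (hP : P.Regular) (hL : 0 < L) (hmono : MonotoneOp F P.eqSet)
    (hLip : LipschitzOp F P.eqSet L) {μinit β δ : ℝ} (hμ : 0 < μinit) (hβ : 0 < β) (hδ : 0 < δ)
    (y₀ l₀ : Vec n) (T K : ℕ) :
    ∃ x y lam : ℕ → ℕ → Vec n, IsACVIRun P F μinit β δ y₀ l₀ T K x y lam := by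
  choose X hX using exists_x_step (F := F) hP hL hmono hLip hβ
  have hYex : ∀ (t : ℕ) (w : Vec n), ∃ y ∈ P.ltSet, IsMinOn (fun z =>
      P.barrier (muSeq μinit δ t) z + β / 2 * ‖z - w‖ ^ 2) P.ltSet y := by
    intro t w
    obtain ⟨y, hy, hmin⟩ := exists_isMinOn_barrier_add_sq (A := Set.univ) hP.contDiff hP.convex
      (show 0 < muSeq μinit δ t by unfold muSeq; positivity) hβ isClosed_univ
      (by rw [Set.inter_univ]; exact hP.interior_nonempty.mono Set.inter_subset_left) w
    rw [Set.inter_univ] at hy hmin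
    exact ⟨y, hy, hmin⟩
  choose Y hY hYmin using hYex
  -- One inner iteration, on states `(x, y, λ)`.
  let step : ℕ → Vec n × Vec n × Vec n → Vec n × Vec n × Vec n := fun t s =>
    (X s.2.1 s.2.2, Y t (X s.2.1 s.2.2 + (1 / β) • s.2.2),
      s.2.2 + β • (X s.2.1 s.2.2 - Y t (X s.2.1 s.2.2 + (1 / β) • s.2.2)))
  let start : ℕ → Vec n × Vec n × Vec n := fun t =>
    Nat.rec (0, y₀, l₀) (fun t s => (step t)^[K] s) t
  refine ⟨fun t k => ((step t)^[k] (start t)).1, fun t k => ((step t)^[k] (start t)).2.1,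
    fun t k => ((step t)^[k] (start t)).2.2, rfl, rfl, ?_, ?_, ?_, ?_, fun _ _ => rfl,
    fun _ _ => rfl⟩
  · intro t _ k _
    simp only [Function.iterate_succ_apply']
    exact hX _ _
  · intro t _ k _
    simp only [Function.iterate_succ_apply']
    exact hY _ _
  · intro t _ k _
    simp only [Function.iterate_succ_apply']
    simp only [sub_sub]
    exact hYmin _ _
  · intro t _ k _
    simp only [Function.iterate_succ_apply']
    rfl

theorem feasible_of_mem {x : Vec n} (hx : x ∈ P.ltSet ∩ P.eqSet) : x ∈ P.feasible :=
  ⟨fun i => (hx.1 i).le, hx.2⟩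

theorem exists_central_point (hP : P.Regular) (hL : 0 < L) (hmono : MonotoneOp F P.eqSet)
    (hLip : LipschitzOp F P.eqSet L) {μ : ℝ} (hμ : 0 < μ) :
    ∃ x ∈ P.ltSet ∩ P.eqSet, P.IsNormal (F x + P.barrierGrad μ x) := by
  -- Let the strong monotonicity parameter `1 / (j + 1)` tend to zero.
  choose X hX hXn using fun j : ℕ => exists_isNormal_add_smul_add_barrierGrad (F := F)
    hP.contDiff hP.convex hP.interior_nonempty hL hmono hLip hμ
    (show (0 : ℝ) < 1 / ((j : ℝ) + 1) by positivity) 0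
  obtain ⟨z₀, hz₀⟩ := hP.interior_nonempty
  obtain ⟨R, hR⟩ := hP.compact.isBounded.exists_norm_le
  obtain ⟨N, hN⟩ := (hP.compact.image_of_continuousOn
    (hLip.continuousOn.mono fun x hx => hx.2)).isBounded.exists_norm_le
  have hXf : ∀ j, X j ∈ P.feasible := fun j => feasible_of_mem (hX j)
  have hR0 : 0 ≤ R := (norm_nonneg _).trans (hR _ (hXf 0))
  -- The barrier stays bounded along the sequence, so the limit is strictly feasible.
  have hb : ∀ j, P.barrier μ (X j) ≤ P.barrier μ z₀ + (N + R) * (2 * R) := by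
    intro j
    have h1 := inner_barrierGrad_le_sub hP.contDiff hP.convex hμ.le (hX j).1 hz₀.1
    have h2 := hXn j _ (map_sub_eq_zero hz₀.2 (hX j).2)
    rw [inner_add_left] at h2
    have h3 := real_inner_le_norm (F (X j) + (1 / ((j : ℝ) + 1)) • (X j - 0)) (z₀ - X j)
    have h4 : ‖F (X j) + (1 / ((j : ℝ) + 1)) • (X j - 0)‖ ≤ N + R := by
      refine (norm_add_le _ _).trans (add_le_add (hN _ ⟨_, hXf j, rfl⟩) ?_)
      rw [sub_zero, norm_smul, Real.norm_of_nonneg (by positivity)]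
      have : 1 / ((j : ℝ) + 1) ≤ 1 := by
        rw [div_le_one (by positivity)]; linarith [(Nat.cast_nonneg j : (0 : ℝ) ≤ j)]
      calc 1 / ((j : ℝ) + 1) * ‖X j‖ ≤ 1 * ‖X j‖ :=
            mul_le_mul_of_nonneg_right this (norm_nonneg _)
        _ ≤ R := by rw [one_mul]; exact hR _ (hXf j)
    have h5 : ‖z₀ - X j‖ ≤ 2 * R := by
      refine (norm_sub_le _ _).trans ?_
      linarith [hR _ (hXf j), hR _ (feasible_of_mem hz₀)]
    have h6 := mul_le_mul h4 h5 (norm_nonneg _) ((norm_nonneg _).trans h4)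
    linarith
  obtain ⟨η, hη, hslack⟩ := exists_slack_of_barrier_le (P := P) hP.contDiff hμ R
    (P.barrier μ z₀ + (N + R) * (2 * R))
  obtain ⟨x, hx, ψ, hψ, hlim⟩ := hP.compact.tendsto_subseq hXf
  have hxlt : x ∈ P.ltSet := fun i => by
    have : P.φ i x ≤ -η := le_of_tendsto
      (((hP.contDiff i).continuous.tendsto x).comp hlim)
      (Filter.Eventually.of_forall fun j => hslack _ (hX (ψ j)).1 (hR _ (hXf _)) (hb _) i)
    linarith
  refine ⟨x, ⟨hxlt, hx.2⟩, fun v hv => ?_⟩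
  have hF : Filter.Tendsto (fun j => F (X (ψ j))) Filter.atTop (nhds (F x)) :=
    ((hLip.continuousOn x hx.2).tendsto).comp (tendsto_nhdsWithin_iff.2
      ⟨hlim, Filter.Eventually.of_forall fun j => (hX (ψ j)).2⟩)
  have hB : Filter.Tendsto (fun j => P.barrierGrad μ (X (ψ j))) Filter.atTop
      (nhds (P.barrierGrad μ x)) :=
    ((continuousOn_barrierGrad hP.contDiff μ x hxlt).tendsto).comp (tendsto_nhdsWithin_iff.2
      ⟨hlim, Filter.Eventually.of_forall fun j => (hX (ψ j)).1⟩)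
  have hE : Filter.Tendsto (fun j => (1 / (((ψ j : ℕ) : ℝ) + 1)) • (X (ψ j) - 0)) Filter.atTop
      (nhds ((0 : ℝ) • (x - 0))) :=
    ((tendsto_one_div_add_atTop_nhds_zero_nat (𝕜 := ℝ)).comp hψ.tendsto_atTop).smul
      (hlim.sub_const 0)
  have htot := ((hF.add hE).add hB).inner (𝕜 := ℝ) (tendsto_const_nhds (x := v))
  have hzero := tendsto_nhds_unique htot (tendsto_const_nhds.congr fun j => (hXn (ψ j) v hv).symm)
  simpa using hzero

/-- The central path point is the strictly feasible zero of `F` plus the barrier gradient modulo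
the normal space, and the multiplier is the barrier gradient there. -/
theorem isCentralPair_iff (hP : P.Regular) {μ : ℝ} (hμ : 0 < μ) {x l : Vec n} :
    IsCentralPair P F μ x l ↔
      x ∈ P.ltSet ∩ P.eqSet ∧ l = P.barrierGrad μ x ∧ P.IsNormal (F x + l) := by
  constructor
  · rintro ⟨⟨lam, nu, hkkt, hcomp, hx, hlt, -⟩, -, -, hsub⟩
    have hl := eq_barrierGrad_of_subgradient hP.contDiff hlt hsub
    refine ⟨⟨hlt, hx⟩, hl, fun v hv => ?_⟩
    have e : ∑ i, lam i • gradient (P.φ i) x = P.barrierGrad μ x := by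
      refine Finset.sum_congr rfl fun i _ => ?_
      congr 1
      have := hlt i
      rw [eq_div_iff (by linarith)]
      linarith [hcomp i]
    rw [e, ← hl] at hkkt
    have h : (inner ℝ (F x + l + Matrix.toEuclideanLin P.C.transpose nu) v : ℝ) = 0 := by
      rw [hkkt, inner_zero_left]
    rwa [inner_add_left, inner_transpose_apply, hv, inner_zero_right, add_zero] at h
  · rintro ⟨⟨hlt, hx⟩, rfl, hn⟩
    obtain ⟨nu, hnu⟩ := hn.exists_transpose_eq
    refine ⟨⟨fun i => μ / -(P.φ i x), -nu, ?_, fun i => ?_, hx, hlt, fun i => ?_⟩,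
      ⟨hx, fun z hz => ?_⟩, hlt, fun z hz => ?_⟩
    · rw [map_neg, hnu]; exact add_neg_cancel _
    · have : P.φ i x ≠ 0 := (hlt i).ne
      field_simp; ring
    · exact div_pos hμ (by have := hlt i; linarith)
    · have h := hn.inner_sub_eq_zero hz hx
      rw [inner_add_left, inner_sub_right (𝕜 := ℝ) (F x)] at h
      linarith
    · linarith [inner_barrierGrad_le_sub hP.contDiff hP.convex hμ.le hlt hz]

theorem existsUnique_isCentralPair (hP : P.Regular) (hL : 0 < L) (hmono : MonotoneOp F P.eqSet)
    (hLip : LipschitzOp F P.eqSet L)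
    (hstrict : StrictMonotoneOp F P.feasible ∨ ∃ i, StrictConvexOn ℝ Set.univ (P.φ i))
    {μ : ℝ} (hμ : 0 < μ) : ∃! z : Vec n × Vec n, IsCentralPair P F μ z.1 z.2 := by
  obtain ⟨x, hx, hn⟩ := exists_central_point hP hL hmono hLip hμ
  refine ⟨(x, P.barrierGrad μ x), (isCentralPair_iff hP hμ).2 ⟨hx, rfl, hn⟩, ?_⟩
  rintro ⟨x', l'⟩ h'
  obtain ⟨hx', hl', hn'⟩ := (isCentralPair_iff hP hμ).1 h'
  simp only at hx' hl' hn'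
  subst hl'
  suffices x' = x by rw [this]
  by_contra hne
  have h1 := hn.inner_sub_eq_zero hx'.2 hx.2
  have h2 := hn'.inner_sub_eq_zero hx'.2 hx.2
  have h3 := hmono _ hx'.2 _ hx.2
  have h4 := barrierGrad_monotone hP.contDiff hP.convex hμ.le _ hx'.1 _ hx.1
  rw [real_inner_comm, inner_sub_left] at h3 h4
  rw [inner_add_left] at h1 h2
  rcases hstrict with hs | ⟨i, hi⟩
  · have h5 := hs _ (feasible_of_mem hx') _ (feasible_of_mem hx) hne
    rw [real_inner_comm, inner_sub_left] at h5
    linarith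
  · have h5 := barrierGrad_strictMonotone hP.contDiff hP.convex hi hμ _ hx'.1 _ hx.1 hne
    rw [real_inner_comm, inner_sub_left] at h5
    linarith

end Existence

/-! ### The inner loop -/

section InnerLoop

variable {n m p : ℕ} {P : Constraints n m p} {F : Vec n → Vec n} {L : ℝ}

/-- `K` iterations of the alternating direction method at a fixed barrier parameter `μ`, described
by the stationarity conditions of its two proximal steps. -/
structure IsInnerLoop (P : Constraints n m p) (F : Vec n → Vec n) (μ β : ℝ) (K : ℕ)
    (x y lam : ℕ → Vec n) : Prop where
  x_mem : ∀ k < K, x (k + 1) ∈ P.eqSet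
  normal : ∀ k < K, P.IsNormal (F (x (k + 1)) + lam k + β • (x (k + 1) - y k))
  y_mem : ∀ k < K, y (k + 1) ∈ P.ltSet
  lam_eq : ∀ k < K, lam (k + 1) = P.barrierGrad μ (y (k + 1))
  lam_step : ∀ k < K, lam (k + 1) = lam k + β • (x (k + 1) - y (k + 1))

theorem IsACVIRun.isInnerLoop (hP : P.Regular) {μinit β δ : ℝ} (hβ : 0 < β)
    {y₀ l₀ : Vec n} {T K : ℕ} {x y lam : ℕ → ℕ → Vec n}
    (h : IsACVIRun P F μinit β δ y₀ l₀ T K x y lam) {t : ℕ} (ht : t < T) :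
    IsInnerLoop P F (muSeq μinit δ t) β K (x t) (y t) (lam t) where
  x_mem k hk := ((x_step_iff hP.rank_eq hβ _ _ _ _).1 (h.x_step t ht k hk)).1
  normal k hk := ((x_step_iff hP.rank_eq hβ _ _ _ _).1 (h.x_step t ht k hk)).2
  y_mem k hk := h.y_mem t ht k hk
  lam_eq k hk := by
    have h1 := h.y_step t ht k hk
    simp only [sub_sub] at h1
    rw [barrierGrad_eq_of_isMinOn hP.contDiff (h.y_mem t ht k hk) h1, h.lam_step t ht k hk]
    have : β • (1 / β) • lam t k = lam t k := by
      rw [smul_smul, mul_one_div_cancel hβ.ne', one_smul]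
    rw [smul_sub, smul_sub, smul_add, this]
    abel
  lam_step k hk := h.lam_step t ht k hk

theorem Constraints.IsNormal.sub {u v : Vec n} (hu : P.IsNormal u) (hv : P.IsNormal v) :
    P.IsNormal (u - v) := fun w hw => by rw [inner_sub_left, hu w hw, hv w hw, sub_zero]

variable {μ β : ℝ} {K : ℕ} {x y lam : ℕ → Vec n} {xμ lμ : Vec n}

theorem Delta_nonneg (hβ : 0 < β) (y l xμ lμ : Vec n) : 0 ≤ Delta β y l xμ lμ := by
  unfold Delta; positivity

/-- The distance to the central pair decreases along the inner loop, by at least the operator gap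
and the squared residual. -/
theorem IsInnerLoop.two_mul_inner_add_le (h : IsInnerLoop P F μ β K x y lam) (hP : P.Regular)
    (hμ : 0 < μ) (hβ : 0 < β) (hc : IsCentralPair P F μ xμ lμ) {k : ℕ} (hk : k < K) :
    2 * inner ℝ (x (k + 1) - xμ) (F (x (k + 1)) - F xμ) + β * ‖x (k + 1) - y k‖ ^ 2
      ≤ Delta β (y k) (lam k) xμ lμ - Delta β (y (k + 1)) (lam (k + 1)) xμ lμ := by
  obtain ⟨hxμ, hlμ, hn⟩ := (isCentralPair_iff hP hμ).1 hc
  have h1 := ((h.normal k hk).sub hn).inner_sub_eq_zero (h.x_mem k hk) hxμ.2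
  have h2 := barrierGrad_monotone hP.contDiff hP.convex hμ.le _ (h.y_mem k hk) _ hxμ.1
  rw [← h.lam_eq k hk, ← hlμ] at h2
  have hls := h.lam_step k hk
  unfold Delta
  set X := x (k + 1) - xμ with hX
  set Y := y (k + 1) - xμ with hY
  set a := y k - xμ with ha
  set q := lam k - lμ with hq
  set f := F (x (k + 1)) - F xμ with hf
  have e1 : F (x (k + 1)) + lam k + β • (x (k + 1) - y k) - (F xμ + lμ) = f + q + β • (X - a) := by
    simp only [hX, ha, hq, hf]; module
  have e2 : lam (k + 1) - lμ = q + β • (X - Y) := by rw [hls]; simp only [hX, hY, hq]; module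
  have e3 : x (k + 1) - y k = X - a := by simp only [hX, ha]; module
  rw [e1] at h1
  rw [e2] at h2 ⊢
  rw [e3]
  clear_value X Y a q f
  simp only [inner_add_left, inner_sub_left, real_inner_smul_left, inner_add_right,
    inner_sub_right, inner_smul_right] at h1 h2
  rw [norm_add_sq_real, norm_smul, mul_pow, Real.norm_of_nonneg hβ.le, norm_sub_sq_real X a,
    norm_sub_sq_real X Y, inner_smul_right, inner_sub_right]
  have e4 : 1 / β * (‖q‖ ^ 2 + 2 * (β * (inner ℝ q X - inner ℝ q Y)) +
      β ^ 2 * (‖X‖ ^ 2 - 2 * inner ℝ X Y + ‖Y‖ ^ 2)) = 1 / β * ‖q‖ ^ 2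
      + 2 * (inner ℝ q X - inner ℝ q Y) + β * (‖X‖ ^ 2 - 2 * inner ℝ X Y + ‖Y‖ ^ 2) := by
    field_simp
  rw [e4]
  rw [real_inner_self_eq_norm_sq] at h1 h2
  rw [real_inner_comm f X]
  rw [real_inner_comm X a] at h1
  rw [real_inner_comm q Y, real_inner_comm X Y] at h2
  linarith

theorem IsInnerLoop.inner_nonneg (h : IsInnerLoop P F μ β K x y lam)
    (hmono : MonotoneOp F P.eqSet) (hP : P.Regular) (hμ : 0 < μ)
    (hc : IsCentralPair P F μ xμ lμ) {k : ℕ} (hk : k < K) :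
    0 ≤ inner ℝ (x (k + 1) - xμ) (F (x (k + 1)) - F xμ) :=
  hmono _ (h.x_mem k hk) _ ((isCentralPair_iff hP hμ).1 hc).1.2

theorem IsInnerLoop.inner_y_lam_nonneg (h : IsInnerLoop P F μ β K x y lam) (hP : P.Regular)
    (hμ : 0 < μ) {k : ℕ} (hk0 : 1 ≤ k) (hk : k < K) :
    0 ≤ inner ℝ (y (k + 1) - y k) (lam (k + 1) - lam k) := by
  obtain ⟨j, rfl⟩ := Nat.exists_eq_add_of_le' hk0
  rw [h.lam_eq _ hk, h.lam_eq j (by omega)]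
  exact barrierGrad_monotone hP.contDiff hP.convex hμ.le _ (h.y_mem _ hk) _ (h.y_mem j (by omega))

theorem norm_sq_add_norm_sq_le_of_inner_nonneg {a b : Vec n} (h : 0 ≤ inner ℝ a b) :
    ‖b‖ ^ 2 + ‖a‖ ^ 2 ≤ ‖a + b‖ ^ 2 := by
  rw [norm_add_sq_real]; linarith

/-- From the second iteration on, the residual controls both the primal and the dual step, since
consecutive multipliers are gradients of one convex function. -/
theorem IsInnerLoop.norm_sq_add_norm_sq_le (h : IsInnerLoop P F μ β K x y lam) (hP : P.Regular)
    (hμ : 0 < μ) (hβ : 0 < β) {k : ℕ} (hk0 : 1 ≤ k) (hk : k < K) :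
    ‖x (k + 1) - y (k + 1)‖ ^ 2 + ‖y (k + 1) - y k‖ ^ 2 ≤ ‖x (k + 1) - y k‖ ^ 2 := by
  have h1 := h.inner_y_lam_nonneg hP hμ hk0 hk
  rw [h.lam_step k hk, add_sub_cancel_left, inner_smul_right] at h1
  have h2 := norm_sq_add_norm_sq_le_of_inner_nonneg (nonneg_of_mul_nonneg_right h1 hβ)
  have e : y (k + 1) - y k + (x (k + 1) - y (k + 1)) = x (k + 1) - y k := by abel
  rwa [e] at h2

theorem IsInnerLoop.residual_antitone (h : IsInnerLoop P F μ β K x y lam)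
    (hmono : MonotoneOp F P.eqSet) (hP : P.Regular)
    (hμ : 0 < μ) (hβ : 0 < β) {k : ℕ} (hk0 : 1 ≤ k) (hk : k + 1 < K) :
    ‖x (k + 2) - y (k + 1)‖ ≤ ‖x (k + 1) - y k‖ := by
  have h1 := h.inner_y_lam_nonneg hP hμ hk0 (by omega : k < K)
  rw [h.lam_step k (by omega), add_sub_cancel_left, inner_smul_right] at h1
  have h1' := nonneg_of_mul_nonneg_right h1 hβ
  have h2 := ((h.normal (k + 1) hk).sub (h.normal k (by omega))).inner_sub_eq_zero
    (h.x_mem (k + 1) hk) (h.x_mem k (by omega))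
  have h3 := hmono _ (h.x_mem (k + 1) hk) _ (h.x_mem k (by omega))
  have hls := h.lam_step k (by omega)
  set d := x (k + 1 + 1) - x (k + 1) with hd
  set a := y (k + 1) - y k with ha
  set b := x (k + 1) - y (k + 1) with hb
  set f := F (x (k + 1 + 1)) - F (x (k + 1)) with hf
  have e1 : F (x (k + 1 + 1)) + lam (k + 1) + β • (x (k + 1 + 1) - y (k + 1)) -
      (F (x (k + 1)) + lam k + β • (x (k + 1) - y k)) = f + β • (b + d - a) := by
    rw [hls]; simp only [hd, ha, hb, hf]; module
  have e2 : x (k + 2) - y (k + 1) = d + b := by simp only [hd, hb]; module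
  have e3 : x (k + 1) - y k = a + b := by simp only [ha, hb]; module
  rw [e1, inner_add_left, real_inner_smul_left] at h2
  rw [real_inner_comm] at h3
  have h4 : inner ℝ (b + d - a) d ≤ 0 := by
    by_contra! hcon
    have := mul_pos hβ hcon
    linarith
  rw [e2, e3]
  have h5 := real_inner_le_norm (d + b) (a + b)
  have h6 : ‖d + b‖ ^ 2 ≤ inner ℝ (d + b) (a + b) := by
    rw [norm_add_sq_real]
    simp only [inner_add_left, inner_add_right, inner_sub_left] at h4 ⊢
    rw [real_inner_self_eq_norm_sq] at h4 ⊢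
    have c1 := real_inner_comm d b
    have c2 := real_inner_comm d a
    have c3 := real_inner_comm a b
    linarith
  by_contra! hcon
  have h7 : 0 < ‖d + b‖ := (norm_nonneg _).trans_lt hcon
  nlinarith

theorem IsInnerLoop.mul_residual_sq_le (h : IsInnerLoop P F μ β K x y lam)
    (hmono : MonotoneOp F P.eqSet) (hP : P.Regular) (hμ : 0 < μ) (hβ : 0 < β)
    (hc : IsCentralPair P F μ xμ lμ) {k : ℕ} (hk : k < K) :
    β * k * ‖x (k + 1) - y k‖ ^ 2
      ≤ Delta β (y 0) (lam 0) xμ lμ - Delta β (y (k + 1)) (lam (k + 1)) xμ lμ := by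
  have hstep : ∀ k < K, β * ‖x (k + 1) - y k‖ ^ 2
      ≤ Delta β (y k) (lam k) xμ lμ - Delta β (y (k + 1)) (lam (k + 1)) xμ lμ := fun k hk => by
    linarith [h.two_mul_inner_add_le hP hμ hβ hc hk, h.inner_nonneg hmono hP hμ hc hk]
  induction k with
  | zero =>
    have := hstep 0 hk
    have : 0 ≤ β * ‖x (0 + 1) - y 0‖ ^ 2 := by positivity
    simp only [Nat.cast_zero, mul_zero, zero_mul]
    linarith
  | succ k ih =>
    have h1 := ih (by omega)
    have h2 := hstep (k + 1) hk
    have h3 : β * k * ‖x (k + 1 + 1) - y (k + 1)‖ ^ 2 ≤ β * k * ‖x (k + 1) - y k‖ ^ 2 := by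
      rcases Nat.eq_zero_or_pos k with rfl | hk0
      · simp
      · exact mul_le_mul_of_nonneg_left (pow_le_pow_left₀ (norm_nonneg _)
          (h.residual_antitone hmono hP hμ hβ hk0 hk) 2) (by positivity)
    push_cast
    linarith

theorem IsInnerLoop.Delta_le (h : IsInnerLoop P F μ β K x y lam)
    (hmono : MonotoneOp F P.eqSet) (hP : P.Regular) (hμ : 0 < μ) (hβ : 0 < β)
    (hc : IsCentralPair P F μ xμ lμ) {k : ℕ} (hk : k ≤ K) :
    Delta β (y k) (lam k) xμ lμ ≤ Delta β (y 0) (lam 0) xμ lμ := by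
  rcases k with _ | k
  · exact le_rfl
  · have h1 := h.mul_residual_sq_le hmono hP hμ hβ hc (k := k) (by omega)
    have h2 : 0 ≤ β * k * ‖x (k + 1) - y k‖ ^ 2 := by positivity
    linarith

/-- The last residual is `O(1/√K)`, being the smallest from the second one on. -/
theorem IsInnerLoop.last_residual_sq_le (h : IsInnerLoop P F μ β K x y lam)
    (hmono : MonotoneOp F P.eqSet) (hP : P.Regular) (hμ : 0 < μ) (hβ : 0 < β)
    (hc : IsCentralPair P F μ xμ lμ) (hK : 2 ≤ K) :
    ‖x K - y (K - 1)‖ ^ 2 ≤ 2 * Delta β (y 0) (lam 0) xμ lμ / (β * K) := by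
  obtain ⟨k, rfl⟩ : ∃ k, K = k + 1 := ⟨K - 1, by omega⟩
  have h1 := h.mul_residual_sq_le hmono hP hμ hβ hc (k := k) (by omega)
  have h2 := Delta_nonneg hβ (y (k + 1)) (lam (k + 1)) xμ lμ
  rw [Nat.add_sub_cancel, le_div_iff₀ (by positivity)]
  have hk : (1 : ℝ) ≤ k := by exact_mod_cast (by omega : 1 ≤ k)
  push_cast
  have h3 : ‖x (k + 1) - y k‖ ^ 2 * (β * (k + 1)) ≤ ‖x (k + 1) - y k‖ ^ 2 * (β * (2 * k)) := by
    gcongr; linarith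
  linarith

theorem IsInnerLoop.last_primal_dual_le (h : IsInnerLoop P F μ β K x y lam)
    (hmono : MonotoneOp F P.eqSet) (hP : P.Regular) (hμ : 0 < μ) (hβ : 0 < β)
    (hc : IsCentralPair P F μ xμ lμ) (hK : 2 ≤ K) :
    ‖x K - y K‖ ^ 2 + ‖y K - y (K - 1)‖ ^ 2 ≤ 2 * Delta β (y 0) (lam 0) xμ lμ / (β * K) := by
  refine le_trans ?_ (h.last_residual_sq_le hmono hP hμ hβ hc hK)
  obtain ⟨k, rfl⟩ : ∃ k, K = k + 1 := ⟨K - 1, by omega⟩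
  exact h.norm_sq_add_norm_sq_le hP hμ hβ (k := k) (by omega) (by omega)

theorem IsInnerLoop.last_normal (h : IsInnerLoop P F μ β K x y lam) (hK : 2 ≤ K) :
    P.IsNormal (F (x K) + lam K + β • (y K - y (K - 1))) := by
  obtain ⟨k, rfl⟩ : ∃ k, K = k + 1 := ⟨K - 1, by omega⟩
  have h1 := h.normal k (by omega)
  rw [h.lam_step k (by omega), Nat.add_sub_cancel]
  convert h1 using 1
  module

theorem IsInnerLoop.norm_last_sub_central_sq_le (h : IsInnerLoop P F μ β K x y lam)
    (hmono : MonotoneOp F P.eqSet) (hP : P.Regular) (hμ : 0 < μ) (hβ : 0 < β)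
    (hc : IsCentralPair P F μ xμ lμ) (hK : 2 ≤ K) :
    ‖x K - xμ‖ ^ 2 ≤ Delta β (y 0) (lam 0) xμ lμ / β := by
  obtain ⟨k, rfl⟩ : ∃ k, K = k + 2 := ⟨K - 2, by omega⟩
  obtain ⟨hxμ, hlμ, hn⟩ := (isCentralPair_iff hP hμ).1 hc
  have h1 := ((h.normal (k + 1) (by omega)).sub hn).inner_sub_eq_zero
    (h.x_mem (k + 1) (by omega)) hxμ.2
  have h2 := barrierGrad_monotone hP.contDiff hP.convex hμ.le _ (h.y_mem k (by omega)) _ hxμ.1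
  rw [← h.lam_eq k (by omega), ← hlμ] at h2
  have h3 := h.inner_nonneg hmono hP hμ hc (k := k + 1) (by omega)
  have h4 := h.Delta_le hmono hP hμ hβ hc (k := k + 1) (by omega)
  refine le_trans ?_ (div_le_div_of_nonneg_right h4 hβ.le)
  unfold Delta
  change ‖x (k + 1 + 1) - xμ‖ ^ 2 ≤ _
  set X := x (k + 1 + 1) - xμ with hX
  set a := y (k + 1) - xμ with ha
  set q := lam (k + 1) - lμ with hq
  set f := F (x (k + 1 + 1)) - F xμ with hf
  have e1 : F (x (k + 1 + 1)) + lam (k + 1) + β • (x (k + 1 + 1) - y (k + 1)) - (F xμ + lμ)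
      = f + (β • X - (β • a - q)) := by simp only [hX, ha, hq, hf]; module
  rw [e1] at h1
  clear_value X a q f
  rw [inner_add_left, inner_sub_left, real_inner_smul_left, real_inner_self_eq_norm_sq,
    real_inner_comm] at h1
  have h5 := real_inner_le_norm (β • a - q) X
  have h6 : β * ‖X‖ ≤ ‖β • a - q‖ := by
    by_contra! hcon
    have h7 : 0 < ‖X‖ := by
      have := (norm_nonneg _).trans_lt hcon
      by_contra h0
      have := mul_nonpos_of_nonneg_of_nonpos hβ.le (not_lt.1 h0)
      linarith
    nlinarith
  have h7 : ‖β • a - q‖ ^ 2 ≤ β ^ 2 * ‖a‖ ^ 2 + ‖q‖ ^ 2 := by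
    rw [norm_sub_sq_real, norm_smul, mul_pow, Real.norm_of_nonneg hβ.le, real_inner_smul_left]
    nlinarith [mul_nonneg hβ.le h2]
  have h8 := pow_le_pow_left₀ (by positivity) h6 2
  rw [mul_pow] at h8
  rw [le_div_iff₀ hβ, ← mul_le_mul_iff_of_pos_left hβ]
  have e2 : β * (1 / β * ‖q‖ ^ 2 + β * ‖a‖ ^ 2) = ‖q‖ ^ 2 + β ^ 2 * ‖a‖ ^ 2 := by field_simp
  rw [e2]
  nlinarith

theorem sq_norm_sub_sq_norm_le (a b : Vec n) {s : ℝ} (hs : 0 < s) :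
    ‖a‖ ^ 2 - ‖b‖ ^ 2 ≤ s / 2 * ‖b - a‖ ^ 2 + (‖a‖ ^ 2 + ‖b‖ ^ 2) / s := by
  have e : ‖a‖ ^ 2 - ‖b‖ ^ 2 = inner ℝ (a - b) (a + b) := by
    rw [inner_sub_left, inner_add_right, inner_add_right, real_inner_self_eq_norm_sq,
      real_inner_self_eq_norm_sq, real_inner_comm a b]; ring
  have h1 : ‖a + b‖ ^ 2 ≤ 2 * (‖a‖ ^ 2 + ‖b‖ ^ 2) := by
    have := parallelogram_law_with_norm ℝ a b
    nlinarith [sq_nonneg ‖a - b‖]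
  have h2 := real_inner_le_norm (a - b) (a + b)
  have h3 : ‖a - b‖ * ‖a + b‖ ≤ s / 2 * ‖a - b‖ ^ 2 + ‖a + b‖ ^ 2 / (2 * s) := by
    have e2 : s / 2 * ‖a - b‖ ^ 2 + ‖a + b‖ ^ 2 / (2 * s) - ‖a - b‖ * ‖a + b‖
        = (s * ‖a - b‖ - ‖a + b‖) ^ 2 / (2 * s) := by field_simp; ring
    have : 0 ≤ (s * ‖a - b‖ - ‖a + b‖) ^ 2 / (2 * s) := by positivity
    linarith
  have h4 : ‖a + b‖ ^ 2 / (2 * s) ≤ (‖a‖ ^ 2 + ‖b‖ ^ 2) / s := by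
    rw [div_le_div_iff₀ (by positivity) hs]; nlinarith
  rw [norm_sub_rev b a]
  linarith

/-- The operator gap of the last iterate is `O(1/√K)`: it is at most half the decrease of the
distance to the central pair, which is small because consecutive iterates are close. -/
theorem IsInnerLoop.inner_last_le (h : IsInnerLoop P F μ β K x y lam)
    (hmono : MonotoneOp F P.eqSet) (hP : P.Regular) (hμ : 0 < μ) (hβ : 0 < β)
    (hc : IsCentralPair P F μ xμ lμ) (hK : 2 ≤ K) :
    inner ℝ (x K - xμ) (F (x K) - F xμ) ≤ 2 * Delta β (y 0) (lam 0) xμ lμ / √K := by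
  have h1 := h.last_primal_dual_le hmono hP hμ hβ hc hK
  obtain ⟨k, hk⟩ : ∃ k, K = k + 1 := ⟨K - 1, by omega⟩
  have h2 := h.two_mul_inner_add_le hP hμ hβ hc (k := k) (by omega)
  have h3 := h.Delta_le hmono hP hμ hβ hc (k := k) (by omega)
  have h4 := h.Delta_le hmono hP hμ hβ hc (k := k + 1) (by omega)
  have hls := h.lam_step k (by omega)
  have hk' : K - 1 = k := by omega
  rw [hk', hk] at h1
  have hs : 0 < √(K : ℝ) := Real.sqrt_pos.2 (by positivity)
  have hsq : √(K : ℝ) ^ 2 = K := Real.sq_sqrt (by positivity)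
  rw [← hk] at h1 h2 h4 hls
  set Δ := Delta β (y 0) (lam 0) xμ lμ
  have hΔ : 0 ≤ Δ := Delta_nonneg hβ _ _ _ _
  have h5 := sq_norm_sub_sq_norm_le (lam k - lμ) (lam K - lμ) hs
  have h6 := sq_norm_sub_sq_norm_le (y k - xμ) (y K - xμ) hs
  rw [sub_sub_sub_cancel_right] at h5 h6
  have e1 : ‖lam K - lam k‖ ^ 2 = β ^ 2 * ‖x K - y K‖ ^ 2 := by
    rw [hls, add_sub_cancel_left, norm_smul, mul_pow, Real.norm_of_nonneg hβ.le]
  rw [e1] at h5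
  unfold Delta at h2 h3 h4
  have h7 : 0 ≤ β * ‖x K - y k‖ ^ 2 := by positivity
  set s := √(K : ℝ)
  have h8 := mul_le_mul_of_nonneg_left h5 (one_div_pos.2 hβ).le
  have h9 := mul_le_mul_of_nonneg_left h6 hβ.le
  have e2 : 1 / β * (s / 2 * (β ^ 2 * ‖x K - y K‖ ^ 2)
      + (‖lam k - lμ‖ ^ 2 + ‖lam K - lμ‖ ^ 2) / s) + β * (s / 2 * ‖y K - y k‖ ^ 2
      + (‖y k - xμ‖ ^ 2 + ‖y K - xμ‖ ^ 2) / s)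
      = s / 2 * (β * (‖x K - y K‖ ^ 2 + ‖y K - y k‖ ^ 2))
        + ((1 / β * ‖lam k - lμ‖ ^ 2 + β * ‖y k - xμ‖ ^ 2)
        + (1 / β * ‖lam K - lμ‖ ^ 2 + β * ‖y K - xμ‖ ^ 2)) / s := by
    field_simp; ring
  have h10 : s / 2 * (β * (‖x K - y K‖ ^ 2 + ‖y K - y k‖ ^ 2)) ≤ Δ / s := by
    have : β * (‖x K - y K‖ ^ 2 + ‖y K - y k‖ ^ 2) ≤ 2 * Δ / s ^ 2 := by
      calc β * (‖x K - y K‖ ^ 2 + ‖y K - y k‖ ^ 2) ≤ β * (2 * Δ / (β * K)) :=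
            mul_le_mul_of_nonneg_left h1 hβ.le
        _ = 2 * Δ / s ^ 2 := by rw [hsq]; field_simp
    calc _ ≤ s / 2 * (2 * Δ / s ^ 2) := mul_le_mul_of_nonneg_left this (by positivity)
      _ = Δ / s := by field_simp
  have h11 : ((1 / β * ‖lam k - lμ‖ ^ 2 + β * ‖y k - xμ‖ ^ 2)
        + (1 / β * ‖lam K - lμ‖ ^ 2 + β * ‖y K - xμ‖ ^ 2)) / s ≤ 2 * (Δ / s) := by
    rw [← mul_div_assoc]
    exact div_le_div_of_nonneg_right (by linarith) hs.le
  have h12 : 2 * Δ / s = 2 * (Δ / s) := by ring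
  have h13 : 0 ≤ Δ / s := by positivity
  rw [h12]
  linarith

theorem IsInnerLoop.sum_inner_le (h : IsInnerLoop P F μ β K x y lam) (hP : P.Regular)
    (hμ : 0 < μ) (hβ : 0 < β) (hc : IsCentralPair P F μ xμ lμ) :
    ∑ k ∈ Finset.Icc 1 K, inner ℝ (x k - xμ) (F (x k) - F xμ)
      ≤ Delta β (y 0) (lam 0) xμ lμ / 2 := by
  have key : ∀ j ≤ K, 2 * ∑ k ∈ Finset.Icc 1 j, inner ℝ (x k - xμ) (F (x k) - F xμ)
      ≤ Delta β (y 0) (lam 0) xμ lμ - Delta β (y j) (lam j) xμ lμ := by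
    intro j
    induction j with
    | zero => simp
    | succ j ih =>
      intro hj
      have h1 := ih (by omega)
      have h2 := h.two_mul_inner_add_le hP hμ hβ hc (k := j) (by omega)
      have h3 : 0 ≤ β * ‖x (j + 1) - y j‖ ^ 2 := by positivity
      rw [Finset.sum_Icc_succ_top (by omega)]
      linarith
  have h1 := key K le_rfl
  have h2 := Delta_nonneg hβ (y K) (lam K) xμ lμ
  linarith

theorem average_sub (hK : 1 ≤ K) (x : ℕ → Vec n) (z : Vec n) :
    average x K - z = (1 / (K : ℝ)) • ∑ k ∈ Finset.Icc 1 K, (x k - z) := by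
  have hK' : (K : ℝ) ≠ 0 := by positivity
  rw [Finset.sum_sub_distrib, smul_sub, average]
  simp only [Finset.sum_const, Nat.card_Icc, Nat.add_sub_cancel]
  rw [← Nat.cast_smul_eq_nsmul ℝ, smul_smul, one_div_mul_cancel hK', one_smul]

theorem IsInnerLoop.average_mem (h : IsInnerLoop P F μ β K x y lam) (hK : 1 ≤ K) :
    average x K ∈ P.eqSet := by
  have hK' : (K : ℝ) ≠ 0 := by positivity
  rw [average, Finset.smul_sum]
  refine convex_eqSet.sum_mem (fun _ _ => by positivity) (by simp [hK']) fun k hk => ?_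
  rw [Finset.mem_Icc] at hk
  obtain ⟨j, rfl⟩ := Nat.exists_eq_add_of_le' hk.1
  exact h.x_mem j (by omega)

/-- Averaging and the convexity of `s ↦ s ^ ξ` turn the telescoping sum into a bound for the average
iterate. -/
theorem IsInnerLoop.norm_average_sub_central_le (h : IsInnerLoop P F μ β K x y lam)
    (hP : P.Regular) (hμ : 0 < μ) (hβ : 0 < β) (hc : IsCentralPair P F μ xμ lμ) (hK : 1 ≤ K)
    {c ξ : ℝ} (hc0 : 0 < c) (hξ : 1 < ξ) (hxi : XiMonotoneOp F P.eqSet c ξ) :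
    c * ‖average x K - xμ‖ ^ ξ ≤ Delta β (y 0) (lam 0) xμ lμ / 2 / K := by
  have hK' : (0 : ℝ) < K := by positivity
  obtain ⟨hxμ, -, -⟩ := (isCentralPair_iff hP hμ).1 hc
  have h1 : ‖average x K - xμ‖ ≤ ∑ k ∈ Finset.Icc 1 K, 1 / (K : ℝ) * ‖x k - xμ‖ := by
    rw [average_sub hK, norm_smul, Real.norm_of_nonneg (by positivity), ← Finset.mul_sum]
    exact mul_le_mul_of_nonneg_left (norm_sum_le _ _) (by positivity)
  have h2 := Real.rpow_arith_mean_le_arith_mean_rpow (Finset.Icc 1 K) (fun _ => 1 / (K : ℝ))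
    (fun k => ‖x k - xμ‖) (fun _ _ => by positivity) (by simp [hK'.ne'])
    (fun _ _ => norm_nonneg _) hξ.le
  have h3 : ‖average x K - xμ‖ ^ ξ ≤ ∑ k ∈ Finset.Icc 1 K, 1 / (K : ℝ) * ‖x k - xμ‖ ^ ξ :=
    (Real.rpow_le_rpow (norm_nonneg _) h1 (by linarith)).trans h2
  have h4 : ∑ k ∈ Finset.Icc 1 K, c * ‖x k - xμ‖ ^ ξ ≤ Delta β (y 0) (lam 0) xμ lμ / 2 := by
    refine le_trans (Finset.sum_le_sum fun k hk => ?_) (h.sum_inner_le hP hμ hβ hc)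
    rw [Finset.mem_Icc] at hk
    obtain ⟨j, rfl⟩ := Nat.exists_eq_add_of_le' hk.1
    exact hxi _ (h.x_mem j (by omega)) _ hxμ.2
  rw [le_div_iff₀ hK']
  rw [← Finset.mul_sum] at h3 h4
  calc c * ‖average x K - xμ‖ ^ ξ * K
      ≤ c * (1 / (K : ℝ) * ∑ k ∈ Finset.Icc 1 K, ‖x k - xμ‖ ^ ξ) * K := by gcongr
    _ = c * ∑ k ∈ Finset.Icc 1 K, ‖x k - xμ‖ ^ ξ := by field_simp
    _ ≤ _ := h4

end InnerLoop

/-! ### Uniform bounds along the run -/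

section Uniform

variable {n m p : ℕ} {P : Constraints n m p} {F : Vec n → Vec n} {L : ℝ}

theorem exists_slater_slack {z₀ : Vec n} (hz₀ : z₀ ∈ P.ltSet) : ∃ σ > 0, ∀ i, P.φ i z₀ ≤ -σ := by
  rcases isEmpty_or_nonempty (Fin m) with h | h
  · exact ⟨1, one_pos, fun i => (h.false i).elim⟩
  · obtain ⟨j, hj⟩ := Finite.exists_max fun i => P.φ i z₀
    exact ⟨-(P.φ j z₀), by have := hz₀ j; linarith, fun i => by rw [neg_neg]; exact hj i⟩

/-- A linear error bound: moving towards a Slater point repairs a violation `h` of the inequality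
constraints at a cost proportional to `h`. -/
theorem exists_error_bound (hP : P.Regular) : ∃ κ ≥ 0, ∀ x ∈ P.eqSet, ∀ h ≥ 0,
    (∀ i, P.φ i x ≤ h) → ∃ z ∈ P.feasible, ‖x - z‖ ≤ κ * h := by
  obtain ⟨z₀, hz₀⟩ := hP.interior_nonempty
  obtain ⟨σ, hσ, hslack⟩ := exists_slater_slack hz₀.1
  obtain ⟨R, hR⟩ := hP.compact.isBounded.exists_norm_le
  have hR0 : 0 ≤ R := (norm_nonneg _).trans (hR _ (feasible_of_mem hz₀))
  refine ⟨2 * R / σ, by positivity, fun x hx h hh hφ => ?_⟩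
  have hhσ : 0 < h + σ := by linarith
  set z := (σ / (h + σ)) • x + (h / (h + σ)) • z₀ with hz
  have hsum : σ / (h + σ) + h / (h + σ) = 1 := by field_simp; ring
  have hzf : z ∈ P.feasible := by
    refine ⟨fun i => ?_, convex_eqSet hx hz₀.2 (by positivity) (by positivity) hsum⟩
    have h1 := (hP.convex i).2 (Set.mem_univ x) (Set.mem_univ z₀)
      (show 0 ≤ σ / (h + σ) by positivity) (show 0 ≤ h / (h + σ) by positivity) hsum
    simp only [smul_eq_mul] at h1
    have h2 := mul_le_mul_of_nonneg_left (hφ i) (show 0 ≤ σ / (h + σ) by positivity)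
    have h3 := mul_le_mul_of_nonneg_left (hslack i) (show 0 ≤ h / (h + σ) by positivity)
    have h4 : σ / (h + σ) * h + h / (h + σ) * -σ = 0 := by field_simp; ring
    linarith
  refine ⟨z, hzf, ?_⟩
  have e : x - z = (h / σ) • (z - z₀) := by
    have h1 : h / (h + σ) = 1 - σ / (h + σ) := by linarith
    have h2 : h / σ * (σ / (h + σ)) = 1 - σ / (h + σ) := by rw [← h1]; field_simp
    have h3 : z - z₀ = (σ / (h + σ)) • (x - z₀) := by rw [hz, h1]; module
    rw [h3, smul_smul, h2, hz, h1]; module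
  rw [e, norm_smul, Real.norm_of_nonneg (by positivity)]
  have h5 : ‖z - z₀‖ ≤ 2 * R := by
    refine (norm_sub_le _ _).trans ?_
    linarith [hR _ hzf, hR _ (feasible_of_mem hz₀)]
  calc h / σ * ‖z - z₀‖ ≤ h / σ * (2 * R) := mul_le_mul_of_nonneg_left h5 (by positivity)
    _ = 2 * R / σ * h := by ring

theorem exists_gradient_bound (hd : ∀ i, ContDiff ℝ 1 (P.φ i)) (R : ℝ) :
    ∃ G ≥ 0, ∀ i, ∀ x : Vec n, ‖x‖ ≤ R → ‖gradient (P.φ i) x‖ ≤ G := by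
  have : ∀ i, ∃ G : ℝ, ∀ x : Vec n, ‖x‖ ≤ R → ‖gradient (P.φ i) x‖ ≤ G := by
    intro i
    obtain ⟨G, hG⟩ := (isCompact_closedBall (0 : Vec n) R).exists_bound_of_continuousOn
      (continuous_gradient_constraint hd i).continuousOn
    exact ⟨G, fun x hx => hG x (by simpa using hx)⟩
  choose G hG using this
  refine ⟨∑ i, |G i|, Finset.sum_nonneg fun i _ => abs_nonneg _, fun i x hx => ?_⟩
  exact ((hG i x hx).trans (le_abs_self _)).trans
    (Finset.single_le_sum (f := fun i => |G i|) (fun i _ => abs_nonneg _) (Finset.mem_univ i))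

theorem constraint_le_add (hd : ∀ i, ContDiff ℝ 1 (P.φ i))
    (hcv : ∀ i, ConvexOn ℝ Set.univ (P.φ i)) (i : Fin m) (x y : Vec n) :
    P.φ i x ≤ P.φ i y + ‖gradient (P.φ i) x‖ * ‖x - y‖ := by
  have h1 := inner_le_sub_of_convexOn (hcv i) (hasGradientAt_constraint hd i x) y
  have h2 := real_inner_le_norm (gradient (P.φ i) x) (x - y)
  rw [← neg_sub x y, inner_neg_right] at h1
  linarith

/-- Slater's condition bounds the multipliers at approximate KKT points, uniformly in the barrier
parameter. -/
theorem exists_multiplier_bound (hP : P.Regular) (hL : 0 < L) (hLip : LipschitzOp F P.eqSet L)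
    {μmax : ℝ} : ∃ ρ > 0, ∃ Λ : ℝ, ∀ μ > 0, μ ≤ μmax → ∀ x ∈ P.eqSet, ∀ y ∈ P.ltSet, ∀ q : Vec n,
      P.IsNormal (F x + P.barrierGrad μ y + q) → ‖x - y‖ ≤ ρ → ‖q‖ ≤ 1 →
      (∃ z ∈ P.feasible, ‖x - z‖ ≤ 1) → ‖P.barrierGrad μ y‖ ≤ Λ := by
  obtain ⟨z₀, hz₀⟩ := hP.interior_nonempty
  obtain ⟨σ, hσ, hslack⟩ := exists_slater_slack hz₀.1
  obtain ⟨R, hR⟩ := hP.compact.isBounded.exists_norm_le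
  obtain ⟨N, hN⟩ := (hP.compact.image_of_continuousOn
    (hLip.continuousOn.mono fun x hx => hx.2)).isBounded.exists_norm_le
  obtain ⟨G, hG0, hG⟩ := exists_gradient_bound (P := P) hP.contDiff (R + 2)
  have hR0 : 0 ≤ R := (norm_nonneg _).trans (hR _ (feasible_of_mem hz₀))
  have hN0 : 0 ≤ N := (norm_nonneg _).trans (hN _ ⟨_, feasible_of_mem hz₀, rfl⟩)
  refine ⟨min 1 (σ / (2 * (G + 1))), by positivity,
    G * (2 / σ * (m * μmax + (N + L + 1) * (2 * R + 1))), ?_⟩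
  rintro μ hμ hμmax x hx y hy q hn hxy hq ⟨z, hz, hxz⟩
  have hxR : ‖x‖ ≤ R + 1 := by
    have := norm_add_le (x - z) z
    rw [sub_add_cancel] at this
    linarith [hR z hz]
  have hyR : ‖y‖ ≤ R + 2 := by
    have := norm_sub_le x (x - y)
    rw [sub_sub_cancel] at this
    linarith [hxy.trans (min_le_left _ _)]
  have hFx : ‖F x‖ ≤ N + L := by
    have h1 := hLip x hx z hz.2
    have h2 := norm_add_le (F x - F z) (F z)
    rw [sub_add_cancel] at h2
    have h3 := hN _ ⟨z, hz, rfl⟩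
    nlinarith
  have hcoef : ∀ i, 0 ≤ μ / -(P.φ i y) := fun i =>
    div_nonneg hμ.le (by have := hy i; linarith)
  set S := ∑ i, μ / -(P.φ i y) with hS
  have hS0 : 0 ≤ S := Finset.sum_nonneg fun i _ => hcoef i
  have hgrad : ‖P.barrierGrad μ y‖ ≤ G * S := by
    rw [hS, Finset.mul_sum]
    refine norm_sum_le_of_le _ fun i _ => ?_
    rw [norm_smul, Real.norm_of_nonneg (hcoef i), mul_comm]
    exact mul_le_mul_of_nonneg_right (hG i y hyR) (hcoef i)
  refine hgrad.trans (mul_le_mul_of_nonneg_left ?_ hG0)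
  have h1 := inner_barrierGrad_le hP.contDiff hP.convex hμ.le hy z₀
  have h2 : ∑ i, μ / -(P.φ i y) * P.φ i z₀ ≤ -σ * S := by
    rw [hS, Finset.mul_sum]
    refine Finset.sum_le_sum fun i _ => ?_
    rw [mul_comm]
    exact mul_le_mul_of_nonneg_right (hslack i) (hcoef i)
  have h3 := hn.inner_sub_eq_zero hz₀.2 hx
  have e : F x + P.barrierGrad μ y + q = (F x + q) + P.barrierGrad μ y := by abel
  rw [e, inner_add_left] at h3
  have h4 : inner ℝ (F x + q) (z₀ - x) ≤ (N + L + 1) * (2 * R + 1) := by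
    refine (real_inner_le_norm _ _).trans (mul_le_mul ?_ ?_ (norm_nonneg _) (by positivity))
    · exact (norm_add_le _ _).trans (add_le_add hFx hq)
    · refine (norm_sub_le _ _).trans ?_
      linarith [hR _ (feasible_of_mem hz₀)]
  have h5 : inner ℝ (P.barrierGrad μ y) (y - x) ≤ σ / 2 * S := by
    refine (real_inner_le_norm _ _).trans ?_
    rw [norm_sub_rev]
    have h6 := hxy.trans (min_le_right _ _)
    calc ‖P.barrierGrad μ y‖ * ‖x - y‖ ≤ (G * S) * (σ / (2 * (G + 1))) :=
          mul_le_mul hgrad h6 (norm_nonneg _) (by positivity)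
      _ = σ / 2 * S * (G / (G + 1)) := by field_simp
      _ ≤ σ / 2 * S * 1 := by
          refine mul_le_mul_of_nonneg_left ?_ (by positivity)
          rw [div_le_one (by positivity)]; linarith
      _ = σ / 2 * S := mul_one _
  have e2 : z₀ - y = (z₀ - x) - (y - x) := by abel
  rw [e2, inner_sub_right] at h1
  have h7 : (m : ℝ) * μ ≤ m * μmax := mul_le_mul_of_nonneg_left hμmax (Nat.cast_nonneg m)
  rw [div_mul_eq_mul_div, le_div_iff₀ hσ]
  linarith

theorem eventually_div_sqrt_le (D : ℝ) {ε : ℝ} (hε : 0 < ε) :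
    ∀ᶠ K : ℕ in Filter.atTop, D / √(K : ℝ) ≤ ε := by
  have h : Filter.Tendsto (fun K : ℕ => D / √(K : ℝ)) Filter.atTop (nhds 0) :=
    Filter.Tendsto.div_atTop tendsto_const_nhds
      (Real.tendsto_sqrt_atTop.comp tendsto_natCast_atTop_atTop)
  exact h.eventually_le_const hε

/-- At the end of an inner loop that starts at bounded distance from the central pair, all defects
are `O(1/√K)`. -/
theorem exists_last_defect_bound (hP : P.Regular) (hmono : MonotoneOp F P.eqSet) {β : ℝ}
    (hβ : 0 < β) {B : ℝ} (hB : 0 ≤ B) : ∃ D ≥ 0, ∀ μ > 0, ∀ xμ lμ, IsCentralPair P F μ xμ lμ →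
      ∀ K ≥ 2, ∀ x y lam, IsInnerLoop P F μ β K x y lam → Delta β (y 0) (lam 0) xμ lμ ≤ B →
        ‖x K - y K‖ ≤ D / √K ∧ ‖y K - y (K - 1)‖ ≤ D / √K ∧ (∀ i, P.φ i (x K) ≤ D / √K) ∧
          ∃ z ∈ P.feasible, ‖x K - z‖ ≤ D / √K := by
  obtain ⟨κ, hκ, hproj⟩ := exists_error_bound hP
  obtain ⟨R, hR⟩ := hP.compact.isBounded.exists_norm_le
  obtain ⟨G, hG0, hG⟩ := exists_gradient_bound (P := P) hP.contDiff (R + √(B / β))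
  set D₀ := √(2 * B / β) with hD₀
  have hD₀0 : 0 ≤ D₀ := Real.sqrt_nonneg _
  refine ⟨D₀ + G * D₀ + κ * (G * D₀), by positivity, ?_⟩
  intro μ hμ xμ lμ hc K hK x y lam h hΔ
  have hKpos : (0 : ℝ) < K := by exact_mod_cast (by omega : 0 < K)
  have hs : 0 < √(K : ℝ) := Real.sqrt_pos.2 hKpos
  have hbound : ‖x K - y K‖ ^ 2 + ‖y K - y (K - 1)‖ ^ 2 ≤ (D₀ / √K) ^ 2 := by
    refine (h.last_primal_dual_le hmono hP hμ hβ hc hK).trans ?_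
    rw [div_pow, hD₀, Real.sq_sqrt (by positivity), Real.sq_sqrt hKpos.le, div_div]
    gcongr
  have hD0s : 0 ≤ D₀ / √K := by positivity
  have hxy : ‖x K - y K‖ ≤ D₀ / √K :=
    (pow_le_pow_iff_left₀ (norm_nonneg _) hD0s two_ne_zero).1
      (by linarith [sq_nonneg ‖y K - y (K - 1)‖])
  have hyy : ‖y K - y (K - 1)‖ ≤ D₀ / √K :=
    (pow_le_pow_iff_left₀ (norm_nonneg _) hD0s two_ne_zero).1
      (by linarith [sq_nonneg ‖x K - y K‖])
  have hxK : ‖x K‖ ≤ R + √(B / β) := by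
    have h1 : ‖x K - xμ‖ ≤ √(B / β) := by
      apply Real.le_sqrt_of_sq_le
      exact (h.norm_last_sub_central_sq_le hmono hP hμ hβ hc hK).trans
        (div_le_div_of_nonneg_right hΔ hβ.le)
    have h2 := norm_add_le (x K - xμ) xμ
    rw [sub_add_cancel] at h2
    linarith [hR _ (feasible_of_mem ((isCentralPair_iff hP hμ).1 hc).1)]
  obtain ⟨k, rfl⟩ : ∃ k, K = k + 1 := ⟨K - 1, by omega⟩
  have hφ : ∀ i, P.φ i (x (k + 1)) ≤ G * (D₀ / √((k + 1 : ℕ) : ℝ)) := by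
    intro i
    have h1 := constraint_le_add hP.contDiff hP.convex i (x (k + 1)) (y (k + 1))
    have h2 := h.y_mem k (by omega) i
    have h3 := mul_le_mul (hG i _ hxK) hxy (norm_nonneg _) hG0
    linarith
  obtain ⟨z, hz, hxz⟩ := hproj _ (h.x_mem k (by omega)) _ (mul_nonneg hG0 hD0s) hφ
  rw [add_div, add_div, mul_div_assoc, mul_div_assoc, mul_div_assoc]
  have h4 : 0 ≤ G * (D₀ / √((k + 1 : ℕ) : ℝ)) := by positivity
  have h5 : 0 ≤ κ * (G * (D₀ / √((k + 1 : ℕ) : ℝ))) := by positivity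
  exact ⟨by linarith, by linarith, fun i => by linarith [hφ i], z, hz, by linarith⟩

theorem muSeq_pos {μinit δ : ℝ} (hμ : 0 < μinit) (hδ : 0 < δ) (t : ℕ) : 0 < muSeq μinit δ t := by
  unfold muSeq; positivity

theorem muSeq_le {μinit δ : ℝ} (hμ : 0 < μinit) (hδ₀ : 0 < δ) (hδ₁ : δ < 1) (t : ℕ) :
    muSeq μinit δ t ≤ μinit := by
  unfold muSeq
  exact mul_le_of_le_one_left hμ.le (pow_le_one₀ hδ₀.le hδ₁.le)

/-- The inner loops start at uniformly bounded distance from the central pairs. Warm starting could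
accumulate errors; but a long inner loop ends at an approximate KKT point, and those lie in a set
that does not depend on where the loop started. -/
theorem exists_Delta_bound (hP : P.Regular) (hL : 0 < L) (hmono : MonotoneOp F P.eqSet)
    (hLip : LipschitzOp F P.eqSet L) {μinit β δ : ℝ} (hμ : 0 < μinit) (hβ : 0 < β) (hδ₀ : 0 < δ)
    (hδ₁ : δ < 1) (y₀ l₀ : Vec n) {xμ lμ : ℝ → Vec n}
    (hc : ∀ μ > 0, IsCentralPair P F μ (xμ μ) (lμ μ)) :
    ∃ B ≥ 0, ∀ᶠ K : ℕ in Filter.atTop, ∀ T, ∀ x y lam,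
      IsACVIRun P F μinit β δ y₀ l₀ T K x y lam → ∀ t < T,
        Delta β (y t 0) (lam t 0) (xμ (muSeq μinit δ t)) (lμ (muSeq μinit δ t)) ≤ B := by
  obtain ⟨ρ, hρ, Λ, hΛ⟩ := exists_multiplier_bound (F := F) (μmax := μinit) hP hL hLip
  obtain ⟨R, hR⟩ := hP.compact.isBounded.exists_norm_le
  have hR0 : 0 ≤ R := (norm_nonneg _).trans (hR _ (feasible_of_mem hP.interior_nonempty.some_mem))
  have hxμ : ∀ t, ‖xμ (muSeq μinit δ t)‖ ≤ R := fun t =>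
    hR _ (feasible_of_mem ((isCentralPair_iff hP (muSeq_pos hμ hδ₀ t)).1
      (hc _ (muSeq_pos hμ hδ₀ t))).1)
  have hlμ : ∀ t, ‖lμ (muSeq μinit δ t)‖ ≤ Λ := fun t => by
    obtain ⟨hx, hl, hn⟩ := (isCentralPair_iff hP (muSeq_pos hμ hδ₀ t)).1
      (hc _ (muSeq_pos hμ hδ₀ t))
    rw [hl] at hn ⊢
    exact hΛ _ (muSeq_pos hμ hδ₀ t) (muSeq_le hμ hδ₀ hδ₁ t) _ hx.2 _ hx.1 0 (by simpa using hn)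
      (by simpa using hρ.le) (by simp) ⟨_, feasible_of_mem hx, by simp⟩
  have hΛ0 : 0 ≤ Λ := (norm_nonneg _).trans (hlμ 0)
  set B := 1 / β * (‖l₀‖ + 2 * Λ) ^ 2 + β * (‖y₀‖ + (2 * R + 2)) ^ 2 with hB
  have hB0 : 0 ≤ B := by positivity
  have hDelta : ∀ t y l, ‖l‖ ≤ ‖l₀‖ + Λ → ‖y‖ ≤ ‖y₀‖ + (R + 2) →
      Delta β y l (xμ (muSeq μinit δ t)) (lμ (muSeq μinit δ t)) ≤ B := by
    intro t y l hl hy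
    unfold Delta
    rw [hB]
    have h1 : ‖l - lμ (muSeq μinit δ t)‖ ≤ ‖l₀‖ + 2 * Λ :=
      (norm_sub_le _ _).trans (by linarith [hlμ t])
    have h2 : ‖y - xμ (muSeq μinit δ t)‖ ≤ ‖y₀‖ + (2 * R + 2) :=
      (norm_sub_le _ _).trans (by linarith [hxμ t])
    gcongr
  obtain ⟨D, hD0, hD⟩ := exists_last_defect_bound (F := F) hP hmono hβ hB0
  refine ⟨B, hB0, ?_⟩
  filter_upwards [Filter.eventually_ge_atTop 2, eventually_div_sqrt_le D hρ,
    eventually_div_sqrt_le D one_pos, eventually_div_sqrt_le D (one_div_pos.2 hβ)]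
    with K hK hK1 hK2 hK3 T x y lam hrun t
  induction t with
  | zero =>
    intro _
    rw [hrun.init_y, hrun.init_lam]
    exact hDelta 0 _ _ (by linarith) (by linarith)
  | succ t ih =>
    intro ht
    have ht' : t < T := by omega
    have hloop := hrun.isInnerLoop hP hβ ht'
    obtain ⟨h1, h2, -, z, hz, h3⟩ := hD _ (muSeq_pos hμ hδ₀ t) _ _ (hc _ (muSeq_pos hμ hδ₀ t)) K hK
      _ _ _ hloop (ih ht')
    rw [hrun.warm_y t ht', hrun.warm_lam t ht']
    have hn := hloop.last_normal hK
    have hyK : ‖y t K‖ ≤ R + 2 := by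
      have h4 : y t K = z + (x t K - z) - (x t K - y t K) := by abel
      rw [h4]
      refine (norm_sub_le _ _).trans ?_
      have := norm_add_le z (x t K - z)
      linarith [hR z hz]
    have hlK : ‖lam t K‖ ≤ Λ := by
      obtain ⟨k, rfl⟩ : ∃ k, K = k + 1 := ⟨K - 1, by omega⟩
      rw [hloop.lam_eq k (by omega)] at hn ⊢
      refine hΛ _ (muSeq_pos hμ hδ₀ t) (muSeq_le hμ hδ₀ hδ₁ t) _ (hloop.x_mem k (by omega)) _
        (hloop.y_mem k (by omega)) _ hn (h1.trans hK1) ?_ ⟨z, hz, h3.trans hK2⟩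
      rw [norm_smul, Real.norm_of_nonneg hβ.le]
      have := h2.trans hK3
      rw [le_div_iff₀ hβ] at this
      linarith
    exact hDelta _ _ _ (by linarith [norm_nonneg l₀]) (by linarith [norm_nonneg y₀])

end Uniform

/-! ### Distance to the solution and gap function -/

section Setting

variable {n m p : ℕ} {P : Constraints n m p} {F : Vec n → Vec n} {L c ξ μinit β δ : ℝ}
  {xstar : Vec n} {xμ lμ : ℝ → Vec n}

/-- The standing assumptions on the problem, its solution, the parameters of the algorithm and the
central path, with star-`ξ`-monotonicity on the constraint set only. -/
structure IsSetting (P : Constraints n m p) (F : Vec n → Vec n) (L c ξ μinit β δ : ℝ)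
    (xstar : Vec n) (xμ lμ : ℝ → Vec n) : Prop where
  regular : P.Regular
  L_pos : 0 < L
  mono : MonotoneOp F P.eqSet
  lip : LipschitzOp F P.eqSet L
  sol : IsVISolution F P.feasible xstar
  star : StarXiMonotoneOp F P.feasible xstar c ξ
  c_pos : 0 < c
  one_lt_ξ : 1 < ξ
  μinit_pos : 0 < μinit
  β_pos : 0 < β
  δ_pos : 0 < δ
  δ_lt_one : δ < 1
  central : ∀ μ > 0, IsCentralPair P F μ (xμ μ) (lμ μ)

theorem norm_le_supNorm (hP : P.Regular) (hLip : LipschitzOp F P.eqSet L) {z : Vec n}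
    (hz : z ∈ P.feasible) : ‖F z‖ ≤ supNorm F P.feasible :=
  le_csSup (hP.compact.bddAbove_image (hLip.continuousOn.mono fun _ hx => hx.2).norm) ⟨z, hz, rfl⟩

theorem norm_sub_le_maxDist (hP : P.Regular) (x : Vec n) {z : Vec n} (hz : z ∈ P.feasible) :
    ‖x - z‖ ≤ maxDist P.feasible x :=
  le_csSup (hP.compact.bddAbove_image (by fun_prop)) ⟨z, hz, rfl⟩

theorem gap_le_of_forall (hP : P.Regular) {x : Vec n} {b : ℝ}
    (h : ∀ z ∈ P.feasible, inner ℝ (F x) (x - z) ≤ b) : gap F P.feasible x ≤ b := by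
  refine csSup_le ⟨_, _, feasible_of_mem hP.interior_nonempty.some_mem, rfl⟩ ?_
  rintro _ ⟨z, hz, rfl⟩
  exact h z hz

theorem le_rpow_of_mul_rpow_le {a s : ℝ} (ha : 0 ≤ a) (hc : 0 < c) (hξ : 1 < ξ)
    (h : c * a ^ ξ ≤ s) : a ≤ (s / c) ^ (1 / ξ) := by
  have h1 : a ^ ξ ≤ s / c := by rw [le_div_iff₀ hc]; linarith
  have h2 := Real.rpow_le_rpow (by positivity) h1 (show 0 ≤ 1 / ξ by positivity)
  rwa [← Real.rpow_mul ha, mul_one_div_cancel (by linarith), Real.rpow_one] at h2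

namespace IsSetting

theorem maxDist_nonneg (hS : IsSetting P F L c ξ μinit β δ xstar xμ lμ) :
    0 ≤ maxDist P.feasible xstar :=
  (norm_nonneg _).trans (norm_sub_le_maxDist hS.regular _ hS.sol.1)

theorem supNorm_nonneg (hS : IsSetting P F L c ξ μinit β δ xstar xμ lμ) :
    0 ≤ supNorm F P.feasible :=
  (norm_nonneg _).trans (norm_le_supNorm hS.regular hS.lip hS.sol.1)

theorem central_mem (hS : IsSetting P F L c ξ μinit β δ xstar xμ lμ) {μ : ℝ} (hμ : 0 < μ) :
    xμ μ ∈ P.feasible :=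
  feasible_of_mem ((isCentralPair_iff hS.regular hμ).1 (hS.central μ hμ)).1

theorem inner_central_le (hS : IsSetting P F L c ξ μinit β δ xstar xμ lμ) {μ : ℝ} (hμ : 0 < μ)
    {z : Vec n} (hz : z ∈ P.feasible) : inner ℝ (F (xμ μ)) (xμ μ - z) ≤ m * μ := by
  obtain ⟨hx, hl, hn⟩ := (isCentralPair_iff hS.regular hμ).1 (hS.central μ hμ)
  have h1 := hn.inner_sub_eq_zero hx.2 hz.2
  have h2 := inner_barrierGrad_le_of_nonpos hS.regular.contDiff hS.regular.convex hμ.le hx.1 hz.1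
  rw [← hl, ← neg_sub, inner_neg_right] at h2
  rw [inner_add_left] at h1
  linarith

/-- Since `xstar` solves the variational inequality, the operator gap at `x` is at most
`⟨F x, x - xstar⟩` on the constraint set. -/
theorem inner_sub_le (hS : IsSetting P F L c ξ μinit β δ xstar xμ lμ) {x : Vec n}
    (hx : x ∈ P.feasible) : inner ℝ (x - xstar) (F x - F xstar) ≤ inner ℝ (F x) (x - xstar) := by
  have h := hS.sol.2 x hx
  rw [real_inner_comm, inner_sub_left]
  linarith

theorem norm_central_sub_le (hS : IsSetting P F L c ξ μinit β δ xstar xμ lμ) {μ : ℝ}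
    (hμ : 0 < μ) : ‖xμ μ - xstar‖ ≤ (m / c * μ) ^ (1 / ξ) := by
  have h1 := (hS.star _ (hS.central_mem hμ)).trans
    ((hS.inner_sub_le (hS.central_mem hμ)).trans (hS.inner_central_le hμ hS.sol.1))
  have h2 := le_rpow_of_mul_rpow_le (norm_nonneg _) hS.c_pos hS.one_lt_ξ h1
  rwa [mul_div_right_comm] at h2

theorem norm_sub_le_mul (hS : IsSetting P F L c ξ μinit β δ xstar xμ lμ) {x : Vec n}
    (hx : x ∈ P.eqSet) : ‖F x - F xstar‖ ≤ L * ‖x - xstar‖ := hS.lip x hx _ hS.sol.1.2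

/-- The gap function at a point near the constraint set, in terms of the distance to the
solution. -/
theorem inner_le_mul_norm_sub (hS : IsSetting P F L c ξ μinit β δ xstar xμ lμ) {x z₁ z : Vec n}
    {ρ : ℝ} (hx : x ∈ P.eqSet) (hz₁ : z₁ ∈ P.feasible) (hρ : ‖x - z₁‖ ≤ ρ) (hz : z ∈ P.feasible) :
    inner ℝ (F x) (x - z)
      ≤ (maxDist P.feasible xstar * L + supNorm F P.feasible + L * ρ) * ‖x - xstar‖ := by
  have hFx : ‖F x‖ ≤ supNorm F P.feasible + L * ρ := by
    have h1 := hS.lip x hx z₁ hz₁.2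
    have h2 := norm_add_le (F x - F z₁) (F z₁)
    rw [sub_add_cancel] at h2
    have h3 := norm_le_supNorm hS.regular hS.lip hz₁
    have h4 := mul_le_mul_of_nonneg_left hρ hS.L_pos.le
    linarith
  have e : inner ℝ (F x) (x - z) = inner ℝ (F x) (x - xstar)
      + inner ℝ (F x - F xstar) (xstar - z) - inner ℝ (F xstar) (z - xstar) := by
    simp only [inner_sub_left, inner_sub_right]; ring
  have h1 := (real_inner_le_norm (F x) (x - xstar)).trans
    (mul_le_mul_of_nonneg_right hFx (norm_nonneg _))
  have h2 := (real_inner_le_norm (F x - F xstar) (xstar - z)).trans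
    (mul_le_mul (hS.norm_sub_le_mul hx) (norm_sub_le_maxDist hS.regular xstar hz) (norm_nonneg _)
      (mul_nonneg hS.L_pos.le (norm_nonneg _)))
  have h3 := hS.sol.2 z hz
  rw [e]
  linarith

theorem gap_le (hS : IsSetting P F L c ξ μinit β δ xstar xμ lμ) {x z₁ : Vec n} {ρ : ℝ}
    (hx : x ∈ P.eqSet) (hz₁ : z₁ ∈ P.feasible) (hρ : ‖x - z₁‖ ≤ ρ) :
    gap F P.feasible x
      ≤ (maxDist P.feasible xstar * L + supNorm F P.feasible + L * ρ) * ‖x - xstar‖ :=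
  gap_le_of_forall hS.regular fun _ hz => hS.inner_le_mul_norm_sub hx hz₁ hρ hz

/-- Star-monotonicity on the constraint set controls the distance of nearby points to the
solution. -/
theorem mul_norm_rpow_le_of_near (hS : IsSetting P F L c ξ μinit β δ xstar xμ lμ) {x z : Vec n}
    {ρ : ℝ} (hx : x ∈ P.eqSet) (hz : z ∈ P.feasible) (hρ : ‖x - z‖ ≤ ρ) (hρ1 : ρ ≤ 1) :
    c * ‖z - xstar‖ ^ ξ ≤ inner ℝ (x - xstar) (F x - F xstar)
      + L * (2 * maxDist P.feasible xstar + 1) * ρ := by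
  have h0 := hS.star z hz
  have e : inner ℝ (z - xstar) (F z - F xstar) = inner ℝ (x - xstar) (F x - F xstar)
      + inner ℝ (z - xstar) (F z - F x) + inner ℝ (z - x) (F x - F xstar) := by
    simp only [inner_sub_left, inner_sub_right]; ring
  have hD := norm_sub_le_maxDist hS.regular xstar hz
  rw [norm_sub_rev] at hD
  have hD0 := hS.maxDist_nonneg
  have hρ0 : 0 ≤ ρ := (norm_nonneg _).trans hρ
  have hL := hS.L_pos
  have h1 : inner ℝ (z - xstar) (F z - F x) ≤ maxDist P.feasible xstar * (L * ρ) := by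
    refine (real_inner_le_norm _ _).trans (mul_le_mul hD ?_ (norm_nonneg _) hD0)
    refine (hS.lip z hz.2 x hx).trans (mul_le_mul_of_nonneg_left ?_ hL.le)
    rwa [norm_sub_rev]
  have h2 : inner ℝ (z - x) (F x - F xstar) ≤ ρ * (L * (maxDist P.feasible xstar + 1)) := by
    refine (real_inner_le_norm _ _).trans (mul_le_mul ?_ ?_ (norm_nonneg _) hρ0)
    · rwa [norm_sub_rev]
    · refine (hS.norm_sub_le_mul hx).trans (mul_le_mul_of_nonneg_left ?_ hL.le)
      have := norm_add_le (x - z) (z - xstar)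
      rw [sub_add_sub_cancel] at this
      linarith
  rw [e] at h0
  linarith

theorem inner_sub_le_of_central (hS : IsSetting P F L c ξ μinit β δ xstar xμ lμ) {x : Vec n}
    (hx : x ∈ P.eqSet) {μ r : ℝ} (hμ : 0 < μ) (hr : ‖x - xμ μ‖ ≤ r) :
    inner ℝ (x - xstar) (F x - F xstar) ≤ inner ℝ (x - xμ μ) (F x - F (xμ μ))
      + L * (m / c * μ) ^ (1 / ξ) * (2 * r + (m / c * μ) ^ (1 / ξ)) := by
  have he := hS.norm_central_sub_le hμ
  set e := (m / c * μ) ^ (1 / ξ)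
  set w := xμ μ
  have hw : w ∈ P.eqSet := (hS.central_mem hμ).2
  have hL := hS.L_pos
  have he0 : 0 ≤ e := (norm_nonneg _).trans he
  have hr0 : 0 ≤ r := (norm_nonneg _).trans hr
  have e1 : inner ℝ (x - xstar) (F x - F xstar) = inner ℝ (x - w) (F x - F w)
      + inner ℝ (x - w) (F w - F xstar) + inner ℝ (w - xstar) (F x - F w)
      + inner ℝ (w - xstar) (F w - F xstar) := by
    simp only [inner_sub_left, inner_sub_right]; ring
  have h0 : ‖F w - F xstar‖ ≤ L * e :=
    (hS.norm_sub_le_mul hw).trans (mul_le_mul_of_nonneg_left he hL.le)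
  have h1 : inner ℝ (x - w) (F w - F xstar) ≤ r * (L * e) :=
    (real_inner_le_norm _ _).trans (mul_le_mul hr h0 (norm_nonneg _) hr0)
  have h2 : inner ℝ (w - xstar) (F x - F w) ≤ e * (L * r) :=
    (real_inner_le_norm _ _).trans (mul_le_mul he ((hS.lip x hx w hw).trans
      (mul_le_mul_of_nonneg_left hr hL.le)) (norm_nonneg _) he0)
  have h3 : inner ℝ (w - xstar) (F w - F xstar) ≤ e * (L * e) :=
    (real_inner_le_norm _ _).trans (mul_le_mul he h0 (norm_nonneg _) he0)
  rw [e1]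
  linarith

/-- The operator gap of the last inner iterate, relative to the solution. -/
theorem inner_last_sub_le (hS : IsSetting P F L c ξ μinit β δ xstar xμ lμ) {μ : ℝ} (hμ : 0 < μ)
    {K : ℕ} (hK : 2 ≤ K) {x y lam : ℕ → Vec n} (h : IsInnerLoop P F μ β K x y lam) :
    inner ℝ (x K - xstar) (F (x K) - F xstar)
      ≤ 2 * Delta β (y 0) (lam 0) (xμ μ) (lμ μ) / √K + L * (m / c * μ) ^ (1 / ξ) *
        (2 * √(Delta β (y 0) (lam 0) (xμ μ) (lμ μ) / β) + (m / c * μ) ^ (1 / ξ)) := by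
  have h1 := h.inner_last_le hS.mono hS.regular hμ hS.β_pos (hS.central μ hμ) hK
  have h2 := Real.le_sqrt_of_sq_le
    (h.norm_last_sub_central_sq_le hS.mono hS.regular hμ hS.β_pos (hS.central μ hμ) hK)
  have hx : x K ∈ P.eqSet := by
    obtain ⟨k, rfl⟩ : ∃ k, K = k + 1 := ⟨K - 1, by omega⟩
    exact h.x_mem k (by omega)
  linarith [hS.inner_sub_le_of_central hx hμ h2]

/-- Either there are inequality constraints and the operator does not vanish on the constraint set,
or the affine subspace is a single point. -/
theorem nondegenerate_or (hS : IsSetting P F L c ξ μinit β δ xstar xμ lμ) :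
    (0 < m ∧ 0 < supNorm F P.feasible) ∨ ∀ x ∈ P.eqSet, x = xstar := by
  by_contra! hcon
  obtain ⟨h, x, hx, hne⟩ := hcon
  have hnorm : 0 < ‖x - xstar‖ := norm_pos_iff.2 (sub_ne_zero.2 hne)
  have hdir := map_sub_eq_zero hx hS.sol.1.2
  rcases Nat.eq_zero_or_pos m with rfl | hm
  · obtain ⟨R, hR⟩ := hS.regular.compact.isBounded.exists_norm_le
    have hR0 : 0 ≤ R := (norm_nonneg _).trans (hR _ hS.sol.1)
    have h1 := hR (xstar + ((2 * R + 1) / ‖x - xstar‖) • (x - xstar))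
      ⟨fun i => i.elim0, add_smul_mem_eqSet hS.sol.1.2 hdir _⟩
    have h2 := norm_sub_le (xstar + ((2 * R + 1) / ‖x - xstar‖) • (x - xstar)) xstar
    rw [add_sub_cancel_left, norm_smul, Real.norm_of_nonneg (by positivity),
      div_mul_cancel₀ _ hnorm.ne'] at h2
    linarith [hR _ hS.sol.1]
  · have hM : supNorm F P.feasible = 0 := le_antisymm (h hm) hS.supNorm_nonneg
    have hF0 : ∀ z ∈ P.feasible, F z = 0 := fun z hz => by
      have := norm_le_supNorm hS.regular hS.lip hz
      rw [hM] at this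
      exact norm_le_zero_iff.1 this
    have huniq : ∀ z ∈ P.feasible, z = xstar := fun z hz => by
      have h1 := hS.star z hz
      rw [hF0 z hz, hF0 _ hS.sol.1, sub_zero, inner_zero_right] at h1
      by_contra hzne
      have h2 : 0 < ‖z - xstar‖ := norm_pos_iff.2 (sub_ne_zero.2 hzne)
      have h3 := mul_pos hS.c_pos (Real.rpow_pos_of_pos h2 ξ)
      linarith
    -- The Slater point is `xstar`, so the constraint set contains a segment towards `x`.
    obtain ⟨z₀, hz₀⟩ := hS.regular.interior_nonempty
    have hlt : xstar ∈ P.ltSet := huniq z₀ (feasible_of_mem hz₀) ▸ hz₀.1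
    have hcont : Continuous fun t : ℝ => xstar + t • (x - xstar) := by fun_prop
    have hev : ∀ᶠ t in nhds (0 : ℝ), xstar + t • (x - xstar) ∈ P.ltSet :=
      hcont.continuousAt.eventually
        ((isOpen_ltSet hS.regular.contDiff).mem_nhds (by simpa using hlt))
    obtain ⟨t, ht, ht0⟩ := ((hev.filter_mono nhdsWithin_le_nhds).and
      (self_mem_nhdsWithin : Set.Ioi (0 : ℝ) ∈ nhdsWithin 0 (Set.Ioi 0))).exists
    have h4 := huniq _ (feasible_of_mem ⟨ht, add_smul_mem_eqSet hS.sol.1.2 hdir t⟩)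
    rw [add_eq_left, smul_eq_zero] at h4
    rcases h4 with h4 | h4
    · exact (ne_of_gt ht0) h4
    · exact hne (sub_eq_zero.1 h4)

/-- On the central path the gap function is smaller than its generic bound by a fixed factor. Where
the bound on the distance to the solution is nearly attained, the gap is at most
`m μ ≈ c ‖x - xstar‖ ^ ξ ≤ L D ‖x - xstar‖`, so that the term `M ‖x - xstar‖` is superfluous. -/
theorem exists_central_gap_slack (hS : IsSetting P F L c ξ μinit β δ xstar xμ lμ)
    (hM : 0 < supNorm F P.feasible) : ∃ γ > 0, ∀ μ > 0, ∀ z ∈ P.feasible,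
      inner ℝ (F (xμ μ)) (xμ μ - z) ≤
        (maxDist P.feasible xstar * L + supNorm F P.feasible - γ) * (m / c * μ) ^ (1 / ξ) := by
  set M := supNorm F P.feasible
  set D := maxDist P.feasible xstar with hD
  have hD0 : 0 ≤ D := hS.maxDist_nonneg
  have hL := hS.L_pos
  have hc := hS.c_pos
  have hξ : 0 < ξ := by linarith [hS.one_lt_ξ]
  have hDL : 0 ≤ D * L := by positivity
  set q := (D * L + M / 4) / (D * L + M / 2) with hq
  have hq0 : 0 < q := by positivity
  have hq1 : q < 1 := by rw [hq, div_lt_one (by positivity)]; linarith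
  set a := q ^ (1 / ξ) with ha
  have ha0 : 0 < a := Real.rpow_pos_of_pos hq0 _
  have ha1 : a < 1 := Real.rpow_lt_one hq0.le hq1 (by positivity)
  have haξ : a ^ ξ = q := by
    rw [ha, ← Real.rpow_mul hq0.le, one_div_mul_cancel hξ.ne', Real.rpow_one]
  refine ⟨min (M / 2) ((D * L + M) * (1 - a)),
    lt_min (by positivity) (mul_pos (by positivity) (by linarith)), fun μ hμ z hz => ?_⟩
  have he := hS.norm_central_sub_le hμ
  have hbase : 0 ≤ (m : ℝ) / c * μ := by positivity
  set e := ((m : ℝ) / c * μ) ^ (1 / ξ) with he_def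
  have he0 : 0 ≤ e := Real.rpow_nonneg hbase _
  have heξ : c * e ^ ξ = m * μ := by
    rw [he_def, ← Real.rpow_mul hbase, one_div_mul_cancel hξ.ne', Real.rpow_one]
    field_simp
  have hxf := hS.central_mem hμ
  by_cases hcase : ‖xμ μ - xstar‖ ≤ a * e
  · have h1 := hS.inner_le_mul_norm_sub hxf.2 hxf (ρ := 0) (by simp) hz
    rw [mul_zero, add_zero] at h1
    have h2 := mul_le_mul_of_nonneg_left hcase (show 0 ≤ D * L + M by positivity)
    have h3 := mul_le_mul_of_nonneg_right (min_le_right (M / 2) ((D * L + M) * (1 - a))) he0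
    rw [sub_mul]
    linarith
  · have hlt := not_le.1 hcase
    have h1 := hS.star _ hxf
    have h2 := (real_inner_le_norm (xμ μ - xstar) (F (xμ μ) - F xstar)).trans
      (mul_le_mul_of_nonneg_left (hS.norm_sub_le_mul hxf.2) (norm_nonneg _))
    have h3 := Real.rpow_le_rpow (by positivity) hlt.le hξ.le
    rw [Real.mul_rpow ha0.le he0, haξ] at h3
    have h4 : ‖xμ μ - xstar‖ ≤ D := by
      rw [norm_sub_rev]; exact norm_sub_le_maxDist hS.regular xstar hxf
    have h5 : ‖xμ μ - xstar‖ * (L * ‖xμ μ - xstar‖) ≤ D * (L * e) :=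
      mul_le_mul h4 (mul_le_mul_of_nonneg_left he hL.le) (by positivity) hD0
    have h6 : q * (m * μ) ≤ D * L * e := by
      rw [← heξ]
      have := mul_le_mul_of_nonneg_left h3 hc.le
      linarith
    have h7 : D * L * e ≤ q * ((D * L + M / 2) * e) := by
      have : q * ((D * L + M / 2) * e) = (D * L + M / 4) * e := by rw [hq]; field_simp
      rw [this]
      exact mul_le_mul_of_nonneg_right (by linarith) he0
    have h8 : (m : ℝ) * μ ≤ (D * L + M / 2) * e := le_of_mul_le_mul_left (h6.trans h7) hq0
    have h9 := hS.inner_central_le hμ hz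
    have h10 := mul_le_mul_of_nonneg_right (min_le_left (M / 2) ((D * L + M) * (1 - a))) he0
    rw [sub_mul]
    linarith

end IsSetting

end Setting

/-! ### The explicit bounds -/

section Bounds

variable {n m p : ℕ} {P : Constraints n m p} {F : Vec n → Vec n} {L c ξ μinit β δ : ℝ}
  {xstar : Vec n} {xμ lμ : ℝ → Vec n}

theorem rpow_muSeq (hc : 0 < c) (hμ : 0 < μinit) (hδ : 0 < δ) (ξ : ℝ) (t : ℕ) :
    (m / c * muSeq μinit δ t) ^ (1 / ξ) = (m / c * μinit) ^ (1 / ξ) * δ ^ (((t : ℝ) + 1) / ξ) := by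
  have e : (m : ℝ) / c * muSeq μinit δ t = m / c * μinit * δ ^ (t + 1) := by unfold muSeq; ring
  rw [e, Real.mul_rpow (by positivity) (by positivity), ← Real.rpow_natCast,
    ← Real.rpow_mul hδ.le]
  congr 2
  push_cast
  ring

theorem rpow_muSeq_le (hc : 0 < c) (hξ : 0 < ξ) (hμ : 0 < μinit) (hδ₀ : 0 < δ) (hδ₁ : δ < 1)
    (t : ℕ) :
    (m / c * muSeq μinit δ t) ^ (1 / ξ) ≤ δ ^ (1 / ξ) * (m / c * μinit) ^ (1 / ξ) := by
  rw [rpow_muSeq hc hμ hδ₀, mul_comm]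
  refine mul_le_mul_of_nonneg_right ?_ (by positivity)
  refine Real.rpow_le_rpow_of_exponent_ge hδ₀ hδ₁.le ?_
  gcongr
  linarith [(Nat.cast_nonneg t : (0 : ℝ) ≤ t)]

theorem lastBound_nonneg {M Δ ln : ℝ} (hc : 0 < c) (hL : 0 < L) (hδ : 0 < δ)
    (hμ : 0 < μinit) (hM : 0 ≤ M) (hΔ : 0 ≤ Δ) (hln : 0 ≤ ln) (t K : ℕ) :
    0 ≤ lastBound m c ξ L M β δ μinit Δ ln t K := by
  unfold lastBound; positivity

theorem avgBound_nonneg {μ Δ : ℝ} (hc : 0 < c) (hμ : 0 < μ) (hΔ : 0 ≤ Δ) (K : ℕ) :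
    0 ≤ avgBound m c ξ μ Δ K := by
  unfold avgBound; positivity

/-- The part of the last-iterate bound that the convergence analysis uses. -/
theorem le_lastBound {M Δ ln : ℝ} (hc : 0 < c) (hL : 0 < L) (hξ : 0 < ξ) (hδ : 0 < δ)
    (hμ : 0 < μinit) (hM : 0 ≤ M) (hΔ : 0 ≤ Δ) (hln : 0 ≤ ln) (t K : ℕ) :
    ((4 * (Δ / √K) + L * (m / c * muSeq μinit δ t) ^ (1 / ξ) *
        ((m / c * μinit) ^ (1 / ξ) + 2 * √(Δ / β))) / c) ^ (1 / ξ)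
      ≤ lastBound m c ξ L M β δ μinit Δ ln t K := by
  have hμt := muSeq_pos hμ hδ t
  unfold lastBound
  refine Real.rpow_le_rpow (by positivity) ?_ (by positivity)
  rw [rpow_muSeq hc hμ hδ]
  set e₀ := ((m : ℝ) / c * μinit) ^ (1 / ξ)
  have he₀ : 0 ≤ e₀ := by positivity
  set d := δ ^ (((t : ℝ) + 1) / ξ)
  have hd : 0 ≤ d := by positivity
  have e1 : 2 / c * (Δ / K + 2 * Δ / √K + ln * √(Δ / (β * K)))
      + L * (e₀ + 2 * √(Δ / β) + M / L) / c * e₀ * d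
      = (4 * (Δ / √K) + L * (e₀ * d) * (e₀ + 2 * √(Δ / β))) / c
        + (2 / c * (Δ / K + ln * √(Δ / (β * K))) + L * (M / L) / c * e₀ * d) := by ring
  rw [e1]
  have : 0 ≤ 2 / c * (Δ / K + ln * √(Δ / (β * K))) + L * (M / L) / c * e₀ * d := by positivity
  linarith

/-- The available bound exceeds the one that is needed by a fixed factor, because `μ_t ≤ δ μ_{-1}`
with `δ < 1`. -/
theorem exists_contraction_factor {e₀ d s₀ : ℝ} (hL : 0 < L) (he₀ : 0 < e₀) (hd : d < 1)
    (hs₀ : 0 ≤ s₀) : ∃ κ : ℝ, 0 < κ ∧ κ < 1 ∧ ∀ a ≥ 0, ∀ s ≥ 0, s ≤ s₀ → ∀ e ≥ 0,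
      e ≤ d * e₀ → 2 * a + L * e * (2 * s + e) ≤ κ * (4 * a + L * e * (e₀ + 2 * s)) := by
  set q := (2 * s₀ + d * e₀) / (2 * s₀ + e₀) with hq
  have hden : 0 < 2 * s₀ + e₀ := by linarith
  have hq1 : q < 1 := by rw [hq, div_lt_one hden]; nlinarith
  refine ⟨max (1 / 2) q, by positivity, max_lt (by norm_num) hq1, ?_⟩
  intro a ha s hs hss e he hee
  set κ := max (1 / 2) q
  have hκ1 : 1 / 2 ≤ κ := le_max_left _ _
  have h1 : 2 * s + e ≤ q * (e₀ + 2 * s) := by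
    have h2 : q * (2 * s₀ + e₀) = 2 * s₀ + d * e₀ := by rw [hq]; field_simp
    nlinarith
  have h3 : 2 * s + e ≤ κ * (e₀ + 2 * s) :=
    h1.trans (mul_le_mul_of_nonneg_right (le_max_right _ _) (by linarith))
  have h4 := mul_le_mul_of_nonneg_left h3 (mul_nonneg hL.le he)
  nlinarith

namespace IsSetting

/-- The bounds that hold uniformly along all runs with sufficiently many inner iterations. -/
theorem exists_run_bounds (hS : IsSetting P F L c ξ μinit β δ xstar xμ lμ) (y₀ l₀ : Vec n) :
    ∃ B ≥ 0, ∃ D ≥ 0, ∀ᶠ K : ℕ in Filter.atTop, 2 ≤ K ∧ ∀ T, ∀ x y lam,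
      IsACVIRun P F μinit β δ y₀ l₀ T K x y lam → ∀ t < T,
        Delta β (y t 0) (lam t 0) (xμ (muSeq μinit δ t)) (lμ (muSeq μinit δ t)) ≤ B ∧
        x t K ∈ P.eqSet ∧ (∀ i, P.φ i (x t K) ≤ D / √K) ∧
        ∃ z ∈ P.feasible, ‖x t K - z‖ ≤ D / √K := by
  obtain ⟨B, hB, hev⟩ := exists_Delta_bound hS.regular hS.L_pos hS.mono hS.lip hS.μinit_pos
    hS.β_pos hS.δ_pos hS.δ_lt_one y₀ l₀ hS.central
  obtain ⟨D, hD, hdef⟩ := exists_last_defect_bound (F := F) hS.regular hS.mono hS.β_pos hB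
  refine ⟨B, hB, D, hD, ?_⟩
  filter_upwards [hev, Filter.eventually_ge_atTop 2] with K hK hK2
  refine ⟨hK2, fun T x y lam hrun t ht => ?_⟩
  have hloop := hrun.isInnerLoop hS.regular hS.β_pos ht
  have hμt := muSeq_pos hS.μinit_pos hS.δ_pos t
  obtain ⟨-, -, h3, h4⟩ := hdef _ hμt _ _ (hS.central _ hμt) K hK2 _ _ _ hloop
    (hK T x y lam hrun t ht)
  refine ⟨hK T x y lam hrun t ht, ?_, h3, h4⟩
  obtain ⟨k, rfl⟩ : ∃ k, K = k + 1 := ⟨K - 1, by omega⟩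
  exact hloop.x_mem k (by omega)

theorem rpow_base_pos (hS : IsSetting P F L c ξ μinit β δ xstar xμ lμ) (hm : 0 < m) {μ : ℝ}
    (hμ : 0 < μ) : 0 < ((m : ℝ) / c * μ) ^ (1 / ξ) := by
  have := hS.c_pos
  have : (0 : ℝ) < m := by exact_mod_cast hm
  positivity

/-- The last iterate when star-monotonicity extends to a neighbourhood of the constraint set in the
affine subspace: it applies to the last iterate itself, uniformly in the outer iteration. -/
theorem exists_last_le_of_hatSet (hS : IsSetting P F L c ξ μinit β δ xstar xμ lμ) (hm : 0 < m)
    (y₀ l₀ : Vec n) {r : ℝ} (hr : 0 < r) (hstar : StarXiMonotoneOp F (P.hatSet r) xstar c ξ) :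
    ∃ θ ≥ 0, θ < 1 ∧ ∀ᶠ K : ℕ in Filter.atTop, ∀ T, ∀ x y lam,
      IsACVIRun P F μinit β δ y₀ l₀ T K x y lam → ∀ t < T, ‖x t K - xstar‖ ≤
        θ * lastBound m c ξ L (supNorm F P.feasible) β δ μinit
          (Delta β (y t 0) (lam t 0) (xμ (muSeq μinit δ t)) (lμ (muSeq μinit δ t)))
          ‖lμ (muSeq μinit δ t)‖ t K := by
  obtain ⟨B, hB, D, hD, hev⟩ := hS.exists_run_bounds y₀ l₀
  have hL := hS.L_pos
  have hβ := hS.β_pos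
  have hc := hS.c_pos
  have hδ := hS.δ_pos
  have hξ : 0 < ξ := by linarith [hS.one_lt_ξ]
  have he₀ := hS.rpow_base_pos hm hS.μinit_pos
  obtain ⟨κ, hκ0, hκ1, hκ⟩ := exists_contraction_factor hL he₀ (d := δ ^ (1 / ξ))
    (s₀ := √(B / β)) (Real.rpow_lt_one hδ.le hS.δ_lt_one (by positivity))
    (Real.sqrt_nonneg _)
  refine ⟨κ ^ (1 / ξ), by positivity, Real.rpow_lt_one hκ0.le hκ1 (by positivity), ?_⟩
  filter_upwards [hev, eventually_div_sqrt_le D hr] with K hK hKr T x y lam hrun t ht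
  obtain ⟨hK2, hK⟩ := hK
  obtain ⟨h1, h2, h3, -⟩ := hK T x y lam hrun t ht
  have hμt := muSeq_pos hS.μinit_pos hδ t
  have h4 := hstar (x t K) ⟨h2, fun i => (h3 i).trans hKr⟩
  have h5 := hS.inner_last_sub_le hμt hK2 (hrun.isInnerLoop hS.regular hβ ht)
  have hΔ := Delta_nonneg hβ (y t 0) (lam t 0) (xμ (muSeq μinit δ t)) (lμ (muSeq μinit δ t))
  set Δ := Delta β (y t 0) (lam t 0) (xμ (muSeq μinit δ t)) (lμ (muSeq μinit δ t))
  have he := (hS.rpow_base_pos hm hμt).le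
  have h6 := hκ (Δ / √K) (by positivity) (√(Δ / β)) (Real.sqrt_nonneg _)
    (Real.sqrt_le_sqrt (div_le_div_of_nonneg_right h1 hβ.le)) _ he
    (rpow_muSeq_le hc hξ hS.μinit_pos hδ hS.δ_lt_one t)
  rw [mul_div_assoc] at h5
  have h7 := le_rpow_of_mul_rpow_le (norm_nonneg _) hc hS.one_lt_ξ (h4.trans (h5.trans h6))
  rw [mul_div_assoc, Real.mul_rpow hκ0.le (by positivity)] at h7
  exact h7.trans (mul_le_mul_of_nonneg_left (le_lastBound hc hL hξ hδ hS.μinit_pos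
    hS.supNorm_nonneg hΔ (norm_nonneg _) t K) (by positivity))

/-- The last iterate at a fixed outer iteration `t`, by star-monotonicity on the constraint set
alone: the cost of projecting the last iterate vanishes as `K` grows, while the bound stays above a
positive constant that depends on `t`. -/
theorem exists_last_le (hS : IsSetting P F L c ξ μinit β δ xstar xμ lμ) (hm : 0 < m)
    (y₀ l₀ : Vec n) (t : ℕ) :
    ∃ θ ≥ 0, θ < 1 ∧ ∀ᶠ K : ℕ in Filter.atTop, ∀ T, ∀ x y lam,
      IsACVIRun P F μinit β δ y₀ l₀ T K x y lam → t < T → ‖x t K - xstar‖ ≤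
        θ * lastBound m c ξ L (supNorm F P.feasible) β δ μinit
          (Delta β (y t 0) (lam t 0) (xμ (muSeq μinit δ t)) (lμ (muSeq μinit δ t)))
          ‖lμ (muSeq μinit δ t)‖ t K := by
  obtain ⟨B, hB, D, hD, hev⟩ := hS.exists_run_bounds y₀ l₀
  have hL := hS.L_pos
  have hβ := hS.β_pos
  have hc := hS.c_pos
  have hδ := hS.δ_pos
  have hξ : 0 < ξ := by linarith [hS.one_lt_ξ]
  have he₀ := hS.rpow_base_pos hm hS.μinit_pos
  have hμt := muSeq_pos hS.μinit_pos hδ t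
  have he := hS.rpow_base_pos hm hμt
  have hle := rpow_muSeq_le (m := m) hc hξ hS.μinit_pos hδ hS.δ_lt_one t
  obtain ⟨κ, hκ0, hκ1, hκ⟩ := exists_contraction_factor hL he₀ (d := δ ^ (1 / ξ))
    (s₀ := √(B / β)) (Real.rpow_lt_one hδ.le hS.δ_lt_one (by positivity))
    (Real.sqrt_nonneg _)
  set e := ((m : ℝ) / c * muSeq μinit δ t) ^ (1 / ξ)
  set e₀ := ((m : ℝ) / c * μinit) ^ (1 / ξ)
  set κ' := (1 + κ) / 2 with hκ'
  have hκ'0 : 0 < κ' := by linarith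
  have hκ'1 : κ' < 1 := by linarith
  have hθ1 : κ' ^ (1 / ξ) < 1 := Real.rpow_lt_one hκ'0.le hκ'1 (by positivity)
  have hθ0 : 0 ≤ κ' ^ (1 / ξ) := by positivity
  set θ := κ' ^ (1 / ξ)
  set E := L * (2 * maxDist P.feasible xstar + 1) * D
  -- `L e e₀` is the part of the bound that does not depend on `K`.
  have hlow : 0 < L * e * e₀ := by positivity
  have hlow' : 0 < (L * e * e₀ / c) ^ (1 / ξ) := by positivity
  refine ⟨(1 + θ) / 2, by positivity, by linarith, ?_⟩
  filter_upwards [hev, eventually_div_sqrt_le D one_pos,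
    eventually_div_sqrt_le E (show 0 < (κ' - κ) * (L * e * e₀) from
      mul_pos (by linarith) hlow),
    eventually_div_sqrt_le D (show 0 < (1 - θ) / 2 * (L * e * e₀ / c) ^ (1 / ξ) from
      mul_pos (by linarith) hlow')] with K hK hK1 hKE hKD T x y lam hrun ht
  obtain ⟨hK2, hK⟩ := hK
  obtain ⟨h1, h2, -, z, hz, h3⟩ := hK T x y lam hrun t ht
  have h4 := hS.mul_norm_rpow_le_of_near h2 hz h3 hK1
  have h5 := hS.inner_last_sub_le hμt hK2 (hrun.isInnerLoop hS.regular hβ ht)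
  have hΔ := Delta_nonneg hβ (y t 0) (lam t 0) (xμ (muSeq μinit δ t)) (lμ (muSeq μinit δ t))
  set Δ := Delta β (y t 0) (lam t 0) (xμ (muSeq μinit δ t)) (lμ (muSeq μinit δ t))
  have h6 := hκ (Δ / √K) (by positivity) (√(Δ / β)) (Real.sqrt_nonneg _)
    (Real.sqrt_le_sqrt (div_le_div_of_nonneg_right h1 hβ.le)) e he.le hle
  rw [mul_div_assoc] at h5
  set S := 4 * (Δ / √K) + L * e * (e₀ + 2 * √(Δ / β)) with hSdef
  have hSlow : L * e * e₀ ≤ S := by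
    have e1 : S = L * e * e₀ + (4 * (Δ / √K) + L * e * (2 * √(Δ / β))) := by rw [hSdef]; ring
    have : 0 ≤ 4 * (Δ / √K) + L * e * (2 * √(Δ / β)) := by positivity
    linarith
  have hS0 : 0 ≤ S := hlow.le.trans hSlow
  have h7 : c * ‖z - xstar‖ ^ ξ ≤ κ' * S := by
    have e2 : L * (2 * maxDist P.feasible xstar + 1) * (D / √K) = E / √K := by
      simp only [E]; ring
    rw [e2] at h4
    have h8 := mul_le_mul_of_nonneg_left hSlow (show 0 ≤ κ' - κ by linarith)
    linarith
  have h8 := le_rpow_of_mul_rpow_le (norm_nonneg _) hc hS.one_lt_ξ h7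
  rw [mul_div_assoc, Real.mul_rpow hκ'0.le (by positivity)] at h8
  have h9 : (L * e * e₀ / c) ^ (1 / ξ) ≤ (S / c) ^ (1 / ξ) :=
    Real.rpow_le_rpow (by positivity) (div_le_div_of_nonneg_right hSlow hc.le) (by positivity)
  have h10 : (S / c) ^ (1 / ξ) ≤ _ := le_lastBound (ξ := ξ) hc hL hξ hδ hS.μinit_pos
    hS.supNorm_nonneg hΔ (norm_nonneg (lμ (muSeq μinit δ t))) t K
  have h11 := norm_add_le (x t K - z) (z - xstar)
  rw [sub_add_sub_cancel] at h11
  have h12 := mul_le_mul_of_nonneg_left h9 (show 0 ≤ (1 - θ) / 2 by linarith)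
  have h13 := mul_le_mul_of_nonneg_left h10 (show 0 ≤ (1 + θ) / 2 by linarith)
  linarith

theorem le_and_gap_le_of_le_mul (hS : IsSetting P F L c ξ μinit β δ xstar xμ lμ)
    {x z : Vec n} {ρ θ b : ℝ} (hx : x ∈ P.eqSet) (hz : z ∈ P.feasible) (hxz : ‖x - z‖ ≤ ρ)
    (hθ1 : θ < 1) (hb : 0 ≤ b) (hle : ‖x - xstar‖ ≤ θ * b)
    (hρ : L * ρ ≤ (maxDist P.feasible xstar * L + supNorm F P.feasible) * (1 - θ)) :
    ‖x - xstar‖ ≤ b ∧ gap F P.feasible x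
      ≤ (maxDist P.feasible xstar * L + supNorm F P.feasible) * b := by
  refine ⟨hle.trans (mul_le_of_le_one_left hb hθ1.le), ?_⟩
  have hM₀ : 0 ≤ maxDist P.feasible xstar * L + supNorm F P.feasible :=
    add_nonneg (mul_nonneg hS.maxDist_nonneg hS.L_pos.le) hS.supNorm_nonneg
  refine (hS.gap_le hx hz hxz).trans ?_
  set M₀ := maxDist P.feasible xstar * L + supNorm F P.feasible
  have hρ0 : 0 ≤ L * ρ := mul_nonneg hS.L_pos.le ((norm_nonneg _).trans hxz)
  -- `(2 - θ) θ ≤ 1` leaves room for the infeasibility `ρ`.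
  calc (M₀ + L * ρ) * ‖x - xstar‖ ≤ (M₀ + L * ρ) * (θ * b) :=
        mul_le_mul_of_nonneg_left hle (by positivity)
    _ ≤ M₀ * b := by
        rcases le_or_gt 0 θ with hθ | hθ
        · nlinarith [mul_le_mul_of_nonneg_right hρ (mul_nonneg hθ hb),
            mul_nonneg hM₀ (mul_nonneg hb (sq_nonneg (1 - θ)))]
        · have h1 : θ * b ≤ 0 := mul_nonpos_of_nonpos_of_nonneg hθ.le hb
          have h2 := mul_nonpos_of_nonneg_of_nonpos (add_nonneg hM₀ hρ0) h1
          have h3 := mul_nonneg hM₀ hb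
          linarith

/-- The average iterate is within `(Δ / (2 c K)) ^ (1 / ξ)` of the central path. -/
theorem norm_average_sub_le (hS : IsSetting P F L c ξ μinit β δ xstar xμ lμ) {μ : ℝ} (hμ : 0 < μ)
    {K : ℕ} (hK : 1 ≤ K) {x y lam : ℕ → Vec n} (h : IsInnerLoop P F μ β K x y lam)
    (hxi : XiMonotoneOp F P.eqSet c ξ) :
    ‖average x K - xμ μ‖ ≤ (1 / 2 : ℝ) ^ (1 / ξ) *
      (Delta β (y 0) (lam 0) (xμ μ) (lμ μ) / (c * K)) ^ (1 / ξ) := by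
  have hΔ := Delta_nonneg hS.β_pos (y 0) (lam 0) (xμ μ) (lμ μ)
  have hc := hS.c_pos
  have h1 := le_rpow_of_mul_rpow_le (norm_nonneg _) hS.c_pos hS.one_lt_ξ
    (h.norm_average_sub_central_le hS.regular hμ hS.β_pos (hS.central μ hμ) hK hS.c_pos hS.one_lt_ξ
      hxi)
  rw [← Real.mul_rpow (by norm_num) (by positivity)]
  convert h1 using 2
  field_simp

/-- The bounds for the average iterate. The factor `1 / 2` gained in `norm_average_sub_le` and the
slack of the gap function on the central path absorb the infeasibility of the average. -/
theorem eventually_average_le (hS : IsSetting P F L c ξ μinit β δ xstar xμ lμ)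
    (hM : 0 < supNorm F P.feasible) (y₀ l₀ : Vec n) :
    ∀ᶠ K : ℕ in Filter.atTop, ∀ T, ∀ x y lam,
      IsACVIRun P F μinit β δ y₀ l₀ T K x y lam → ∀ t < T, XiMonotoneOp F P.eqSet c ξ →
        ‖average (x t) K - xstar‖ ≤ avgBound m c ξ (muSeq μinit δ t)
          (Delta β (y t 0) (lam t 0) (xμ (muSeq μinit δ t)) (lμ (muSeq μinit δ t))) K ∧
        gap F P.feasible (average (x t) K)
          ≤ (maxDist P.feasible xstar * L + supNorm F P.feasible) *
            avgBound m c ξ (muSeq μinit δ t)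
              (Delta β (y t 0) (lam t 0) (xμ (muSeq μinit δ t)) (lμ (muSeq μinit δ t))) K := by
  obtain ⟨B, hB, D, -, hev⟩ := hS.exists_run_bounds y₀ l₀
  obtain ⟨γ, hγ, hslack⟩ := hS.exists_central_gap_slack hM
  have hL := hS.L_pos
  have hc := hS.c_pos
  have hξ : 0 < ξ := by linarith [hS.one_lt_ξ]
  have hD0 := hS.maxDist_nonneg
  set M := supNorm F P.feasible
  set Dm := maxDist P.feasible xstar
  set θ := (1 / 2 : ℝ) ^ (1 / ξ)
  have hθ0 : 0 ≤ θ := by positivity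
  have hθ1 : θ < 1 := Real.rpow_lt_one (by norm_num) (by norm_num) (by positivity)
  have hM₀ : 0 < Dm * L + M := by positivity
  have hsmall : Filter.Tendsto (fun K : ℕ => (B / (c * K)) ^ (1 / ξ)) Filter.atTop (nhds 0) := by
    have h1 : Filter.Tendsto (fun K : ℕ => B / (c * (K : ℝ))) Filter.atTop (nhds 0) :=
      Filter.Tendsto.div_atTop tendsto_const_nhds
        (Filter.Tendsto.const_mul_atTop hc tendsto_natCast_atTop_atTop)
    have h2 := h1.rpow_const (p := 1 / ξ) (Or.inr (by positivity))
    rwa [Real.zero_rpow (by positivity)] at h2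
  filter_upwards [hev, hsmall.eventually_le_const (show 0 < γ / L by positivity),
    hsmall.eventually_le_const (show 0 < (Dm * L + M) * (1 - θ) / L from
      div_pos (mul_pos hM₀ (by linarith)) hL)] with K hK hK1 hK2 T x y lam hrun t ht hxi
  obtain ⟨hK0, hK⟩ := hK
  obtain ⟨h1, -, -, -⟩ := hK T x y lam hrun t ht
  have hloop := hrun.isInnerLoop hS.regular hS.β_pos ht
  have hμt := muSeq_pos hS.μinit_pos hS.δ_pos t
  have hρ := hS.norm_average_sub_le hμt (by omega) hloop hxi
  have he := hS.norm_central_sub_le hμt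
  have hΔ := Delta_nonneg hS.β_pos (y t 0) (lam t 0) (xμ (muSeq μinit δ t))
    (lμ (muSeq μinit δ t))
  have hg := hslack _ hμt
  have hxe := hloop.average_mem (by omega)
  have hwf := hS.central_mem hμt
  unfold avgBound
  set Δ := Delta β (y t 0) (lam t 0) (xμ (muSeq μinit δ t)) (lμ (muSeq μinit δ t))
  set w := xμ (muSeq μinit δ t)
  set e := ((m : ℝ) / c * muSeq μinit δ t) ^ (1 / ξ)
  have he0 : 0 ≤ e := (norm_nonneg _).trans he
  have hsB : (Δ / (c * K)) ^ (1 / ξ) ≤ (B / (c * K)) ^ (1 / ξ) :=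
    Real.rpow_le_rpow (by positivity) (div_le_div_of_nonneg_right h1 (by positivity))
      (by positivity)
  have hs0 : 0 ≤ (Δ / (c * K)) ^ (1 / ξ) := by positivity
  set s := (Δ / (c * K)) ^ (1 / ξ)
  set a := average (x t) K
  have hρs : ‖a - w‖ ≤ s := hρ.trans (mul_le_of_le_one_left hs0 hθ1.le)
  refine ⟨?_, gap_le_of_forall hS.regular fun z hz => ?_⟩
  · have := norm_add_le (a - w) (w - xstar)
    rw [sub_add_sub_cancel] at this
    linarith
  · have e1 : inner ℝ (F a) (a - z) = inner ℝ (F a - F w) (a - z) + inner ℝ (F w) (a - w)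
        + inner ℝ (F w) (w - z) := by simp only [inner_sub_left, inner_sub_right]; ring
    have hρ0 := norm_nonneg (a - w)
    have h2 : ‖a - z‖ ≤ ‖a - w‖ + e + Dm := by
      have e2 : a - z = (a - w) + (w - xstar) + (xstar - z) := by abel
      rw [e2]
      have h3 := norm_sub_le_maxDist hS.regular xstar hz
      exact (norm_add₃_le).trans (add_le_add (add_le_add le_rfl he) h3)
    have h3 : inner ℝ (F a - F w) (a - z) ≤ L * ‖a - w‖ * (‖a - w‖ + e + Dm) :=
      (real_inner_le_norm _ _).trans (mul_le_mul (hS.lip a hxe w hwf.2) h2 (norm_nonneg _)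
        (by positivity))
    have h4 : inner ℝ (F w) (a - w) ≤ M * ‖a - w‖ := (real_inner_le_norm _ _).trans
      (mul_le_mul_of_nonneg_right (norm_le_supNorm hS.regular hS.lip hwf) hρ0)
    have h5 := hg z hz
    have h6 : L * ‖a - w‖ ≤ γ := by
      have := (hρs.trans hsB).trans hK1
      rw [le_div_iff₀ hL] at this
      linarith
    have h7 : L * ‖a - w‖ ≤ (Dm * L + M) * (1 - θ) := by
      have := (hρs.trans hsB).trans hK2
      rw [le_div_iff₀ hL] at this
      linarith
    have h8 := mul_le_mul_of_nonneg_right h6 he0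
    have h9 : L * ‖a - w‖ * ‖a - w‖ ≤ (Dm * L + M) * (1 - θ) * s :=
      mul_le_mul h7 hρs hρ0 (mul_nonneg hM₀.le (by linarith))
    have h10 := mul_le_mul_of_nonneg_left hρ hM₀.le
    rw [e1]
    linarith

/-- If the affine subspace is a single point, all bounds hold trivially. -/
theorem explicitBounds_of_eqSet_subset (hS : IsSetting P F L c ξ μinit β δ xstar xμ lμ)
    (huniq : ∀ x ∈ P.eqSet, x = xstar) {y₀ l₀ : Vec n} {T K : ℕ} (hK : 1 ≤ K)
    {x y lam : ℕ → ℕ → Vec n} (hrun : IsACVIRun P F μinit β δ y₀ l₀ T K x y lam) {t : ℕ}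
    (ht : t < T) : ExplicitBounds P F L c ξ xstar μinit β δ xμ lμ K x y lam t := by
  have hloop := hrun.isInnerLoop hS.regular hS.β_pos ht
  have hμt := muSeq_pos hS.μinit_pos hS.δ_pos t
  have hΔ := Delta_nonneg hS.β_pos (y t 0) (lam t 0) (xμ (muSeq μinit δ t))
    (lμ (muSeq μinit δ t))
  have hM₀ : 0 ≤ maxDist P.feasible xstar * L + supNorm F P.feasible :=
    add_nonneg (mul_nonneg hS.maxDist_nonneg hS.L_pos.le) hS.supNorm_nonneg
  have hgap : gap F P.feasible xstar ≤ 0 := gap_le_of_forall hS.regular fun z hz => by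
    rw [huniq z hz.2, sub_self, inner_zero_right]
  have hx : x t K = xstar := by
    obtain ⟨k, rfl⟩ : ∃ k, K = k + 1 := ⟨K - 1, by omega⟩
    exact huniq _ (hloop.x_mem k (by omega))
  have hb1 := lastBound_nonneg (m := m) (ξ := ξ) (β := β) hS.c_pos hS.L_pos hS.δ_pos hS.μinit_pos
    hS.supNorm_nonneg hΔ (norm_nonneg (lμ (muSeq μinit δ t))) t K
  have hb2 := avgBound_nonneg (m := m) (ξ := ξ) hS.c_pos hμt hΔ K
  refine ⟨?_, fun _ => ?_⟩
  · rw [hx, sub_self, norm_zero]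
    exact ⟨hb1, hgap.trans (mul_nonneg hM₀ hb1)⟩
  · rw [huniq _ (hloop.average_mem hK), sub_self, norm_zero]
    exact ⟨hb2, hgap.trans (mul_nonneg hM₀ hb2)⟩

theorem eventually_explicitBounds (hS : IsSetting P F L c ξ μinit β δ xstar xμ lμ)
    (y₀ l₀ : Vec n) (t : ℕ) :
    ∀ᶠ K : ℕ in Filter.atTop, ∀ T, ∀ x y lam, IsACVIRun P F μinit β δ y₀ l₀ T K x y lam → t < T →
      ExplicitBounds P F L c ξ xstar μinit β δ xμ lμ K x y lam t := by
  rcases hS.nondegenerate_or with ⟨hm, hM⟩ | huniq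
  · obtain ⟨B, hB, D, hD, hev⟩ := hS.exists_run_bounds y₀ l₀
    obtain ⟨θ, hθ0, hθ1, hlast⟩ := hS.exists_last_le hm y₀ l₀ t
    have hM₀ : 0 < maxDist P.feasible xstar * L + supNorm F P.feasible :=
      add_pos_of_nonneg_of_pos (mul_nonneg hS.maxDist_nonneg hS.L_pos.le) hM
    filter_upwards [hev, hlast, hS.eventually_average_le hM y₀ l₀,
      eventually_div_sqrt_le (L * D) (mul_pos hM₀ (sub_pos.2 hθ1))]
      with K hK hKl hKa hKD T x y lam hrun ht
    obtain ⟨-, h2, -, z, hz, h3⟩ := hK.2 T x y lam hrun t ht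
    rw [mul_div_assoc] at hKD
    exact ⟨hS.le_and_gap_le_of_le_mul h2 hz h3 hθ1 (lastBound_nonneg hS.c_pos hS.L_pos
      hS.δ_pos hS.μinit_pos hS.supNorm_nonneg (Delta_nonneg hS.β_pos _ _ _ _) (norm_nonneg _) _ _)
      (hKl T x y lam hrun ht) hKD, hKa T x y lam hrun t ht⟩
  · filter_upwards [Filter.eventually_ge_atTop 1] with K hK T x y lam hrun ht
    exact hS.explicitBounds_of_eqSet_subset huniq hK hrun ht

theorem eventually_explicitBounds_of_hatSet (hS : IsSetting P F L c ξ μinit β δ xstar xμ lμ)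
    (y₀ l₀ : Vec n) {r : ℝ} (hr : 0 < r) (hstar : StarXiMonotoneOp F (P.hatSet r) xstar c ξ) :
    ∀ᶠ K : ℕ in Filter.atTop, ∀ T, ∀ x y lam, IsACVIRun P F μinit β δ y₀ l₀ T K x y lam →
      ∀ t < T, ExplicitBounds P F L c ξ xstar μinit β δ xμ lμ K x y lam t := by
  rcases hS.nondegenerate_or with ⟨hm, hM⟩ | huniq
  · obtain ⟨B, hB, D, hD, hev⟩ := hS.exists_run_bounds y₀ l₀
    obtain ⟨θ, hθ0, hθ1, hlast⟩ := hS.exists_last_le_of_hatSet hm y₀ l₀ hr hstar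
    have hM₀ : 0 < maxDist P.feasible xstar * L + supNorm F P.feasible :=
      add_pos_of_nonneg_of_pos (mul_nonneg hS.maxDist_nonneg hS.L_pos.le) hM
    filter_upwards [hev, hlast, hS.eventually_average_le hM y₀ l₀,
      eventually_div_sqrt_le (L * D) (mul_pos hM₀ (sub_pos.2 hθ1))]
      with K hK hKl hKa hKD T x y lam hrun t ht
    obtain ⟨-, h2, -, z, hz, h3⟩ := hK.2 T x y lam hrun t ht
    rw [mul_div_assoc] at hKD
    exact ⟨hS.le_and_gap_le_of_le_mul h2 hz h3 hθ1 (lastBound_nonneg hS.c_pos hS.L_pos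
      hS.δ_pos hS.μinit_pos hS.supNorm_nonneg (Delta_nonneg hS.β_pos _ _ _ _) (norm_nonneg _) _ _)
      (hKl T x y lam hrun t ht) hKD, hKa T x y lam hrun t ht⟩
  · filter_upwards [Filter.eventually_ge_atTop 1] with K hK T x y lam hrun t ht
    exact hS.explicitBounds_of_eqSet_subset huniq hK hrun ht

end IsSetting

/-! ### Rates in the number of inner iterations -/

theorem rpow_muSeq_le_div (hc : 0 < c) (hξ : 0 < ξ) (hμ : 0 < μinit) (hδ₀ : 0 < δ) (hδ₁ : δ < 1)
    {t K : ℕ} (hK : 1 ≤ K) (ht : ξ / -Real.log δ * Real.log K ≤ t) :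
    (m / c * muSeq μinit δ t) ^ (1 / ξ) ≤ (m / c * μinit) ^ (1 / ξ) / K := by
  have hK' : (0 : ℝ) < K := by exact_mod_cast hK
  rw [rpow_muSeq hc hμ hδ₀, div_eq_mul_inv]
  refine mul_le_mul_of_nonneg_left ?_ (by positivity)
  have hlog : Real.log δ < 0 := Real.log_neg hδ₀ hδ₁
  rw [Real.rpow_def_of_pos hδ₀, ← Real.exp_log (inv_pos.2 hK'), Real.exp_le_exp, Real.log_inv]
  rw [div_mul_eq_mul_div, div_le_iff₀ (by linarith)] at ht
  rw [mul_div_assoc', div_le_iff₀ hξ]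
  nlinarith

namespace IsSetting

theorem exists_last_rate (hS : IsSetting P F L c ξ μinit β δ xstar xμ lμ) (y₀ l₀ : Vec n) :
    ∃ Q ≥ 0, ∀ᶠ K : ℕ in Filter.atTop, ∀ T, ∀ x y lam,
      IsACVIRun P F μinit β δ y₀ l₀ T K x y lam → ∀ t < T, ξ / -Real.log δ * Real.log K ≤ t →
        ‖x t K - xstar‖ ≤ Q / (K : ℝ) ^ (1 / (2 * ξ)) ∧
        gap F P.feasible (x t K) ≤ Q / (K : ℝ) ^ (1 / (2 * ξ)) := by
  obtain ⟨B, hB, D, hD, hev⟩ := hS.exists_run_bounds y₀ l₀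
  have hL := hS.L_pos
  have hβ := hS.β_pos
  have hc := hS.c_pos
  have hδ := hS.δ_pos
  have hμ := hS.μinit_pos
  have hξ1 := hS.one_lt_ξ
  have hξ : 0 < ξ := by linarith
  have hDm := hS.maxDist_nonneg
  have hM := hS.supNorm_nonneg
  set M := supNorm F P.feasible
  set Dm := maxDist P.feasible xstar
  set e₀ := ((m : ℝ) / c * μinit) ^ (1 / ξ)
  have he₀ : 0 ≤ e₀ := by positivity
  set E := 2 * B + L * e₀ * (2 * √(B / β) + e₀) + L * (2 * Dm + 1) * D with hE
  have hE0 : 0 ≤ E := by positivity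
  set Q₀ := (E / c) ^ (1 / ξ) + D with hQ₀
  have hQ₀0 : 0 ≤ Q₀ := by positivity
  refine ⟨Q₀ + (Dm * L + M + L) * Q₀, by positivity, ?_⟩
  filter_upwards [hev, eventually_div_sqrt_le D one_pos] with K hK hK1 T x y lam hrun t ht hlog
  obtain ⟨hK2, hK⟩ := hK
  obtain ⟨h1, h2, -, z, hz, h3⟩ := hK T x y lam hrun t ht
  have hK' : (1 : ℝ) ≤ K := by exact_mod_cast (by omega : 1 ≤ K)
  have hs : 0 < √(K : ℝ) := Real.sqrt_pos.2 (by linarith)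
  have hsK : √(K : ℝ) ≤ K := Real.sqrt_le_self_iff.2 (Or.inr hK')
  have hμt := muSeq_pos hμ hδ t
  have h4 := hS.mul_norm_rpow_le_of_near h2 hz h3 hK1
  have h5 := hS.inner_last_sub_le hμt hK2 (hrun.isInnerLoop hS.regular hβ ht)
  have he := rpow_muSeq_le_div (m := m) hc hξ hμ hδ hS.δ_lt_one (by omega) hlog
  have he0 : 0 ≤ ((m : ℝ) / c * muSeq μinit δ t) ^ (1 / ξ) := by positivity
  have hΔ := Delta_nonneg hβ (y t 0) (lam t 0) (xμ (muSeq μinit δ t)) (lμ (muSeq μinit δ t))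
  set Δ := Delta β (y t 0) (lam t 0) (xμ (muSeq μinit δ t)) (lμ (muSeq μinit δ t))
  set e := ((m : ℝ) / c * muSeq μinit δ t) ^ (1 / ξ)
  have hes : e ≤ e₀ / √K := he.trans (by gcongr)
  have hee₀ : e ≤ e₀ := he.trans (div_le_self he₀ hK')
  have h6 : L * e * (2 * √(Δ / β) + e) ≤ L * (e₀ / √K) * (2 * √(B / β) + e₀) := by
    gcongr
  have h7 : c * ‖z - xstar‖ ^ ξ ≤ E / √K := by
    have h8 : 2 * Δ / √K ≤ 2 * B / √K := by gcongr
    have e1 : E / √K = 2 * B / √K + L * (e₀ / √K) * (2 * √(B / β) + e₀)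
        + L * (2 * Dm + 1) * (D / √K) := by rw [hE]; ring
    linarith
  have h8 := le_rpow_of_mul_rpow_le (norm_nonneg _) hc hξ1 h7
  have e2 : (E / √K / c) ^ (1 / ξ) = (E / c) ^ (1 / ξ) / (K : ℝ) ^ (1 / (2 * ξ)) := by
    rw [div_right_comm, Real.div_rpow (by positivity) hs.le, Real.sqrt_eq_rpow,
      ← Real.rpow_mul (by linarith)]
    congr 2
    field_simp
  rw [e2] at h8
  have hKpow : 0 < (K : ℝ) ^ (1 / (2 * ξ)) := Real.rpow_pos_of_pos (by linarith) _
  have h9 : D / √K ≤ D / (K : ℝ) ^ (1 / (2 * ξ)) := by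
    refine div_le_div_of_nonneg_left hD hKpow ?_
    rw [Real.sqrt_eq_rpow]
    refine Real.rpow_le_rpow_of_exponent_le hK' ?_
    rw [div_le_div_iff₀ (by positivity) two_pos]
    linarith
  have h10 : ‖x t K - xstar‖ ≤ Q₀ / (K : ℝ) ^ (1 / (2 * ξ)) := by
    have := norm_add_le (x t K - z) (z - xstar)
    rw [sub_add_sub_cancel] at this
    rw [hQ₀, add_div]
    linarith
  have hgap := hS.gap_le h2 hz (h3.trans hK1)
  rw [mul_one] at hgap
  have h11 := mul_le_mul_of_nonneg_left h10 (show 0 ≤ Dm * L + M + L by positivity)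
  have h12 : 0 ≤ Q₀ / (K : ℝ) ^ (1 / (2 * ξ)) := by positivity
  have h13 : 0 ≤ (Dm * L + M + L) * (Q₀ / (K : ℝ) ^ (1 / (2 * ξ))) := by positivity
  rw [add_div, mul_div_assoc]
  exact ⟨by linarith, by linarith⟩

theorem exists_average_rate (hS : IsSetting P F L c ξ μinit β δ xstar xμ lμ) (y₀ l₀ : Vec n) :
    ∃ Q ≥ 0, ∀ᶠ K : ℕ in Filter.atTop, ∀ T, ∀ x y lam,
      IsACVIRun P F μinit β δ y₀ l₀ T K x y lam → ∀ t < T, ξ / -Real.log δ * Real.log K ≤ t →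
        XiMonotoneOp F P.eqSet c ξ →
        ‖average (x t) K - xstar‖ ≤ Q / (K : ℝ) ^ (1 / ξ) ∧
        gap F P.feasible (average (x t) K) ≤ Q / (K : ℝ) ^ (1 / ξ) := by
  obtain ⟨B, hB, D, hD, hev⟩ := hS.exists_run_bounds y₀ l₀
  have hL := hS.L_pos
  have hβ := hS.β_pos
  have hc := hS.c_pos
  have hδ := hS.δ_pos
  have hμ := hS.μinit_pos
  have hξ1 := hS.one_lt_ξ
  have hξ : 0 < ξ := by linarith
  have hDm := hS.maxDist_nonneg
  have hM := hS.supNorm_nonneg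
  set M := supNorm F P.feasible
  set Dm := maxDist P.feasible xstar
  set e₀ := ((m : ℝ) / c * μinit) ^ (1 / ξ)
  have he₀ : 0 ≤ e₀ := by positivity
  set b := (B / c) ^ (1 / ξ)
  have hb : 0 ≤ b := by positivity
  refine ⟨(b + e₀) + (Dm * L + M + L * b) * (b + e₀), by positivity, ?_⟩
  filter_upwards [hev] with K hK T x y lam hrun t ht hlog hxi
  obtain ⟨hK2, hK⟩ := hK
  obtain ⟨h1, -, -, -⟩ := hK T x y lam hrun t ht
  have hK' : (1 : ℝ) ≤ K := by exact_mod_cast (by omega : 1 ≤ K)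
  have hμt := muSeq_pos hμ hδ t
  have hloop := hrun.isInnerLoop hS.regular hβ ht
  have hΔ := Delta_nonneg hβ (y t 0) (lam t 0) (xμ (muSeq μinit δ t)) (lμ (muSeq μinit δ t))
  have hKpow : 1 ≤ (K : ℝ) ^ (1 / ξ) := Real.one_le_rpow hK' (by positivity)
  have hρ : ‖average (x t) K - xμ (muSeq μinit δ t)‖ ≤ b / (K : ℝ) ^ (1 / ξ) := by
    refine (hS.norm_average_sub_le hμt (by omega) hloop hxi).trans ?_
    refine (mul_le_of_le_one_left (by positivity)
      (Real.rpow_le_one (by norm_num) (by norm_num) (by positivity))).trans ?_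
    rw [← Real.div_rpow (by positivity) (by positivity), div_div]
    exact Real.rpow_le_rpow (by positivity) (by gcongr) (by positivity)
  have he : ‖xμ (muSeq μinit δ t) - xstar‖ ≤ e₀ / (K : ℝ) ^ (1 / ξ) := by
    refine (hS.norm_central_sub_le hμt).trans
      ((rpow_muSeq_le_div (m := m) hc hξ hμ hδ hS.δ_lt_one (by omega) hlog).trans ?_)
    refine div_le_div_of_nonneg_left he₀ (by linarith) ?_
    have := Real.rpow_le_rpow_of_exponent_le hK' (show 1 / ξ ≤ 1 by
      rw [div_le_one hξ]; exact hξ1.le)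
    rwa [Real.rpow_one] at this
  have h10 : ‖average (x t) K - xstar‖ ≤ (b + e₀) / (K : ℝ) ^ (1 / ξ) := by
    have := norm_add_le (average (x t) K - xμ (muSeq μinit δ t)) (xμ (muSeq μinit δ t) - xstar)
    rw [sub_add_sub_cancel] at this
    rw [add_div]
    linarith
  have hgap := hS.gap_le (hloop.average_mem (by omega)) (hS.central_mem hμt)
    (hρ.trans (div_le_self hb hKpow))
  have h11 := mul_le_mul_of_nonneg_left h10 (show 0 ≤ Dm * L + M + L * b by positivity)
  have h12 : 0 ≤ (b + e₀) / (K : ℝ) ^ (1 / ξ) := by positivity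
  have h13 : 0 ≤ (Dm * L + M + L * b) * ((b + e₀) / (K : ℝ) ^ (1 / ξ)) := by positivity
  rw [add_div, mul_div_assoc]
  exact ⟨by linarith, by linarith⟩

end IsSetting

end Bounds

end ACVI

theorem mainTheorem4 {n m p : ℕ} (P : ACVI.Constraints n m p) (hP : P.Regular)
    (F : ACVI.Vec n → ACVI.Vec n) (L : ℝ) (hL : 0 < L)
    (hmono : ACVI.MonotoneOp F P.eqSet) (hLip : ACVI.LipschitzOp F P.eqSet L)
    (hstrict : ACVI.StrictMonotoneOp F P.feasible ∨ ∃ i, StrictConvexOn ℝ Set.univ (P.φ i))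
    (xstar : ACVI.Vec n) (hsol : ACVI.IsVISolution F P.feasible xstar)
    (c ξ : ℝ) (hc : 0 < c) (hξ : 1 < ξ)
    (hstar : (∃ r > 0, ACVI.StarXiMonotoneOp F (P.hatSet r) xstar c ξ) ∨
      (∃ s > 0, ACVI.StarXiMonotoneOp F (P.tildeSet s) xstar c ξ))
    (μinit β δ : ℝ) (hμ : 0 < μinit) (hβ : 0 < β) (hδ₀ : 0 < δ) (hδ₁ : δ < 1)
    (y₀ l₀ : ACVI.Vec n) :
    -- the central path, its multipliers and the iterates are well defined
    (∀ μ > 0, ∃! z : ACVI.Vec n × ACVI.Vec n, ACVI.IsCentralPair P F μ z.1 z.2) ∧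
    (∀ T K : ℕ, ∃ x y lam : ℕ → ℕ → ACVI.Vec n,
      ACVI.IsACVIRun P F μinit β δ y₀ l₀ T K x y lam) ∧
    -- the explicit bounds
    (∀ xμ lμ : ℝ → ACVI.Vec n, (∀ μ > 0, ACVI.IsCentralPair P F μ (xμ μ) (lμ μ)) →
      (∀ T : ℕ, ∃ K₀ : ℕ, ∀ K > K₀, ∀ x y lam : ℕ → ℕ → ACVI.Vec n,
        ACVI.IsACVIRun P F μinit β δ y₀ l₀ T K x y lam → ∀ t < T,
          ACVI.ExplicitBounds P F L c ξ xstar μinit β δ xμ lμ K x y lam t) ∧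
      -- in the first case of `hstar`, the threshold does not depend on `T` either
      ((∃ r > 0, ACVI.StarXiMonotoneOp F (P.hatSet r) xstar c ξ) →
        ∃ K₀ : ℕ, ∀ T : ℕ, ∀ K > K₀, ∀ x y lam : ℕ → ℕ → ACVI.Vec n,
          ACVI.IsACVIRun P F μinit β δ y₀ l₀ T K x y lam → ∀ t < T,
            ACVI.ExplicitBounds P F L c ξ xstar μinit β δ xμ lμ K x y lam t)) ∧
    -- the rates in `K` alone, once `t` is at least of order `log K`
    (∃ A B : ℝ, ∃ K₀ : ℕ, ∀ T : ℕ, ∀ K > K₀, ∀ x y lam : ℕ → ℕ → ACVI.Vec n,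
      ACVI.IsACVIRun P F μinit β δ y₀ l₀ T K x y lam → ∀ t < T, A * Real.log K ≤ t →
        (‖x t K - xstar‖ ≤ B / (K : ℝ) ^ (1 / (2 * ξ)) ∧
          ACVI.gap F P.feasible (x t K) ≤ B / (K : ℝ) ^ (1 / (2 * ξ))) ∧
        (ACVI.XiMonotoneOp F P.eqSet c ξ →
          ‖ACVI.average (x t) K - xstar‖ ≤ B / (K : ℝ) ^ (1 / ξ) ∧
          ACVI.gap F P.feasible (ACVI.average (x t) K) ≤ B / (K : ℝ) ^ (1 / ξ))) := by
  have hstarC : ACVI.StarXiMonotoneOp F P.feasible xstar c ξ := by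
    rcases hstar with ⟨r, hr, h⟩ | ⟨s, hs, h⟩
    · exact fun x hx => h x ⟨hx.2, fun i => (hx.1 i).trans hr.le⟩
    · refine fun x hx => h x ⟨?_, hx.1⟩
      have hx2 : Matrix.toEuclideanLin P.C x = P.d := hx.2
      rw [hx2, sub_self, norm_zero]
      exact hs.le
  have hex := fun μ (hμ : 0 < μ) =>
    ACVI.existsUnique_isCentralPair hP hL hmono hLip hstrict hμ
  have hset : ∀ xμ lμ : ℝ → ACVI.Vec n, (∀ μ > 0, ACVI.IsCentralPair P F μ (xμ μ) (lμ μ)) →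
      ACVI.IsSetting P F L c ξ μinit β δ xstar xμ lμ := fun xμ lμ h =>
    ⟨hP, hL, hmono, hLip, hsol, hstarC, hc, hξ, hμ, hβ, hδ₀, hδ₁, h⟩
  refine ⟨hex, ACVI.exists_isACVIRun hP hL hmono hLip hμ hβ hδ₀ y₀ l₀,
    fun xμ lμ hcent => ⟨fun T => ?_, ?_⟩, ?_⟩
  · have h : ∀ᶠ K : ℕ in Filter.atTop, ∀ t ∈ Finset.range T, ∀ T', ∀ x y lam,
        ACVI.IsACVIRun P F μinit β δ y₀ l₀ T' K x y lam → t < T' →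
        ACVI.ExplicitBounds P F L c ξ xstar μinit β δ xμ lμ K x y lam t :=
      (Filter.eventually_all_finset _).2 fun t _ =>
        (hset xμ lμ hcent).eventually_explicitBounds y₀ l₀ t
    obtain ⟨K₀, hK₀⟩ := Filter.eventually_atTop.1 h
    exact ⟨K₀, fun K hK x y lam hrun t ht =>
      hK₀ K hK.le t (Finset.mem_range.2 ht) T x y lam hrun ht⟩
  · rintro ⟨r, hr, h⟩
    obtain ⟨K₀, hK₀⟩ := Filter.eventually_atTop.1
      ((hset xμ lμ hcent).eventually_explicitBounds_of_hatSet y₀ l₀ hr h)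
    exact ⟨K₀, fun T K hK => hK₀ K hK.le T⟩
  · choose! z hz using fun μ hμ => (hex μ hμ).exists
    have hS := hset (fun μ => (z μ).1) (fun μ => (z μ).2) hz
    obtain ⟨Q₁, hQ₁, h₁⟩ := hS.exists_last_rate y₀ l₀
    obtain ⟨Q₂, hQ₂, h₂⟩ := hS.exists_average_rate y₀ l₀
    obtain ⟨K₀, hK₀⟩ := Filter.eventually_atTop.1 (h₁.and h₂)
    refine ⟨ξ / -Real.log δ, Q₁ + Q₂, K₀, fun T K hK x y lam hrun t ht hlog => ?_⟩
    obtain ⟨hl, ha⟩ := hK₀ K hK.le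
    have hle₁ : ∀ s : ℝ, Q₁ / (K : ℝ) ^ s ≤ (Q₁ + Q₂) / (K : ℝ) ^ s := fun s =>
      div_le_div_of_nonneg_right (by linarith) (by positivity)
    have hle₂ : ∀ s : ℝ, Q₂ / (K : ℝ) ^ s ≤ (Q₁ + Q₂) / (K : ℝ) ^ s := fun s =>
      div_le_div_of_nonneg_right (by linarith) (by positivity)
    refine ⟨?_, fun hxi => ?_⟩
    · obtain ⟨h3, h4⟩ := hl T x y lam hrun t ht hlog
      exact ⟨h3.trans (hle₁ _), h4.trans (hle₁ _)⟩
    · obtain ⟨h3, h4⟩ := ha T x y lam hrun t ht hlog hxi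
      exact ⟨h3.trans (hle₂ _), h4.trans (hle₂ _)⟩
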